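/- \textbf{Definitions.} A permutation $\sigma$ of $\{1,\dots,n\}$ is \emph{simple} if the only intervals $\{i,\dots,i+l\}$ that it maps onto intervals $\{j,\dots,j+l\}$ are those with $l=0$ or with $i=j=1$, $l=n-1$. Two points of its diagram $\{(i,\sigma_i)\}$ are in \emph{knight position} if their columns and their rows differ by $1$ and $2$, or by $2$ and $1$. A pin (a point of $\mathbb Z^2$) $p$ \emph{separates} $P$ from $Q$ if the horizontal or the vertical line through $p$ has $P$ on one side and $Q$ on the other; it is \emph{independent} from a set of pins if it does not separate it into two nonempty sets. A \emph{pin sequence} is a sequence $(p_1,\dots,p_k)$ of pins, no two in the same row or column, such that for all $i\ge 2$ the pin $p_i$ is outside the bounding box of $\{p_1,\dots,p_{i-1}\}$ and either separates $p_{i-1}$ from $\{p_1,\dots,p_{i-2}\}$ or is independent from $\{p_1,\dots,p_{i-1}\}$. A \emph{pin representation} of $\sigma$ is a pin sequence that is order isomorphic to the diagram of $\sigma$; it is \emph{proper} if $p_i$ separates $p_{i-1}$ from $\{p_1,\dots,p_{i-2}\}$ for all $i\ge 3$. A \emph{pin-permutation} is a permutation that has a pin representation. A \emph{pin word} encoding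 $\sigma$ is a word $w_1\cdots w_n$ over $\{1,2,3,4,U,D,L,R\}$ obtained from a pin representation $(p_1,\dots,p_n)$ of $\sigma$ and an origin $p_0$ such that $(p_0,p_1,\dots,p_n)$ is a pin sequence: $w_i$ is $U$ (resp. $D,L,R$) if $i\ge 2$ and $p_i$ separates $p_{i-1}$ from $\{p_0,\dots,p_{i-2}\}$ from the top (resp. bottom, left, right), and $w_i$ is $1$ (resp. $2,3,4$) if $p_i$ is independent from $\{p_0,\dots,p_{i-1}\}$ and lies up-right (resp. up-left, bottom-left, bottom-right) of the bounding box of $\{p_0,\dots,p_{i-1}\}$. \textbf{Procedure} \textsc{PinWords}$(\sigma)$. \begin{enumerate} \item Compute $\sigma^{-1}$. For each point of the diagram, inspect the eight cells in knight position with it, and collect the set $E$ of all ordered pairs of points in knight position. \item If $|E|>48$, return $\varnothing$. \item For each pair in $E$, compute the proper pin representation of $\sigma$ beginning with that pair, if there is one, by repeatedly looking for the next pin in a column or row adjacent to that of the last pin; if the representation exists, output its pin words for the (at most eight) possible placements of the origin relative to its first two pins. \end{enumerate} The procedure is run as a program on a unit-cost random access machine (registers and arrays of integers, addition of constants, comparisons,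 bounded loops, output of letters one at a time). \textbf{Lemma.} \begin{enumerate} \item There is a constant $C$ such that, for every $n\ge 3$ and every simple permutation $\sigma$ of length $n$, the procedure \textsc{PinWords} makes at most $C\,n$ steps on input $\sigma$, and the set of words that it outputs is exactly the set of all pin words encoding $\sigma$. \item The diagram of a simple pin-permutation has at most $48$ ordered pairs of points in knight position. \item For every permutation $\sigma$ and every ordered pair of points of its diagram in knight position, at most one proper pin representation of $\sigma$ (as an ordering of the points of its diagram) begins with that pair. \end{enumerate} -/

import Mathlib

namespace PinPerm

/-! ### Simple permutations and knight pairs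

A permutation of length `n` is an element of `Equiv.Perm (Fin n)`: positions and values are numbered
`0, …, n - 1`, and its diagram is the set of points `(x, σ x)`. -/

/-- `σ` is simple: the only intervals `{i, …, i + l}` of positions that `σ` maps onto an interval
`{j, …, j + l}` of values are the one-point intervals and the set of all positions. -/
def IsSimple {n : ℕ} (σ : Equiv.Perm (Fin n)) : Prop :=
  ∀ i j l : ℕ, i + l < n →
    (∀ x : Fin n, (x : ℕ) ∈ Finset.Icc i (i + l) ↔ (σ x : ℕ) ∈ Finset.Icc j (j + l)) →
      l = 0 ∨ (i = 0 ∧ j = 0 ∧ l + 1 = n)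

/-- The points of the diagram of `σ` in columns `x` and `y` are in knight position. -/
def IsKnight {n : ℕ} (σ : Equiv.Perm (Fin n)) (x y : Fin n) : Prop :=
  (|(x : ℤ) - (y : ℤ)| = 1 ∧ |((σ x : ℕ) : ℤ) - ((σ y : ℕ) : ℤ)| = 2) ∨
  (|(x : ℤ) - (y : ℤ)| = 2 ∧ |((σ x : ℕ) : ℤ) - ((σ y : ℕ) : ℤ)| = 1)

/-! ### Pins, pin sequences and pin representations -/

/-- A pin is a point with integer coordinates. -/
abbrev Pin := ℤ × ℤ

/-- The vertical line through `p` has `P` strictly on one side and `Q` strictly on the other. -/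
def SeparatesV (p : Pin) (P Q : Set Pin) : Prop :=
  ((∀ a ∈ P, a.1 < p.1) ∧ (∀ b ∈ Q, p.1 < b.1)) ∨ ((∀ a ∈ P, p.1 < a.1) ∧ (∀ b ∈ Q, b.1 < p.1))

/-- The horizontal line through `p` has `P` strictly on one side and `Q` strictly on the other. -/
def SeparatesH (p : Pin) (P Q : Set Pin) : Prop :=
  ((∀ a ∈ P, a.2 < p.2) ∧ (∀ b ∈ Q, p.2 < b.2)) ∨ ((∀ a ∈ P, p.2 < a.2) ∧ (∀ b ∈ Q, b.2 < p.2))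

def Separates (p : Pin) (P Q : Set Pin) : Prop :=
  SeparatesV p P Q ∨ SeparatesH p P Q

/-- `p` does not separate `S` into two nonempty sets. -/
def Independent (p : Pin) (S : Set Pin) : Prop :=
  ∀ P Q : Set Pin, P.Nonempty → Q.Nonempty → P ∪ Q = S → ¬ Separates p P Q

/-- `p` lies in the (closed) bounding box of `S`. -/
def InBoundingBox (p : Pin) (S : Set Pin) : Prop :=
  ((∃ a ∈ S, a.1 ≤ p.1) ∧ (∃ a ∈ S, p.1 ≤ a.1)) ∧ ((∃ a ∈ S, a.2 ≤ p.2) ∧ (∃ a ∈ S, p.2 ≤ a.2))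

/-- `(p_a, p_{a+1}, …, p_b)` is a pin sequence. -/
def IsPinSequence (p : ℕ → Pin) (a b : ℕ) : Prop :=
  (∀ i ∈ Set.Icc a b, ∀ j ∈ Set.Icc a b, i ≠ j → (p i).1 ≠ (p j).1 ∧ (p i).2 ≠ (p j).2) ∧
  ∀ i, a < i → i ≤ b →
    ¬ InBoundingBox (p i) (p '' Set.Ico a i) ∧
    (Separates (p i) {p (i - 1)} (p '' Set.Ico a (i - 1)) ∨ Independent (p i) (p '' Set.Ico a i))

/-- `(p_1, …, p_n)` is a pin representation of `σ`: it is a pin sequence that is order isomorphic to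
the diagram of `σ`, the pin `p_{k+1}` corresponding to the point of the diagram in column `e k`. -/
def IsPinRepresentation {n : ℕ} (σ : Equiv.Perm (Fin n)) (p : ℕ → Pin) (e : Equiv.Perm (Fin n)) :
    Prop :=
  IsPinSequence p 1 n ∧
  ∀ k l : Fin n,
    ((p (k + 1)).1 < (p (l + 1)).1 ↔ e k < e l) ∧
    ((p (k + 1)).2 < (p (l + 1)).2 ↔ σ (e k) < σ (e l))

def IsPinPermutation {n : ℕ} (σ : Equiv.Perm (Fin n)) : Prop :=
  ∃ p e, IsPinRepresentation σ p e

/-- A proper pin representation: every `p_i` with `i ≥ 3` separates `p_{i-1}` from the earlier pins. -/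
def IsProperPinRepresentation {n : ℕ} (σ : Equiv.Perm (Fin n)) (p : ℕ → Pin)
    (e : Equiv.Perm (Fin n)) : Prop :=
  IsPinRepresentation σ p e ∧
  ∀ i, 3 ≤ i → i ≤ n → Separates (p i) {p (i - 1)} (p '' Set.Ico 1 (i - 1))

/-- The first two pins of the representation correspond to the points in columns `x` and `y`. -/
def BeginsWith {n : ℕ} (e : Equiv.Perm (Fin n)) (x y : Fin n) : Prop :=
  ∀ k : Fin n, ((k : ℕ) = 0 → e k = x) ∧ ((k : ℕ) = 1 → e k = y)

/-! ### Pin words -/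

/-- The alphabet `{1, 2, 3, 4, U, D, L, R}`. -/
inductive Letter
  | one | two | three | four | U | D | L | R
  deriving DecidableEq

/-- `ℓ` is the letter associated with `p_i` in the sequence `(p_0, p_1, …)` with origin `p_0`.
A direction needs at least one pin besides `p_{i-1}` before `p_i`, hence `2 ≤ i`. -/
def HasLetter (p : ℕ → Pin) (i : ℕ) : Letter → Prop
  | .U => 2 ≤ i ∧ SeparatesV (p i) {p (i - 1)} (p '' Set.Ico 0 (i - 1)) ∧
      ∀ a ∈ p '' Set.Ico 0 i, a.2 < (p i).2
  | .D => 2 ≤ i ∧ SeparatesV (p i) {p (i - 1)} (p '' Set.Ico 0 (i - 1)) ∧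
      ∀ a ∈ p '' Set.Ico 0 i, (p i).2 < a.2
  | .L => 2 ≤ i ∧ SeparatesH (p i) {p (i - 1)} (p '' Set.Ico 0 (i - 1)) ∧
      ∀ a ∈ p '' Set.Ico 0 i, (p i).1 < a.1
  | .R => 2 ≤ i ∧ SeparatesH (p i) {p (i - 1)} (p '' Set.Ico 0 (i - 1)) ∧
      ∀ a ∈ p '' Set.Ico 0 i, a.1 < (p i).1
  | .one => Independent (p i) (p '' Set.Ico 0 i) ∧
      ∀ a ∈ p '' Set.Ico 0 i, a.1 < (p i).1 ∧ a.2 < (p i).2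
  | .two => Independent (p i) (p '' Set.Ico 0 i) ∧
      ∀ a ∈ p '' Set.Ico 0 i, (p i).1 < a.1 ∧ a.2 < (p i).2
  | .three => Independent (p i) (p '' Set.Ico 0 i) ∧
      ∀ a ∈ p '' Set.Ico 0 i, (p i).1 < a.1 ∧ (p i).2 < a.2
  | .four => Independent (p i) (p '' Set.Ico 0 i) ∧
      ∀ a ∈ p '' Set.Ico 0 i, a.1 < (p i).1 ∧ (p i).2 < a.2

/-- `w` is a pin word encoding `σ`: for some pin representation `(p_1, …, p_n)` of `σ` and some
origin `p_0` extending it to a pin sequence `(p_0, …, p_n)`, the letters of `w` are those associated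
with `p_1, …, p_n`. -/
def IsPinWordOf {n : ℕ} (w : List Letter) (σ : Equiv.Perm (Fin n)) : Prop :=
  ∃ p e, IsPinRepresentation σ p e ∧ IsPinSequence p 0 n ∧ w.length = n ∧
    ∀ (k : ℕ) (hk : k < w.length), HasLetter p (k + 1) w[k]

/-! ### A random access machine

Programs work on finitely many integer registers and finitely many integer arrays, and write words
on an output. The only arithmetic is the addition of a constant of the program to a register, so
that all numbers handled in `t` steps are `O(t)` larger than those of the input. Every elementary
instruction costs one step. -/

inductive Reg
  /-- length of the permutation -/
  | n
  /-- loop counters -/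
  | i | k | t | s
  /-- number of knight pairs found so far -/
  | m
  /-- scratch values -/
  | v | w
  /-- coordinates of the first two pins -/
  | x1 | y1 | x2 | y2
  /-- the last pin placed -/
  | cx | cy
  /-- bounding box of the pins before the last one -/
  | oldL | oldR | oldD | oldU
  /-- bounding box of all pins placed -/
  | boxL | boxR | boxD | boxU
  /-- candidate for the next pin; the next pin and its direction, once found -/
  | px | py | nx | ny | dir
  /-- flags -/
  | found | alive
  deriving DecidableEq

inductive Arr
  /-- the permutation -/
  | S
  /-- its inverse -/
  | T
  /-- columns of the first and of the second points of the knight pairs -/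
  | E | F
  /-- directions of the pins `p_3, p_4, …` -/
  | G
  deriving DecidableEq

/-- Operands: an integer constant, or a register plus an integer constant. -/
inductive Opd
  | lit (z : ℤ)
  | reg (r : Reg) (z : ℤ)

inductive Cmd
  | skip
  | set (r : Reg) (o : Opd)
  /-- `r := A[o]` -/
  | load (r : Reg) (A : Arr) (o : Opd)
  /-- `A[o] := o'` -/
  | store (A : Arr) (o o' : Opd)
  /-- append a letter to the current word -/
  | emit (l : Letter)
  /-- add the current word to the output and start a new one -/
  | flush
  | seq (c d : Cmd)
  | ifLt (o o' : Opd) (c d : Cmd)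
  | ifEq (o o' : Opd) (c d : Cmd)
  /-- run `c` for `r = 0, 1, …, o - 1`, where `o` is evaluated once, at the beginning -/
  | loop (r : Reg) (o : Opd) (c : Cmd)

structure State where
  reg : Reg → ℤ
  mem : Arr → ℤ → ℤ
  cur : List Letter
  words : List (List Letter)

def Opd.val : Opd → State → ℤ
  | .lit z, _ => z
  | .reg r z, s => s.reg r + z

def State.setReg (s : State) (r : Reg) (z : ℤ) : State :=
  { s with reg := Function.update s.reg r z }

def State.setMem (s : State) (A : Arr) (a z : ℤ) : State :=
  { s with mem := Function.update s.mem A (Function.update (s.mem A) a z) }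

/-- The state after running a program. -/
def Cmd.exec : Cmd → State → State
  | .skip, s => s
  | .set r o, s => s.setReg r (o.val s)
  | .load r A o, s => s.setReg r (s.mem A (o.val s))
  | .store A o o', s => s.setMem A (o.val s) (o'.val s)
  | .emit l, s => { s with cur := s.cur ++ [l] }
  | .flush, s => { s with cur := [], words := s.words ++ [s.cur] }
  | .seq c d, s => d.exec (c.exec s)
  | .ifLt o o' c d, s => if o.val s < o'.val s then c.exec s else d.exec s
  | .ifEq o o' c d, s => if o.val s = o'.val s then c.exec s else d.exec s
  | .loop r o c, s => Nat.rec s (fun j u => c.exec (u.setReg r j)) (o.val s).toNat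

/-- The number of steps made when running a program: one for each elementary instruction, for each
test, for entering a loop and for each iteration of a loop. -/
def Cmd.cost : Cmd → State → ℕ
  | .skip, _ => 1
  | .set _ _, _ => 1
  | .load _ _ _, _ => 1
  | .store _ _ _, _ => 1
  | .emit _, _ => 1
  | .flush, _ => 1
  | .seq c d, s => c.cost s + d.cost (c.exec s)
  | .ifLt o o' c d, s => 1 + if o.val s < o'.val s then c.cost s else d.cost s
  | .ifEq o o' c d, s => 1 + if o.val s = o'.val s then c.cost s else d.cost s
  | .loop r o c, s =>
      1 + ∑ j ∈ Finset.range (o.val s).toNat,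
        (1 + c.cost
          ((Nat.rec s (fun j u => c.exec (u.setReg r j)) j : State).setReg r j))

infixr:60 " ;; " => Cmd.seq

/-- The sequential composition of a list of programs. -/
def seqs (l : List Cmd) : Cmd := l.foldr Cmd.seq Cmd.skip

/-- A register as an operand. -/
def rg (r : Reg) : Opd := .reg r 0

/-! ### The algorithm -/

/-- `T := S⁻¹`. -/
def invert : Cmd :=
  .loop .i (rg .n) (.load .v .S (rg .i) ;; .store .T (rg .v) (rg .i))

/-- If there is a point in the cell at distance `(dx, dy)` from the point `(i, v)`, record the pair. -/
def checkCell (d : ℤ × ℤ) : Cmd :=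
  .ifLt (.reg .i d.1) (.lit 0) .skip <|
  .ifLt (.reg .i d.1) (rg .n)
    (.load .w .S (.reg .i d.1) ;;
      .ifEq (rg .w) (.reg .v d.2)
        (.store .E (rg .m) (rg .i) ;; .store .F (rg .m) (.reg .i d.1) ;; .set .m (.reg .m 1))
        .skip)
    .skip

/-- List all ordered pairs of points in knight position: for each point inspect the eight cells in
knight position with it. -/
def findKnights : Cmd :=
  .set .m (.lit 0) ;;
  .loop .i (rg .n)
    (.load .v .S (rg .i) ;;
      seqs ([(1, 2), (1, -2), (-1, 2), (-1, -2), (2, 1), (2, -1), (-2, 1), (-2, -1)].map checkCell))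

/-- The integer by which a direction is stored in memory. -/
def dirCode : Letter → ℤ
  | .U => 1
  | .D => 2
  | .L => 3
  | .R => 4
  | _ => 0

def accept (l : Letter) : Cmd :=
  .set .found (.lit 1) ;; .set .nx (rg .px) ;; .set .ny (rg .py) ;; .set .dir (.lit (dirCode l))

/-- Accept the point in the column `px` if it lies above or below all pins placed. -/
def tryColumn (o : Opd) : Cmd :=
  .set .px o ;; .load .py .S (rg .px) ;;
  .ifLt (rg .boxU) (rg .py) (accept .U) (.ifLt (rg .py) (rg .boxD) (accept .D) .skip)

/-- Accept the point in the row `py` if it lies to the right or to the left of all pins placed. -/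
def tryRow (o : Opd) : Cmd :=
  .set .py o ;; .load .px .T (rg .py) ;;
  .ifLt (rg .boxR) (rg .px) (accept .R) (.ifLt (rg .px) (rg .boxL) (accept .L) .skip)

/-- Look for a point outside the bounding box of the pins placed that separates the last pin from the
previous ones: it is in a column or in a row next to that of the last pin, and between the last pin
and the previous ones. If there is one, place it; otherwise give up. -/
def extend : Cmd :=
  .set .found (.lit 0) ;;
  .set .boxL (rg .oldL) ;; .ifLt (rg .cx) (rg .boxL) (.set .boxL (rg .cx)) .skip ;;
  .set .boxR (rg .oldR) ;; .ifLt (rg .boxR) (rg .cx) (.set .boxR (rg .cx)) .skip ;;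
  .set .boxD (rg .oldD) ;; .ifLt (rg .cy) (rg .boxD) (.set .boxD (rg .cy)) .skip ;;
  .set .boxU (rg .oldU) ;; .ifLt (rg .boxU) (rg .cy) (.set .boxU (rg .cy)) .skip ;;
  .ifLt (.reg .cx 1) (rg .oldL) (tryColumn (.reg .cx 1)) .skip ;;
  .ifLt (rg .oldR) (.reg .cx (-1)) (tryColumn (.reg .cx (-1))) .skip ;;
  .ifLt (.reg .cy 1) (rg .oldD) (tryRow (.reg .cy 1)) .skip ;;
  .ifLt (rg .oldU) (.reg .cy (-1)) (tryRow (.reg .cy (-1))) .skip ;;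
  .ifEq (rg .found) (.lit 1)
    (.set .oldL (rg .boxL) ;; .set .oldR (rg .boxR) ;;
      .set .oldD (rg .boxD) ;; .set .oldU (rg .boxU) ;;
      .set .cx (rg .nx) ;; .set .cy (rg .ny) ;; .store .G (rg .t) (rg .dir))
    (.set .alive (.lit 0))

/-- Try to compute the proper pin representation beginning with the `k`-th knight pair. -/
def buildRepresentation : Cmd :=
  .load .x1 .E (rg .k) ;; .load .y1 .S (rg .x1) ;;
  .load .x2 .F (rg .k) ;; .load .y2 .S (rg .x2) ;;
  .set .oldL (rg .x1) ;; .set .oldR (rg .x1) ;; .set .oldD (rg .y1) ;; .set .oldU (rg .y1) ;;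
  .set .cx (rg .x2) ;; .set .cy (rg .y2) ;;
  .set .alive (.lit 1) ;;
  .loop .t (.reg .n (-2)) (.ifEq (rg .alive) (.lit 1) extend .skip)

def emitStored (l : Letter) : Cmd :=
  .ifEq (rg .dir) (.lit (dirCode l)) (.emit l) .skip

/-- Output the word that begins with the two given letters and goes on with the stored directions. -/
def outputWord (w : Letter × Letter) : Cmd :=
  .emit w.1 ;; .emit w.2 ;;
  .loop .s (.reg .n (-2))
    (.load .dir .G (rg .s) ;; seqs ([.U, .D, .L, .R].map emitStored)) ;;
  .flush

/-- Output the pin words of a representation for the possible placements of the origin. The first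
three lists give the first two letters of the words: those possible in all cases, those possible when
`p_3` is encoded by `U` or `D`, and those possible when `p_3` is encoded by `L` or `R`. -/
def outputPlacements (always ifUD ifLR : List (Letter × Letter)) : Cmd :=
  seqs (always.map outputWord) ;;
  .load .w .G (.lit 0) ;;
  .ifLt (rg .w) (.lit 3) (seqs (ifUD.map outputWord)) (seqs (ifLR.map outputWord))

/-- Output the pin words of the representation that has just been computed, according to the
quadrant in which the second pin lies with respect to the first one. -/
def outputWords : Cmd :=
  .ifLt (rg .x1) (rg .x2)
    (.ifLt (rg .y1) (rg .y2)
      (outputPlacements [(.one, .one), (.two, .one), (.three, .one), (.four, .one)]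
        [(.three, .R), (.four, .R)] [(.two, .U), (.three, .U)])
      (outputPlacements [(.one, .four), (.two, .four), (.three, .four), (.four, .four)]
        [(.one, .R), (.two, .R)] [(.two, .D), (.three, .D)]))
    (.ifLt (rg .y1) (rg .y2)
      (outputPlacements [(.one, .two), (.two, .two), (.three, .two), (.four, .two)]
        [(.three, .L), (.four, .L)] [(.one, .U), (.four, .U)])
      (outputPlacements [(.one, .three), (.two, .three), (.three, .three), (.four, .three)]
        [(.one, .L), (.two, .L)] [(.one, .D), (.four, .D)]))

/-- The procedure `PinWords`. -/
def pinWords : Cmd :=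
  invert ;; findKnights ;;
  .ifLt (.lit 48) (rg .m)
    .skip
    (.loop .k (rg .m)
      (buildRepresentation ;; .ifEq (rg .alive) (.lit 1) outputWords .skip))

/-- The initial state on input `σ`: the register `n` holds the length of `σ` and the array `S` the
values of `σ`; everything else is zero or empty. -/
def input {n : ℕ} (σ : Equiv.Perm (Fin n)) : State where
  reg := fun r => if r = .n then (n : ℤ) else 0
  mem := fun A a =>
    if A = .S then
      if h : 0 ≤ a ∧ a < n then ((σ ⟨a.toNat, by omega⟩ : ℕ) : ℤ) else 0
    else 0
  cur := []
  words := []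

end PinPerm

/-! Everything rests on one observation: in a proper pin sequence, `p_j` separates its predecessor
from the earlier pins and is extreme in the other coordinate, so in both coordinates it leaves `p_1,
…, p_{j-2}` on the same side (`StepAt.same_side`).

Simplicity forces properness. If some `p_i` with `i ≥ 3` were independent of the earlier pins,
neither `p_i` nor any later pin would cut `p_1, …, p_{i-1}`, and these points would form a forbidden
interval (`IsPinRepresentation.stepAt_of_isSimple`). Representations of simple permutations are
therefore walks on the diagram (`IsWalk`).

A walk through the diagram is determined by its first two points: if another walk with the same
start deviates at step `i`, its point comes later in the first walk, where it would have to cut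
`p_1` from `p_{i-1}` (`IsWalk.eq_of_start`). The same argument shows that each pin is in a row or
column adjacent to that of its predecessor (`FullWalk.eq_sub_one`), so the local search of the
procedure misses nothing, and that the first two pins are in knight position
(`IsWalk.isKnight_start`), so starting from knight pairs suffices.

For the count, `p_i` and `p_j` with `3 ≤ i < j < n` are never in knight position
(`FullWalk.not_near`): the pin `p_{j+1}` already occupies a line between them, and the remaining
room is too small. Hence every knight pair contains `p_1`, `p_2` or `p_n`. A point has at most four
knight neighbours, which gives at most `3 * 8 = 24` ordered pairs.

In a pin word, the letters from the third on are the directions of the walk. The first two depend on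
the origin: the first pin may be in any of four quadrants while the second is independent, or the
second pin separates the first from the origin; the axis of `p_3` leaves two words of the latter
kind. `mem_firstLetters` and `exists_origin` show that these six pairs are exactly the possible
ones.

The program is verified by loop invariants (`Recorded`, `Placed`, `Building`). Its running time is
linear because its loops have at most `n` rounds and loop-free bodies, except for the outer one,
which has at most 48 rounds. -/

namespace PinPerm

/-! ### Separation and extremality in one coordinate -/

/-- `f i` lies between `f (i - 1)` on one side and `f a, …, f (i - 2)` on the other. -/
def SepAt (f : ℕ → ℤ) (a i : ℕ) : Prop :=
  ((∀ j, a ≤ j → j + 1 < i → f j < f i) ∧ f i < f (i - 1)) ∨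
  ((∀ j, a ≤ j → j + 1 < i → f i < f j) ∧ f (i - 1) < f i)

/-- `f i` is larger than `f a, …, f (i - 1)`. -/
def Above (f : ℕ → ℤ) (a i : ℕ) : Prop := ∀ j, a ≤ j → j < i → f j < f i

/-- `f i` is smaller than `f a, …, f (i - 1)`. -/
def Below (f : ℕ → ℤ) (a i : ℕ) : Prop := ∀ j, a ≤ j → j < i → f i < f j

def OutAt (f : ℕ → ℤ) (a i : ℕ) : Prop := Above f a i ∨ Below f a i

/-- The pin `(x i, y i)` is outside the bounding box of the previous ones and separates the last of
them from the others. -/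
def StepAt (x y : ℕ → ℤ) (a i : ℕ) : Prop :=
  (SepAt x a i ∧ OutAt y a i) ∨ (SepAt y a i ∧ OutAt x a i)

theorem StepAt.symm {x y : ℕ → ℤ} {a i : ℕ} (h : StepAt x y a i) : StepAt y x a i := Or.symm h

/-- With `a + 2 ≤ i` there is an index other than `i - 1` to compare with, so `f i` has an earlier
value on either side. -/
theorem SepAt.not_outAt {f : ℕ → ℤ} {a i : ℕ} (h : SepAt f a i) (hi : a + 2 ≤ i) :
    ¬ OutAt f a i := by
  rintro (o | o) <;> have h1 := o (i - 1) (by omega) (by omega) <;>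
    have h2 := o a le_rfl (by omega) <;>
    rcases h with ⟨h, h'⟩ | ⟨h, h'⟩ <;> have h3 := h a le_rfl (by omega) <;> omega

theorem SepAt.ne {f : ℕ → ℤ} {a i : ℕ} (h : SepAt f a i) {j : ℕ} (hj : a ≤ j) (hji : j < i) :
    f j ≠ f i := by
  rcases eq_or_ne j (i - 1) with rfl | hne
  · rcases h with ⟨_, h⟩ | ⟨_, h⟩ <;> omega
  · rcases h with ⟨h, _⟩ | ⟨h, _⟩ <;> have := h j hj (by omega) <;> omega

theorem OutAt.ne {f : ℕ → ℤ} {a i : ℕ} (h : OutAt f a i) {j : ℕ} (hj : a ≤ j) (hji : j < i) :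
    f j ≠ f i := by
  rcases h with h | h <;> have := h j hj hji <;> omega

theorem StepAt.fst_ne {x y : ℕ → ℤ} {a i : ℕ} (h : StepAt x y a i) {j : ℕ} (hj : a ≤ j)
    (hji : j < i) : x j ≠ x i := by
  rcases h with ⟨h, _⟩ | ⟨_, h⟩ <;> exact h.ne hj hji

/-- A pin does not cut the bounding box of the pins before its predecessor. -/
theorem StepAt.same_side {x y : ℕ → ℤ} {a i : ℕ} (h : StepAt x y a i) {u v : ℕ}
    (hu : a ≤ u) (hui : u + 1 < i) (hv : a ≤ v) (hvi : v + 1 < i) :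
    ¬ (x u < x i ∧ x i < x v) := by
  rcases h with ⟨⟨h, _⟩ | ⟨h, _⟩, _⟩ | ⟨_, h | h⟩
  · have := h u hu hui; have := h v hv hvi; omega
  · have := h u hu hui; have := h v hv hvi; omega
  · have := h u hu (by omega); have := h v hv (by omega); omega
  · have := h u hu (by omega); have := h v hv (by omega); omega

theorem OutAt.same_side {f : ℕ → ℤ} {a i : ℕ} (h : OutAt f a i) {u v : ℕ}
    (hu : a ≤ u) (hui : u < i) (hv : a ≤ v) (hvi : v < i) : ¬ (f u < f i ∧ f i < f v) := by
  rcases h with h | h <;> have := h u hu hui <;> have := h v hv hvi <;> omega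

/-! ### Invariance under order-preserving changes and under dropping initial points -/

section Transfer

variable {f g : ℕ → ℤ} {a b i : ℕ}

theorem Above.transfer (h : Above f a i) (hab : a ≤ b)
    (H : ∀ j k, b ≤ j → j ≤ i → b ≤ k → k ≤ i → f j < f k → g j < g k) : Above g b i :=
  fun j hj hji => H j i hj hji.le (by omega) le_rfl (h j (hab.trans hj) hji)

theorem Below.transfer (h : Below f a i) (hab : a ≤ b)
    (H : ∀ j k, b ≤ j → j ≤ i → b ≤ k → k ≤ i → f j < f k → g j < g k) : Below g b i :=
  fun j hj hji => H i j (by omega) le_rfl hj hji.le (h j (hab.trans hj) hji)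

theorem OutAt.transfer (h : OutAt f a i) (hab : a ≤ b)
    (H : ∀ j k, b ≤ j → j ≤ i → b ≤ k → k ≤ i → f j < f k → g j < g k) : OutAt g b i :=
  h.imp (fun h => h.transfer hab H) (fun h => h.transfer hab H)

theorem SepAt.transfer (h : SepAt f a i) (hab : a ≤ b) (hi : b < i)
    (H : ∀ j k, b ≤ j → j ≤ i → b ≤ k → k ≤ i → f j < f k → g j < g k) : SepAt g b i := by
  rcases h with ⟨h, h'⟩ | ⟨h, h'⟩
  · exact Or.inl ⟨fun j hj hji => H j i hj (by omega) (by omega) le_rfl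
      (h j (hab.trans hj) hji), H i (i - 1) (by omega) le_rfl (by omega) (by omega) h'⟩
  · exact Or.inr ⟨fun j hj hji => H i j (by omega) le_rfl hj (by omega)
      (h j (hab.trans hj) hji), H (i - 1) i (by omega) (by omega) (by omega) le_rfl h'⟩

end Transfer

theorem StepAt.transfer {x y x' y' : ℕ → ℤ} {a b i : ℕ} (h : StepAt x y a i) (hab : a ≤ b)
    (hi : b < i) (hx : ∀ j k, b ≤ j → j ≤ i → b ≤ k → k ≤ i → x j < x k → x' j < x' k)
    (hy : ∀ j k, b ≤ j → j ≤ i → b ≤ k → k ≤ i → y j < y k → y' j < y' k) :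
    StepAt x' y' b i :=
  h.imp (fun h => ⟨h.1.transfer hab hi hx, h.2.transfer hab hy⟩)
    (fun h => ⟨h.1.transfer hab hi hy, h.2.transfer hab hx⟩)

/-! ### Directions -/

/-- The pin `q i` separates `q (i - 1)` from `q a, …, q (i - 2)` from the given direction. -/
def Turn (a : ℕ) (q : ℕ → Pin) (i : ℕ) : Letter → Prop
  | .U => SepAt (fun j => (q j).1) a i ∧ Above (fun j => (q j).2) a i
  | .D => SepAt (fun j => (q j).1) a i ∧ Below (fun j => (q j).2) a i
  | .L => SepAt (fun j => (q j).2) a i ∧ Below (fun j => (q j).1) a i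
  | .R => SepAt (fun j => (q j).2) a i ∧ Above (fun j => (q j).1) a i
  | _ => False

theorem Turn.stepAt {a i : ℕ} {q : ℕ → Pin} {l : Letter} (h : Turn a q i l) :
    StepAt (fun j => (q j).1) (fun j => (q j).2) a i := by
  cases l <;> simp only [Turn] at h
  exacts [Or.inl ⟨h.1, Or.inl h.2⟩, Or.inl ⟨h.1, Or.inr h.2⟩, Or.inr ⟨h.1, Or.inr h.2⟩,
    Or.inr ⟨h.1, Or.inl h.2⟩]

theorem StepAt.exists_turn {a i : ℕ} {q : ℕ → Pin}
    (h : StepAt (fun j => (q j).1) (fun j => (q j).2) a i) : ∃ l, Turn a q i l := by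
  rcases h with ⟨h, h' | h'⟩ | ⟨h, h' | h'⟩
  exacts [⟨.U, h, h'⟩, ⟨.D, h, h'⟩, ⟨.R, h, h'⟩, ⟨.L, h, h'⟩]

theorem Above.not_below {f : ℕ → ℤ} {a i : ℕ} (h : Above f a i) (hi : a < i) : ¬ Below f a i :=
  fun h' => lt_asymm (h a le_rfl hi) (h' a le_rfl hi)

/-- Opposite directions contradict each other on the extremal coordinate; perpendicular ones would
make the same coordinate both intermediate and extreme. -/
theorem Turn.unique {a i : ℕ} {q : ℕ → Pin} {l l' : Letter} (hi : a + 2 ≤ i) (h : Turn a q i l)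
    (h' : Turn a q i l') : l = l' := by
  cases l <;> cases l' <;> simp only [Turn] at h h' <;> first
    | rfl
    | exact (h.2.not_below (by omega) h'.2).elim
    | exact (h'.2.not_below (by omega) h.2).elim
    | exact (h.1.not_outAt hi (Or.inl h'.2)).elim
    | exact (h.1.not_outAt hi (Or.inr h'.2)).elim

theorem Turn.transfer {q q' : ℕ → Pin} {a b i : ℕ} {l : Letter} (h : Turn a q i l) (hab : a ≤ b)
    (hi : b < i)
    (hx : ∀ j k, b ≤ j → j ≤ i → b ≤ k → k ≤ i → (q j).1 < (q k).1 → (q' j).1 < (q' k).1)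
    (hy : ∀ j k, b ≤ j → j ≤ i → b ≤ k → k ≤ i → (q j).2 < (q k).2 → (q' j).2 < (q' k).2) :
    Turn b q' i l := by
  cases l <;> simp only [Turn] at h ⊢
  exacts [⟨h.1.transfer hab hi hx, h.2.transfer hab hy⟩,
    ⟨h.1.transfer hab hi hx, h.2.transfer hab hy⟩, ⟨h.1.transfer hab hi hy, h.2.transfer hab hx⟩,
    ⟨h.1.transfer hab hi hy, h.2.transfer hab hx⟩]

theorem Turn.congr {q q' : ℕ → Pin} {a i : ℕ} {l : Letter} (h : Turn a q i l) (hi : a < i)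
    (hq : ∀ j, a ≤ j → j ≤ i → q j = q' j) : Turn a q' i l :=
  h.transfer le_rfl hi
    (fun j k hj hj' hk hk' => by rw [hq j hj hj', hq k hk hk']; exact id)
    (fun j k hj hj' hk hk' => by rw [hq j hj hj', hq k hk hk']; exact id)

/-! ### Walks on the diagram of a permutation -/

section Walks

variable {n : ℕ} {σ : Equiv.Perm (Fin n)}

/-- The point of the diagram of `σ` in column `c`. -/
def point (σ : Equiv.Perm (Fin n)) (c : Fin n) : Pin := (((c : ℕ) : ℤ), ((σ c : ℕ) : ℤ))

theorem point_injective (σ : Equiv.Perm (Fin n)) : Function.Injective (point σ) := by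
  intro c c' h
  have : ((c : ℕ) : ℤ) = ((c' : ℕ) : ℤ) := congrArg Prod.fst h
  exact Fin.ext (by exact_mod_cast this)

theorem point_eq_of_snd {c c' : Fin n} (h : (point σ c).2 = (point σ c').2) : c = c' := by
  have : ((σ c : ℕ) : ℤ) = ((σ c' : ℕ) : ℤ) := h
  exact σ.injective (Fin.ext (by exact_mod_cast this))

/-- `q 1, …, q m` are points of the diagram of `σ`, and for `i ≥ 3` the point `q i` separates its
predecessor from the earlier points, from the direction `d i`. -/
structure IsWalk (σ : Equiv.Perm (Fin n)) (m : ℕ) (q : ℕ → Pin) (d : ℕ → Letter) : Prop where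
  mem : ∀ i, 1 ≤ i → i ≤ m → ∃ c, q i = point σ c
  start : 2 ≤ m → q 1 ≠ q 2
  turn : ∀ i, 3 ≤ i → i ≤ m → Turn 1 q i (d i)

variable {m : ℕ} {q q' : ℕ → Pin} {d d' : ℕ → Letter}

theorem IsWalk.ne (h : IsWalk σ m q d) {i j : ℕ} (hi : 1 ≤ i) (hij : i < j) (hj : j ≤ m) :
    q i ≠ q j := by
  rcases Nat.lt_or_ge j 3 with h3 | h3
  · obtain rfl : i = 1 := by omega
    obtain rfl : j = 2 := by omega
    exact h.start hj
  · intro he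
    exact (h.turn j h3 hj).stepAt.fst_ne hi hij (by simp [he])

theorem IsWalk.inj (h : IsWalk σ m q d) {i j : ℕ} (hi : 1 ≤ i) (him : i ≤ m) (hj : 1 ≤ j)
    (hjm : j ≤ m) (he : q i = q j) : i = j := by
  rcases lt_trichotomy i j with hlt | rfl | hlt
  · exact absurd he (h.ne hi hlt hjm)
  · rfl
  · exact absurd he.symm (h.ne hj hlt him)

/-- The `n` points of the walk are distinct, hence exhaust a diagram with `n` points. -/
theorem IsWalk.exists_perm (h : IsWalk σ n q d) :
    ∃ e : Equiv.Perm (Fin n), ∀ k : Fin n, q (k + 1) = point σ (e k) := by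
  choose f hf using fun k : Fin n => h.mem (k + 1) (by omega) (by omega)
  have hinj : Function.Injective f := by
    intro k l hkl
    have := h.inj (i := k + 1) (j := l + 1) (by omega) (by omega) (by omega) (by omega)
      (by rw [hf, hf, hkl])
    exact Fin.ext (by omega)
  exact ⟨Equiv.ofBijective f (Finite.injective_iff_bijective.1 hinj), hf⟩

theorem IsWalk.surj (h : IsWalk σ n q d) (c : Fin n) :
    ∃ j, 1 ≤ j ∧ j ≤ n ∧ q j = point σ c := by
  obtain ⟨e, he⟩ := h.exists_perm
  exact ⟨e.symm c + 1, by omega, by omega, by simp [he]⟩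

/-- A walk is determined by its first two points, if these are the beginning of a walk through the
whole diagram. -/
theorem IsWalk.eq_of_start (h : IsWalk σ m q d) (h' : IsWalk σ n q' d') (h1 : q 1 = q' 1)
    (h2 : q 2 = q' 2) : ∀ i, 1 ≤ i → i ≤ m → q i = q' i := by
  intro i
  induction i using Nat.strong_induction_on with
  | _ i ih =>
    intro hi him
    rcases Nat.lt_or_ge i 3 with h3 | h3
    · interval_cases i <;> assumption
    obtain ⟨c, hc⟩ := h.mem i hi him
    obtain ⟨j, hj, hjn, hjc⟩ := h'.surj c
    have hji : q' j = q i := hjc.trans hc.symm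
    rcases lt_trichotomy j i with hlt | rfl | hlt
    · have := ih j hlt hj (by omega)
      exact absurd (this.trans hji) (h.ne hj hlt him)
    · exact hji.symm
    -- The point `q i` is reached by `q'` only at a later step `j`. There it must leave `q 1` and `q
    -- (i - 1)` on the same side in both coordinates, whereas in the walk `q` it separates these
    -- two.
    · have hs := (h'.turn j (by omega) hjn).stepAt
      have e1 := ih (i - 1) (by omega) (by omega) (by omega)
      rcases (h.turn i h3 him).stepAt with ⟨hsep, _⟩ | ⟨hsep, _⟩
      · have n1 := hs.same_side (u := 1) (v := i - 1) (by omega) (by omega) (by omega) (by omega)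
        have n2 := hs.same_side (u := i - 1) (v := 1) (by omega) (by omega) (by omega) (by omega)
        simp only [← h1, ← e1, hji] at n1 n2
        rcases hsep with ⟨hs1, hs2⟩ | ⟨hs1, hs2⟩ <;> have := hs1 1 le_rfl (by omega)
        · exact absurd ⟨this, hs2⟩ n1
        · exact absurd ⟨hs2, this⟩ n2
      · have n1 := hs.symm.same_side (u := 1) (v := i - 1) (by omega) (by omega) (by omega)
          (by omega)
        have n2 := hs.symm.same_side (u := i - 1) (v := 1) (by omega) (by omega) (by omega)
          (by omega)
        simp only [← h1, ← e1, hji] at n1 n2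
        rcases hsep with ⟨hs1, hs2⟩ | ⟨hs1, hs2⟩ <;> have := hs1 1 le_rfl (by omega)
        · exact absurd ⟨this, hs2⟩ n1
        · exact absurd ⟨hs2, this⟩ n2

theorem IsWalk.letter_eq (h : IsWalk σ m q d) (h' : IsWalk σ n q' d') (hmn : m ≤ n)
    (h1 : q 1 = q' 1) (h2 : q 2 = q' 2) {i : ℕ} (hi : 3 ≤ i) (him : i ≤ m) : d i = d' i :=
  Turn.unique hi
    ((h.turn i hi him).congr (by omega)
      fun j hj hji => h.eq_of_start h' h1 h2 j hj (hji.trans him))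
    (h'.turn i hi (him.trans hmn))

/-! ### Pin representations -/

/-- The points of the diagram of `σ` in the order given by `e`, numbered from `1`. -/
def diagram (σ e : Equiv.Perm (Fin n)) (i : ℕ) : Pin :=
  if h : 1 ≤ i ∧ i ≤ n then point σ (e ⟨i - 1, by omega⟩) else 0

theorem diagram_succ (σ e : Equiv.Perm (Fin n)) (k : Fin n) :
    diagram σ e (k + 1) = point σ (e k) := by
  rw [diagram, dif_pos ⟨by omega, by omega⟩]; simp

theorem IsPinRepresentation.fst_lt_iff {p : ℕ → Pin} {e : Equiv.Perm (Fin n)}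
    (h : IsPinRepresentation σ p e) {i j : ℕ} (hi : 1 ≤ i) (hin : i ≤ n) (hj : 1 ≤ j)
    (hjn : j ≤ n) : (p i).1 < (p j).1 ↔ (diagram σ e i).1 < (diagram σ e j).1 := by
  obtain ⟨i, rfl⟩ := Nat.exists_eq_add_of_le' hi
  obtain ⟨j, rfl⟩ := Nat.exists_eq_add_of_le' hj
  have := (h.2 ⟨i, by omega⟩ ⟨j, by omega⟩).1
  simp only at this
  rw [this, diagram_succ σ e ⟨i, by omega⟩, diagram_succ σ e ⟨j, by omega⟩]
  simp [point]

theorem IsPinRepresentation.snd_lt_iff {p : ℕ → Pin} {e : Equiv.Perm (Fin n)}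
    (h : IsPinRepresentation σ p e) {i j : ℕ} (hi : 1 ≤ i) (hin : i ≤ n) (hj : 1 ≤ j)
    (hjn : j ≤ n) : (p i).2 < (p j).2 ↔ (diagram σ e i).2 < (diagram σ e j).2 := by
  obtain ⟨i, rfl⟩ := Nat.exists_eq_add_of_le' hi
  obtain ⟨j, rfl⟩ := Nat.exists_eq_add_of_le' hj
  have := (h.2 ⟨i, by omega⟩ ⟨j, by omega⟩).2
  simp only at this
  rw [this, diagram_succ σ e ⟨i, by omega⟩, diagram_succ σ e ⟨j, by omega⟩]
  simp [point]

theorem separatesV_iff {p : ℕ → Pin} {a i : ℕ} :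
    SeparatesV (p i) {p (i - 1)} (p '' Set.Ico a (i - 1)) ↔ SepAt (fun j => (p j).1) a i := by
  simp only [SeparatesV, SepAt, Set.mem_singleton_iff, forall_eq, Set.forall_mem_image,
    Set.mem_Ico, and_imp]
  constructor
  · rintro (⟨h, h'⟩ | ⟨h, h'⟩)
    · exact Or.inr ⟨fun j hj hji => h' hj (by omega), h⟩
    · exact Or.inl ⟨fun j hj hji => h' hj (by omega), h⟩
  · rintro (⟨h, h'⟩ | ⟨h, h'⟩)
    · exact Or.inr ⟨h', fun j hj hji => h j hj (by omega)⟩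
    · exact Or.inl ⟨h', fun j hj hji => h j hj (by omega)⟩

theorem separatesH_iff {p : ℕ → Pin} {a i : ℕ} :
    SeparatesH (p i) {p (i - 1)} (p '' Set.Ico a (i - 1)) ↔ SepAt (fun j => (p j).2) a i := by
  simp only [SeparatesH, SepAt, Set.mem_singleton_iff, forall_eq, Set.forall_mem_image,
    Set.mem_Ico, and_imp]
  constructor
  · rintro (⟨h, h'⟩ | ⟨h, h'⟩)
    · exact Or.inr ⟨fun j hj hji => h' hj (by omega), h⟩
    · exact Or.inl ⟨fun j hj hji => h' hj (by omega), h⟩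
  · rintro (⟨h, h'⟩ | ⟨h, h'⟩)
    · exact Or.inr ⟨h', fun j hj hji => h j hj (by omega)⟩
    · exact Or.inl ⟨h', fun j hj hji => h j hj (by omega)⟩

/-- A pin that is not extreme in some coordinate has earlier pins on both sides of its line, and the
two sides form a forbidden partition; `hne` ensures that no pin lies on the line itself. -/
theorem independent_iff {p : ℕ → Pin} {a i : ℕ}
    (hne : ∀ j, a ≤ j → j < i → (p j).1 ≠ (p i).1 ∧ (p j).2 ≠ (p i).2) :
    Independent (p i) (p '' Set.Ico a i) ↔
      OutAt (fun j => (p j).1) a i ∧ OutAt (fun j => (p j).2) a i := by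
  constructor
  · intro h
    constructor
    · by_contra ho
      simp only [OutAt, Above, Below, not_or, not_forall, not_lt] at ho
      obtain ⟨⟨j, hj, hji, h1⟩, k, hk, hki, h2⟩ := ho
      refine h {b ∈ p '' Set.Ico a i | b.1 < (p i).1} {b ∈ p '' Set.Ico a i | (p i).1 < b.1}
        ⟨p k, ⟨k, ⟨hk, hki⟩, rfl⟩, lt_of_le_of_ne h2 (hne k hk hki).1⟩
        ⟨p j, ⟨j, ⟨hj, hji⟩, rfl⟩, lt_of_le_of_ne h1 (hne j hj hji).1.symm⟩ ?_
        (Or.inl (Or.inl ⟨fun b hb => hb.2, fun b hb => hb.2⟩))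
      ext b
      constructor
      · rintro (hb | hb) <;> exact hb.1
      · rintro ⟨l, ⟨hl, hli⟩, rfl⟩
        rcases lt_or_gt_of_ne (hne l hl hli).1 with hlt | hlt
        · exact Or.inl ⟨⟨l, ⟨hl, hli⟩, rfl⟩, hlt⟩
        · exact Or.inr ⟨⟨l, ⟨hl, hli⟩, rfl⟩, hlt⟩
    · by_contra ho
      simp only [OutAt, Above, Below, not_or, not_forall, not_lt] at ho
      obtain ⟨⟨j, hj, hji, h1⟩, k, hk, hki, h2⟩ := ho
      refine h {b ∈ p '' Set.Ico a i | b.2 < (p i).2} {b ∈ p '' Set.Ico a i | (p i).2 < b.2}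
        ⟨p k, ⟨k, ⟨hk, hki⟩, rfl⟩, lt_of_le_of_ne h2 (hne k hk hki).2⟩
        ⟨p j, ⟨j, ⟨hj, hji⟩, rfl⟩, lt_of_le_of_ne h1 (hne j hj hji).2.symm⟩ ?_
        (Or.inr (Or.inl ⟨fun b hb => hb.2, fun b hb => hb.2⟩))
      ext b
      constructor
      · rintro (hb | hb) <;> exact hb.1
      · rintro ⟨l, ⟨hl, hli⟩, rfl⟩
        rcases lt_or_gt_of_ne (hne l hl hli).2 with hlt | hlt
        · exact Or.inl ⟨⟨l, ⟨hl, hli⟩, rfl⟩, hlt⟩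
        · exact Or.inr ⟨⟨l, ⟨hl, hli⟩, rfl⟩, hlt⟩
  · rintro ⟨hx, hy⟩ P Q ⟨b, hb⟩ ⟨c, hc⟩ hPQ hsep
    obtain ⟨j, ⟨hj, hji⟩, rfl⟩ : b ∈ p '' Set.Ico a i := hPQ ▸ Or.inl hb
    obtain ⟨k, ⟨hk, hki⟩, rfl⟩ : c ∈ p '' Set.Ico a i := hPQ ▸ Or.inr hc
    rcases hsep with (⟨h1, h2⟩ | ⟨h1, h2⟩) | (⟨h1, h2⟩ | ⟨h1, h2⟩)
    · exact hx.same_side hj hji hk hki ⟨h1 _ hb, h2 _ hc⟩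
    · exact hx.same_side hk hki hj hji ⟨h2 _ hc, h1 _ hb⟩
    · exact hy.same_side hj hji hk hki ⟨h1 _ hb, h2 _ hc⟩
    · exact hy.same_side hk hki hj hji ⟨h2 _ hc, h1 _ hb⟩

/-- In the coordinate where it separates, the pin has earlier pins on both sides, so it can only
leave the bounding box through the other coordinate. -/
theorem stepAt_of_separates {p : ℕ → Pin} {a i : ℕ} (hi : a + 2 ≤ i)
    (hbox : ¬ InBoundingBox (p i) (p '' Set.Ico a i))
    (h : Separates (p i) {p (i - 1)} (p '' Set.Ico a (i - 1))) :
    StepAt (fun j => (p j).1) (fun j => (p j).2) a i := by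
  have key : ∀ f : Pin → ℤ, SepAt (fun j => f (p j)) a i →
      (∃ b ∈ p '' Set.Ico a i, f b ≤ f (p i)) ∧ ∃ b ∈ p '' Set.Ico a i, f (p i) ≤ f b := by
    rintro f (⟨h, h'⟩ | ⟨h, h'⟩) <;> have := h a le_rfl (by omega)
    · exact ⟨⟨p a, ⟨a, ⟨le_rfl, by omega⟩, rfl⟩, this.le⟩,
        ⟨p (i - 1), ⟨i - 1, ⟨by omega, by omega⟩, rfl⟩, h'.le⟩⟩
    · exact ⟨⟨p (i - 1), ⟨i - 1, ⟨by omega, by omega⟩, rfl⟩, h'.le⟩,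
        ⟨p a, ⟨a, ⟨le_rfl, by omega⟩, rfl⟩, this.le⟩⟩
  have key2 : ∀ f : Pin → ℤ, ¬ OutAt (fun j => f (p j)) a i →
      (∃ b ∈ p '' Set.Ico a i, f b ≤ f (p i)) ∧ ∃ b ∈ p '' Set.Ico a i, f (p i) ≤ f b := by
    intro f ho
    simp only [OutAt, Above, Below, not_or, not_forall, not_lt] at ho
    obtain ⟨⟨j, hj, hji, h1⟩, k, hk, hki, h2⟩ := ho
    exact ⟨⟨p k, ⟨k, ⟨hk, hki⟩, rfl⟩, h2⟩, ⟨p j, ⟨j, ⟨hj, hji⟩, rfl⟩, h1⟩⟩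
  rcases h with h | h
  · rw [separatesV_iff] at h
    refine Or.inl ⟨h, ?_⟩
    by_contra ho
    exact hbox ⟨key Prod.fst h, key2 Prod.snd ho⟩
  · rw [separatesH_iff] at h
    refine Or.inr ⟨h, ?_⟩
    by_contra ho
    exact hbox ⟨key2 Prod.fst ho, key Prod.snd h⟩

theorem IsPinSequence.stepAt_or_outAt {p : ℕ → Pin} {a b i : ℕ} (h : IsPinSequence p a b)
    (hi : a + 2 ≤ i) (hib : i ≤ b) :
    StepAt (fun j => (p j).1) (fun j => (p j).2) a i ∨
      (OutAt (fun j => (p j).1) a i ∧ OutAt (fun j => (p j).2) a i) := by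
  obtain ⟨hbox, hs | hs⟩ := h.2 i (by omega) hib
  · exact Or.inl (stepAt_of_separates hi hbox hs)
  · exact Or.inr ((independent_iff fun j hj hji =>
      h.1 j ⟨hj, by omega⟩ i ⟨by omega, hib⟩ hji.ne).1 hs)

/-- Steps depend only on the relative order of coordinates, so they can be read on the diagram
itself instead of on the abstract pins. -/
theorem IsPinRepresentation.exists_isWalk {p : ℕ → Pin} {e : Equiv.Perm (Fin n)}
    (h : IsPinRepresentation σ p e)
    (hs : ∀ i, 3 ≤ i → i ≤ n → StepAt (fun j => (p j).1) (fun j => (p j).2) 1 i) :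
    ∃ d, IsWalk σ n (diagram σ e) d := by
  have : ∀ i, ∃ l, 3 ≤ i → i ≤ n → Turn 1 (diagram σ e) i l := by
    intro i
    by_cases hi : 3 ≤ i ∧ i ≤ n
    · have h1 : StepAt (fun j => (diagram σ e j).1) (fun j => (diagram σ e j).2) 1 i :=
        (hs i hi.1 hi.2).transfer le_rfl (by omega)
        (fun j k hj hj' hk hk' => (h.fst_lt_iff hj (by omega) hk (by omega)).1)
        (fun j k hj hj' hk hk' => (h.snd_lt_iff hj (by omega) hk (by omega)).1)
      obtain ⟨l, hl⟩ := h1.exists_turn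
      exact ⟨l, fun _ _ => hl⟩
    -- Outside `3, …, n` the direction is arbitrary.
    · exact ⟨.U, fun h1 h2 => absurd ⟨h1, h2⟩ hi⟩
  choose d hd using this
  refine ⟨d, ⟨?_, ?_, hd⟩⟩
  · intro i hi hin
    exact ⟨_, dif_pos ⟨hi, hin⟩⟩
  · intro hn he
    rw [diagram, dif_pos (by omega), diagram, dif_pos (by omega)] at he
    simpa using e.injective (point_injective σ he)

theorem IsProperPinRepresentation.exists_isWalk {p : ℕ → Pin} {e : Equiv.Perm (Fin n)}
    (h : IsProperPinRepresentation σ p e) : ∃ d, IsWalk σ n (diagram σ e) d :=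
  h.1.exists_isWalk fun i hi hin =>
    stepAt_of_separates (by omega) (h.1.1.2 i (by omega) hin).1 (h.2 i hi hin)

theorem properPinRepresentation_unique {x y : Fin n} {p p' : ℕ → Pin} {e e' : Equiv.Perm (Fin n)}
    (h : IsProperPinRepresentation σ p e) (hb : BeginsWith e x y)
    (h' : IsProperPinRepresentation σ p' e') (hb' : BeginsWith e' x y) : e = e' := by
  obtain ⟨d, hd⟩ := h.exists_isWalk
  obtain ⟨d', hd'⟩ := h'.exists_isWalk
  have hdiag : ∀ i, i < 2 → diagram σ e (i + 1) = diagram σ e' (i + 1) := by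
    intro i hi
    by_cases hin : i < n
    · rw [diagram_succ σ e ⟨i, hin⟩, diagram_succ σ e' ⟨i, hin⟩]
      have h0 := hb ⟨i, hin⟩
      have h0' := hb' ⟨i, hin⟩
      simp only at h0 h0'
      interval_cases i
      · rw [h0.1 rfl, h0'.1 rfl]
      · rw [h0.2 rfl, h0'.2 rfl]
    -- For `n < 2` some of these indices are outside the diagram, where both sequences take the
    -- default value.
    · rw [diagram, dif_neg (by omega), diagram, dif_neg (by omega)]
  ext k : 1
  have := hd.eq_of_start hd' (hdiag 0 (by omega)) (hdiag 1 (by omega)) (k + 1) (by omega) (by omega)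
  rw [diagram_succ, diagram_succ] at this
  exact point_injective σ this

end Walks


/-! ### Pin representations of simple permutations are proper -/

section Simple

variable {n : ℕ} {σ : Equiv.Perm (Fin n)}

theorem exists_eq_Icc_of_convex (B : Finset (Fin n)) (hB : B.Nonempty)
    (hc : ∀ a ∈ B, ∀ b ∈ B, ∀ c, a < c → c < b → c ∈ B) :
    ∃ i, i + (B.card - 1) < n ∧ ∀ x : Fin n, x ∈ B ↔ (x : ℕ) ∈ Finset.Icc i (i + (B.card - 1)) := by
  have hmin := B.min'_mem hB
  have hmax := B.max'_mem hB
  have hle : B.min' hB ≤ B.max' hB := B.min'_le _ hmax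
  have hB' : B = Finset.Icc (B.min' hB) (B.max' hB) := by
    ext x
    rw [Finset.mem_Icc]
    refine ⟨fun hx => ⟨B.min'_le _ hx, B.le_max' _ hx⟩, fun ⟨h1, h2⟩ => ?_⟩
    rcases h1.eq_or_lt with h1 | h1
    · exact h1 ▸ hmin
    rcases h2.eq_or_lt with h2 | h2
    · exact h2 ▸ hmax
    exact hc _ hmin _ hmax _ h1 h2
  have hcard : B.card = (B.max' hB : ℕ) + 1 - B.min' hB := by
    conv_lhs => rw [hB']
    rw [Fin.card_Icc]
  have hle' : (B.min' hB : ℕ) ≤ B.max' hB := hle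
  have hsum : (B.min' hB : ℕ) + (B.card - 1) = B.max' hB := by omega
  refine ⟨B.min' hB, by rw [hsum]; exact (B.max' hB).2, fun x => ?_⟩
  rw [hsum, Finset.mem_Icc]
  conv_lhs => rw [hB', Finset.mem_Icc]
  exact Iff.rfl

/-- A simple permutation has no proper block, that is, no set of points that is not cut by the row or
the column of another point. -/
theorem IsSimple.card_eq_of_convex (h : IsSimple σ) (A : Finset (Fin n)) (hA : 2 ≤ A.card)
    (hc : ∀ a ∈ A, ∀ b ∈ A, ∀ c, a < c → c < b → c ∈ A)
    (hr : ∀ a ∈ A, ∀ b ∈ A, ∀ c, σ a < σ c → σ c < σ b → c ∈ A) : A.card = n := by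
  have hne : A.Nonempty := Finset.card_pos.1 (by omega)
  obtain ⟨i, hi, hi'⟩ := exists_eq_Icc_of_convex A hne hc
  obtain ⟨j, hj, hj'⟩ := exists_eq_Icc_of_convex (A.map σ.toEmbedding) (by simpa using hne) (by
    intro a ha b hb c hac hcb
    obtain ⟨a, ha', rfl⟩ := Finset.mem_map.1 ha
    obtain ⟨b, hb', rfl⟩ := Finset.mem_map.1 hb
    obtain ⟨c, rfl⟩ := σ.surjective c
    exact Finset.mem_map_of_mem _ (hr a ha' b hb' c hac hcb))
  rw [Finset.card_map] at hj hj'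
  -- An interval of length parameter `A.card - 1 ≥ 1` is not a single point, so it is everything.
  rcases h i j (A.card - 1) hi (fun x => by rw [← hi', ← hj']; simp) with h | h <;> omega

/-- If `p i` is independent, the points `p 1, …, p (i - 1)` are cut neither by `p i` nor by a later
pin, whose predecessor is not among them. They form a block of `i - 1` points with `2 ≤ i - 1 < n`,
against simplicity. -/
theorem IsPinRepresentation.stepAt_of_isSimple {p : ℕ → Pin} {e : Equiv.Perm (Fin n)}
    (hσ : IsSimple σ) (h : IsPinRepresentation σ p e) {i : ℕ} (hi : 3 ≤ i) (hin : i ≤ n) :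
    StepAt (fun j => (p j).1) (fun j => (p j).2) 1 i := by
  refine (h.1.stepAt_or_outAt (by omega) hin).resolve_right fun hout => ?_
  have side : ∀ j, i ≤ j → j ≤ n → ∀ u, 1 ≤ u → u < i → ∀ v, 1 ≤ v → v < i →
      ¬ ((p u).1 < (p j).1 ∧ (p j).1 < (p v).1) ∧ ¬ ((p u).2 < (p j).2 ∧ (p j).2 < (p v).2) := by
    intro j hij hjn u hu hui v hv hvi
    rcases hij.eq_or_lt with rfl | hij
    · exact ⟨hout.1.same_side hu hui hv hvi, hout.2.same_side hu hui hv hvi⟩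
    · rcases h.1.stepAt_or_outAt (i := j) (by omega) hjn with hs | hs
      · exact ⟨hs.same_side hu (by omega) hv (by omega),
          hs.symm.same_side hu (by omega) hv (by omega)⟩
      · exact ⟨hs.1.same_side hu (by omega) hv (by omega),
          hs.2.same_side hu (by omega) hv (by omega)⟩
  -- The block consists of the points with zero-based indices below `i - 1`, that is, of the pins
  -- before `p i`.
  set I : Finset (Fin n) := Finset.Iio ⟨i - 1, by omega⟩ with hI
  have hcard : (I.map e.toEmbedding).card = i - 1 := by simp [hI]
  have mem : ∀ c, c ∈ I.map e.toEmbedding ↔ ((e.symm c : Fin n) : ℕ) + 1 < i := by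
    intro c
    simp only [Finset.mem_map_equiv, hI, Finset.mem_Iio, Fin.lt_def]
    omega
  have hd : ∀ c, diagram σ e (e.symm c + 1) = point σ c := by simp [diagram_succ]
  have lt1 : ∀ a b : Fin n, (p (e.symm a + 1)).1 < (p (e.symm b + 1)).1 ↔ a < b := by
    intro a b
    rw [h.fst_lt_iff (by omega) (by omega) (by omega) (by omega), hd, hd]; simp [point]
  have lt2 : ∀ a b : Fin n, (p (e.symm a + 1)).2 < (p (e.symm b + 1)).2 ↔ σ a < σ b := by
    intro a b
    rw [h.snd_lt_iff (by omega) (by omega) (by omega) (by omega), hd, hd]; simp [point]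
  have := hσ.card_eq_of_convex (I.map e.toEmbedding) (by omega)
    (by
      intro a ha b hb c hac hcb
      rw [mem] at ha hb ⊢
      by_contra hc
      exact (side (e.symm c + 1) (by omega) (by omega) _ (by omega) ha _ (by omega) hb).1
        ⟨(lt1 _ _).2 hac, (lt1 _ _).2 hcb⟩)
    (by
      intro a ha b hb c hac hcb
      rw [mem] at ha hb ⊢
      by_contra hc
      exact (side (e.symm c + 1) (by omega) (by omega) _ (by omega) ha _ (by omega) hb).2
        ⟨(lt2 _ _).2 hac, (lt2 _ _).2 hcb⟩)
  omega

end Simple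

/-! ### Points in knight position in a walk through a whole diagram -/

/-- `(x 1, y 1), …, (x n, y n)` is a proper pin sequence without empty rows or columns between its
points. -/
structure FullWalk (x y : ℕ → ℤ) (n : ℕ) : Prop where
  step : ∀ i, 3 ≤ i → i ≤ n → StepAt x y 1 i
  gap_fst : ∀ u v z, 1 ≤ u → u ≤ n → 1 ≤ v → v ≤ n → x u < z → z < x v →
    ∃ j, 1 ≤ j ∧ j ≤ n ∧ x j = z
  gap_snd : ∀ u v z, 1 ≤ u → u ≤ n → 1 ≤ v → v ≤ n → y u < z → z < y v →
    ∃ j, 1 ≤ j ∧ j ≤ n ∧ y j = z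

theorem Above.neg {f : ℕ → ℤ} {a i : ℕ} (h : Above f a i) : Below (fun j => -f j) a i :=
  fun j hj hji => neg_lt_neg (h j hj hji)

theorem Below.neg {f : ℕ → ℤ} {a i : ℕ} (h : Below f a i) : Above (fun j => -f j) a i :=
  fun j hj hji => neg_lt_neg (h j hj hji)

theorem OutAt.neg {f : ℕ → ℤ} {a i : ℕ} (h : OutAt f a i) : OutAt (fun j => -f j) a i :=
  h.symm.imp Below.neg Above.neg

theorem SepAt.neg {f : ℕ → ℤ} {a i : ℕ} (h : SepAt f a i) : SepAt (fun j => -f j) a i := by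
  rcases h with ⟨h, h'⟩ | ⟨h, h'⟩
  · exact Or.inr ⟨fun j hj hji => neg_lt_neg (h j hj hji), neg_lt_neg h'⟩
  · exact Or.inl ⟨fun j hj hji => neg_lt_neg (h j hj hji), neg_lt_neg h'⟩

namespace FullWalk

variable {x y : ℕ → ℤ} {n : ℕ}

theorem symm (h : FullWalk x y n) : FullWalk y x n :=
  ⟨fun i hi hin => (h.step i hi hin).symm, h.gap_snd, h.gap_fst⟩

/-- Together with `symm`, this reflection reduces the four directions of a pin to a single one. -/
theorem neg (h : FullWalk x y n) : FullWalk (fun j => -x j) y n where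
  step i hi hin := (h.step i hi hin).imp (fun h => ⟨h.1.neg, h.2⟩) (fun h => ⟨h.1, h.2.neg⟩)
  gap_fst u v z hu hun hv hvn h1 h2 := by
    obtain ⟨j, hj, hjn, hz⟩ := h.gap_fst v u (-z) hv hvn hu hun (by omega) (by omega)
    exact ⟨j, hj, hjn, by omega⟩
  gap_snd := h.gap_snd

theorem ne (h : FullWalk x y n) {i j : ℕ} (hi : 1 ≤ i) (hij : i < j) (hj : 3 ≤ j) (hjn : j ≤ n) :
    x i ≠ x j := (h.step j hj hjn).fst_ne hi hij

/-- The point that follows `x (i - 1)` in direction of the previous points is next to it. -/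
theorem eq_sub_one (h : FullWalk x y n) {i : ℕ} (hi : 3 ≤ i) (hin : i ≤ n)
    (h1 : ∀ j, 1 ≤ j → j + 1 < i → x j < x i) (h2 : x i < x (i - 1)) : x i = x (i - 1) - 1 := by
  by_contra hne
  obtain ⟨j, hj, hjn, hz⟩ := h.gap_fst i (i - 1) (x (i - 1) - 1) (by omega) hin (by omega)
    (by omega) (by omega) (by omega)
  -- The points before `i - 1` lie to the left of `x i`, so the point in this column comes after
  -- `i`; but then it cuts `x 1` from `x (i - 1)`, which a later pin cannot do.
  have hij : i < j := by
    rcases lt_trichotomy j i with hlt | rfl | hlt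
    · rcases eq_or_ne j (i - 1) with rfl | hne
      · omega
      · have := h1 j hj (by omega); omega
    · omega
    · exact hlt
  have := h1 1 le_rfl (by omega)
  exact (h.step j (by omega) hjn).same_side (u := 1) (v := i - 1) le_rfl (by omega) (by omega)
    (by omega) ⟨by omega, by omega⟩

theorem eq_add_one (h : FullWalk x y n) {i : ℕ} (hi : 3 ≤ i) (hin : i ≤ n)
    (h1 : ∀ j, 1 ≤ j → j + 1 < i → x i < x j) (h2 : x (i - 1) < x i) : x i = x (i - 1) + 1 := by
  have := h.neg.eq_sub_one hi hin (fun j hj hji => neg_lt_neg (h1 j hj hji)) (neg_lt_neg h2)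
  omega

/-- No point after the third one cuts the first two. -/
theorem abs_sub_one_of_outAt (h : FullWalk x y n) (hn : 3 ≤ n) (hne : x 1 ≠ x 2)
    (ho : OutAt x 1 3) : |x 1 - x 2| = 1 := by
  have key : ∀ u v, 1 ≤ u → u ≤ 2 → 1 ≤ v → v ≤ 2 → x u < x v → x u + 1 = x v := by
    intro u v hu hu' hv hv' hlt
    by_contra hne'
    obtain ⟨j, hj, hjn, hz⟩ := h.gap_fst u v (x u + 1) hu (by omega) hv (by omega) (by omega)
      (by omega)
    rcases Nat.lt_or_ge j 3 with h3 | h3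
    · have hju : j ≠ u := by rintro rfl; omega
      have hjv : j ≠ v := by rintro rfl; omega
      have huv : u ≠ v := by rintro rfl; omega
      omega
    · rcases h3.eq_or_lt with rfl | h3
      · exact ho.same_side hu (by omega) hv (by omega) ⟨by omega, by omega⟩
      · exact (h.step j (by omega) hjn).same_side hu (by omega) hv (by omega)
          ⟨by omega, by omega⟩
  rcases lt_or_gt_of_ne hne with hlt | hlt
  · have := key 1 2 (by omega) (by omega) (by omega) (by omega) hlt
    rw [abs_eq (by omega)]; omega
  · have := key 2 1 (by omega) (by omega) (by omega) (by omega) hlt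
    rw [abs_eq (by omega)]; omega

/-- From the fourth on, pins do not cut the first two. So the third one is the only pin strictly
between them in this coordinate. -/
theorem abs_sub_two_of_sepAt (h : FullWalk x y n) (hn : 3 ≤ n)
    (hs : SepAt x 1 3) : |x 1 - x 2| = 2 := by
  have key : ∀ z, ((x 1 < z ∧ z < x 2) ∨ (x 2 < z ∧ z < x 1)) → z = x 3 := by
    intro z hz
    obtain ⟨j, hj, hjn, rfl⟩ : ∃ j, 1 ≤ j ∧ j ≤ n ∧ x j = z := by
      rcases hz with hz | hz
      · exact h.gap_fst 1 2 z (by omega) (by omega) (by omega) (by omega) hz.1 hz.2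
      · exact h.gap_fst 2 1 z (by omega) (by omega) (by omega) (by omega) hz.1 hz.2
    have h1 : j ≠ 1 := by rintro rfl; omega
    have h2 : j ≠ 2 := by rintro rfl; omega
    by_contra hne
    have h3 : j ≠ 3 := by rintro rfl; omega
    have s := h.step j (by omega) hjn
    have n1 := s.same_side (u := 1) (v := 2) (by omega) (by omega) (by omega) (by omega)
    have n2 := s.same_side (u := 2) (v := 1) (by omega) (by omega) (by omega) (by omega)
    tauto
  rw [abs_eq (by omega)]
  rcases hs with ⟨h1, h2⟩ | ⟨h1, h2⟩ <;> have h1 := h1 1 le_rfl (by omega) <;> norm_num at h2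
  · have a := key (x 1 + 1); have b := key (x 2 - 1); omega
  · have a := key (x 2 + 1); have b := key (x 1 - 1); omega

/-- Separating steps alternate between the coordinates: after the first one, `f 1` and `f (i - 1)`
are on different sides of `f i`, while the second one needs both on the same side. -/
theorem not_sepAt_succ {f : ℕ → ℤ} {i : ℕ} (hi : 3 ≤ i) (h : SepAt f 1 i) :
    ¬ SepAt f 1 (i + 1) := by
  intro h'
  rcases h with ⟨h1, h2⟩ | ⟨h1, h2⟩ <;> rcases h' with ⟨h3, h4⟩ | ⟨h3, h4⟩ <;>
    have a := h1 1 le_rfl (by omega) <;> have b := h3 1 le_rfl (by omega) <;>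
    have c := h3 (i - 1) (by omega) (by omega) <;> rw [Nat.add_sub_cancel] at h4 <;> omega

/-- The row of pin `j + 1` lies strictly between that of pin `j` and those of all earlier pins. A
knight move from `j` to `i` must then use two rows and one column, which makes `i` the highest pin
before `j`, hence placed from above. Then `x i` lies between `x 1` and `x (i - 1)`, and one of these
columns gets in the way of `x i` and `x j` being adjacent, unless `j = i + 1`, when two consecutive
steps would separate in the same coordinate. -/
theorem not_near_of_sepAt_of_above (h : FullWalk x y n) {i j : ℕ} (hi : 3 ≤ i) (hij : i < j)
    (hj : j < n) (hsx : SepAt x 1 j) (hay : Above y 1 j) :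
    ¬ (|x i - x j| = 1 ∧ |y i - y j| = 2 ∨ |x i - x j| = 2 ∧ |y i - y j| = 1) := by
  have hy : SepAt y 1 (j + 1) := by
    rcases h.step (j + 1) (by omega) (by omega) with hs | hs
    · exact absurd hs.1 (not_sepAt_succ (by omega) hsx)
    · exact hs.1
  obtain ⟨hlow, hup⟩ : (∀ k, 1 ≤ k → k < j → y k < y (j + 1)) ∧ y (j + 1) < y j := by
    have a := hay 1 le_rfl (by omega)
    rcases hy with ⟨h1, h2⟩ | ⟨h1, h2⟩
    · exact ⟨fun k hk hkj => h1 k hk (by omega), h2⟩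
    · have := h1 1 le_rfl (by omega)
      rw [Nat.add_sub_cancel] at h2
      omega
  intro hk
  have hyi := hlow i (by omega) hij
  have hk' : |x i - x j| = 1 ∧ |y i - y j| = 2 := by
    rcases hk with hk | ⟨_, hk⟩
    · exact hk
    · rw [abs_eq (by omega)] at hk; omega
  obtain ⟨hx1, hy2⟩ := hk'
  rw [abs_eq (by omega)] at hx1 hy2
  have hmax : ∀ k, 1 ≤ k → k < j → y k ≤ y i := by
    intro k hk hkj
    have := hlow k hk hkj
    omega
  -- A step separating in `y` would leave an earlier pin above `i`, although `i` is the highest one.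
  have hsi : SepAt x 1 i := by
    rcases h.step i hi (by omega) with hs | hs
    · exact hs.1
    · rcases hs.1 with ⟨h1, h2⟩ | ⟨h1, h2⟩
      · have := hmax (i - 1) (by omega) (by omega); omega
      · have := h1 1 le_rfl (by omega)
        have := hmax 1 (by omega) (by omega); omega
  rcases Nat.lt_or_ge (i + 1) j with hlt | hge
  -- The sign `s` treats both orientations of the column separation at once.
  · have hor : ∀ s : ℤ, s = 1 ∨ s = -1 →
        (∀ k, 1 ≤ k → k + 1 < j → s * x k < s * x j) → False := by
      rintro s hs hlow
      have a := hlow 1 le_rfl (by omega)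
      have b := hlow (i - 1) (by omega) (by omega)
      have c := hlow i (by omega) (by omega)
      have n1 := h.ne (i := 1) (j := i) le_rfl (by omega) hi (by omega)
      have n2 := h.ne (i := i - 1) (j := i) (by omega) (by omega) hi (by omega)
      rcases hsi with ⟨h1, h2⟩ | ⟨h1, h2⟩ <;> have h1 := h1 1 le_rfl (by omega) <;>
        rcases hs with rfl | rfl <;> omega
    rcases hsx with ⟨h1, h2⟩ | ⟨h1, h2⟩
    · exact hor 1 (by simp) fun k hk hkj => by have := h1 k hk hkj; omega
    · exact hor (-1) (by simp) fun k hk hkj => by have := h1 k hk hkj; omega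
  · obtain rfl : j = i + 1 := by omega
    exact not_sepAt_succ hi hsi hsx

/-- Two points in knight position include one of the first two points or the last one. -/
theorem not_near (h : FullWalk x y n) {i j : ℕ} (hi : 3 ≤ i) (hij : i < j) (hj : j < n) :
    ¬ (|x i - x j| = 1 ∧ |y i - y j| = 2 ∨ |x i - x j| = 2 ∧ |y i - y j| = 1) := by
  have key : ∀ x y : ℕ → ℤ, FullWalk x y n → SepAt x 1 j → OutAt y 1 j →
      ¬ (|x i - x j| = 1 ∧ |y i - y j| = 2 ∨ |x i - x j| = 2 ∧ |y i - y j| = 1) := by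
    rintro x y h hs (ho | ho)
    · exact h.not_near_of_sepAt_of_above hi hij hj hs ho
    · have := h.symm.neg.symm.not_near_of_sepAt_of_above hi hij hj hs ho.neg
      rwa [neg_sub_neg, abs_sub_comm (y j)] at this
  rcases h.step j (by omega) hj.le with hs | hs
  · exact key x y h hs.1 hs.2
  · have := key y x h.symm hs.1 hs.2
    tauto

end FullWalk

/-! ### Counting knight pairs -/

section KnightCount

variable {n : ℕ} {σ : Equiv.Perm (Fin n)}

theorem IsWalk.fullWalk {q : ℕ → Pin} {d : ℕ → Letter} (h : IsWalk σ n q d) :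
    FullWalk (fun j => (q j).1) (fun j => (q j).2) n where
  step i hi hin := (h.turn i hi hin).stepAt
  gap_fst u v z hu hun hv hvn h1 h2 := by
    obtain ⟨c, hc⟩ := h.mem u hu hun
    obtain ⟨c', hc'⟩ := h.mem v hv hvn
    simp only [hc, hc', point] at h1 h2
    obtain ⟨j, hj, hjn, hq⟩ := h.surj ⟨z.toNat, by omega⟩
    exact ⟨j, hj, hjn, by simp only [hq, point]; omega⟩
  gap_snd u v z hu hun hv hvn h1 h2 := by
    obtain ⟨c, hc⟩ := h.mem u hu hun
    obtain ⟨c', hc'⟩ := h.mem v hv hvn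
    simp only [hc, hc', point] at h1 h2
    obtain ⟨j, hj, hjn, hq⟩ := h.surj (σ.symm ⟨z.toNat, by omega⟩)
    exact ⟨j, hj, hjn, by simp only [hq, point, Equiv.apply_symm_apply]; omega⟩

theorem isKnight_iff_point {a b : Fin n} :
    IsKnight σ a b ↔
      (|(point σ a).1 - (point σ b).1| = 1 ∧ |(point σ a).2 - (point σ b).2| = 2) ∨
      (|(point σ a).1 - (point σ b).1| = 2 ∧ |(point σ a).2 - (point σ b).2| = 1) := Iff.rfl

theorem IsKnight.symm {a b : Fin n} (h : IsKnight σ a b) : IsKnight σ b a := by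
  unfold IsKnight at *
  rwa [abs_sub_comm, abs_sub_comm ((σ b : ℕ) : ℤ)]

/-- The first two points of a walk through the whole diagram are in knight position. -/
theorem IsWalk.isKnight_start (hn : 3 ≤ n) {q : ℕ → Pin} {d : ℕ → Letter} (h : IsWalk σ n q d)
    {a b : Fin n} (ha : q 1 = point σ a) (hb : q 2 = point σ b) : IsKnight σ a b := by
  have hab : a ≠ b := by rintro rfl; exact h.start (by omega) (ha.trans hb.symm)
  have hx : (q 1).1 ≠ (q 2).1 := by
    rw [ha, hb]; simp only [point]; have := Fin.val_ne_of_ne hab; omega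
  have hy : (q 1).2 ≠ (q 2).2 := by
    rw [ha, hb]; exact fun he => hab (point_eq_of_snd he)
  rw [isKnight_iff_point, ← ha, ← hb]
  rcases h.fullWalk.step 3 le_rfl hn with hs | hs
  · exact Or.inr ⟨h.fullWalk.abs_sub_two_of_sepAt hn hs.1,
      h.fullWalk.symm.abs_sub_one_of_outAt hn hy hs.2⟩
  · exact Or.inl ⟨h.fullWalk.abs_sub_one_of_outAt hn hx hs.2,
      h.fullWalk.symm.abs_sub_two_of_sepAt hn hs.1⟩

/-- A knight neighbour is determined by its column, and only four columns are close enough. -/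
theorem ncard_isKnight_le (c : Fin n) : {y | IsKnight σ c y}.ncard ≤ 4 := by
  have hsub : (fun y : Fin n => (y : ℤ) - c) '' {y | IsKnight σ c y} ⊆
      (({1, -1, 2, -2} : Finset ℤ) : Set ℤ) := by
    rintro _ ⟨y, hy | hy, rfl⟩ <;> have h := hy.1 <;> rw [abs_eq (by omega)] at h <;>
      simp only [Finset.coe_insert, Finset.coe_singleton, Set.mem_insert_iff,
        Set.mem_singleton_iff] <;> omega
  have hinj : Function.Injective (fun y : Fin n => (y : ℤ) - c) := by
    intro a b h
    simp only at h
    exact Fin.ext (by omega)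
  rw [← Set.ncard_image_of_injective _ hinj]
  refine (Set.ncard_le_ncard hsub (Finset.finite_toSet _)).trans ?_
  rw [Set.ncard_coe_finset]
  rfl

theorem ncard_isKnight_pairs_le (c : Fin n) :
    {q : Fin n × Fin n | IsKnight σ q.1 q.2 ∧ (q.1 = c ∨ q.2 = c)}.ncard ≤ 8 := by
  have hsub : {q : Fin n × Fin n | IsKnight σ q.1 q.2 ∧ (q.1 = c ∨ q.2 = c)} ⊆
      (fun y => (c, y)) '' {y | IsKnight σ c y} ∪ (fun y => (y, c)) '' {y | IsKnight σ c y} := by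
    rintro ⟨a, b⟩ ⟨h, rfl | rfl⟩
    · exact Or.inl ⟨b, h, rfl⟩
    · exact Or.inr ⟨a, h.symm, rfl⟩
  calc _ ≤ _ := Set.ncard_le_ncard hsub (Set.toFinite _)
    _ ≤ _ := Set.ncard_union_le _ _
    _ ≤ 4 + 4 := add_le_add ((Set.ncard_image_le (Set.toFinite _)).trans (ncard_isKnight_le c))
      ((Set.ncard_image_le (Set.toFinite _)).trans (ncard_isKnight_le c))

theorem IsSimple.ncard_knights_le (hσ : IsSimple σ) (h : IsPinPermutation σ) :
    {q : Fin n × Fin n | IsKnight σ q.1 q.2}.ncard ≤ 48 := by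
  obtain ⟨p, e, hp⟩ := h
  rcases Nat.lt_or_ge n 3 with hn | hn
  -- Below length 3 there are at most four pairs of points altogether.
  · calc _ ≤ (Set.univ : Set (Fin n × Fin n)).ncard :=
        Set.ncard_le_ncard (Set.subset_univ _) (Set.toFinite _)
      _ = n * n := by simp [Set.ncard_univ]
      _ ≤ 48 := by nlinarith
  obtain ⟨d, hd⟩ := hp.exists_isWalk fun i hi hin => hp.stepAt_of_isSimple hσ hi hin
  set K := fun c : Fin n => {q : Fin n × Fin n | IsKnight σ q.1 q.2 ∧ (q.1 = c ∨ q.2 = c)} with hK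
  -- Every knight pair meets the first, the second or the last pin, whose zero-based indices are
  -- `0`, `1` and `n - 1`.
  have hsub : {q : Fin n × Fin n | IsKnight σ q.1 q.2} ⊆
      K (e ⟨0, by omega⟩) ∪ K (e ⟨1, by omega⟩) ∪ K (e ⟨n - 1, by omega⟩) := by
    have key : ∀ i j : Fin n, (i : ℕ) < j → IsKnight σ (e i) (e j) →
        (i : ℕ) = 0 ∨ (i : ℕ) = 1 ∨ (j : ℕ) = n - 1 := by
      intro i j hij hk
      by_contra hne
      rw [isKnight_iff_point, ← diagram_succ σ e, ← diagram_succ σ e] at hk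
      exact hd.fullWalk.not_near (i := i + 1) (j := j + 1) (by omega) (by omega) (by omega) hk
    rintro ⟨a, b⟩ (hab : IsKnight σ a b)
    obtain ⟨i, rfl⟩ := e.surjective a
    obtain ⟨j, rfl⟩ := e.surjective b
    have : ∀ k : Fin n, ((k : ℕ) = 0 ∨ (k : ℕ) = 1 ∨ (k : ℕ) = n - 1) → (k = i ∨ k = j) →
        (e i, e j) ∈ K (e ⟨0, by omega⟩) ∪ K (e ⟨1, by omega⟩) ∪ K (e ⟨n - 1, by omega⟩) := by
      intro k hk hkij
      have hkm : (e i, e j) ∈ K (e k) := ⟨hab, by rcases hkij with rfl | rfl <;> simp⟩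
      rcases hk with hk | hk | hk
      · rw [show k = ⟨0, by omega⟩ from Fin.ext hk] at hkm
        exact Or.inl (Or.inl hkm)
      · rw [show k = ⟨1, by omega⟩ from Fin.ext hk] at hkm
        exact Or.inl (Or.inr hkm)
      · rw [show k = ⟨n - 1, by omega⟩ from Fin.ext hk] at hkm
        exact Or.inr hkm
    rcases lt_trichotomy (i : ℕ) j with hlt | heq | hlt
    · rcases key i j hlt hab with hk | hk | hk
      exacts [this i (by omega) (by simp), this i (by omega) (by simp), this j (by omega) (by simp)]
    · obtain rfl := Fin.ext heq
      rcases hab with hab | hab <;> simp at hab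
    · rcases key j i hlt hab.symm with hk | hk | hk
      exacts [this j (by omega) (by simp), this j (by omega) (by simp), this i (by omega) (by simp)]
  calc _ ≤ _ := Set.ncard_le_ncard hsub (Set.toFinite _)
    _ ≤ _ := Set.ncard_union_le _ _
    _ ≤ (8 + 8) + 8 := add_le_add ((Set.ncard_union_le _ _).trans
      (add_le_add (ncard_isKnight_pairs_le _) (ncard_isKnight_pairs_le _)))
      (ncard_isKnight_pairs_le _)
    _ ≤ 48 := by norm_num

end KnightCount


/-! ### Pin words of simple permutations -/

/-- `p` lies in the quadrant `l` of `b`. -/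
def InQuadrant (p b : Pin) : Letter → Prop
  | .one => b.1 < p.1 ∧ b.2 < p.2
  | .two => p.1 < b.1 ∧ b.2 < p.2
  | .three => p.1 < b.1 ∧ p.2 < b.2
  | .four => b.1 < p.1 ∧ p.2 < b.2
  | _ => False

theorem outAt_of_inQuadrant {p : ℕ → Pin} {a i : ℕ} {l : Letter}
    (h : ∀ j, a ≤ j → j < i → InQuadrant (p i) (p j) l) :
    OutAt (fun j => (p j).1) a i ∧ OutAt (fun j => (p j).2) a i := by
  cases l <;> simp only [InQuadrant] at h
  · exact ⟨.inl fun j hj hji => (h j hj hji).1, .inl fun j hj hji => (h j hj hji).2⟩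
  · exact ⟨.inr fun j hj hji => (h j hj hji).1, .inl fun j hj hji => (h j hj hji).2⟩
  · exact ⟨.inr fun j hj hji => (h j hj hji).1, .inr fun j hj hji => (h j hj hji).2⟩
  · exact ⟨.inl fun j hj hji => (h j hj hji).1, .inr fun j hj hji => (h j hj hji).2⟩
  all_goals exact ⟨.inl fun j hj hji => (h j hj hji).elim, .inl fun j hj hji => (h j hj hji).elim⟩

theorem independent_of_outAt {p : ℕ → Pin} {a i : ℕ}
    (h : OutAt (fun j => (p j).1) a i ∧ OutAt (fun j => (p j).2) a i) :
    Independent (p i) (p '' Set.Ico a i) :=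
  (independent_iff (p := p) fun _ hj hji => ⟨h.1.ne hj hji, h.2.ne hj hji⟩).2 h

/-- Lying in one quadrant of all earlier pins makes both coordinates extreme, so the independence
required by a numeral is automatic. The assumption `1 ≤ i` keeps the quadrant condition from being
vacuous. -/
theorem hasLetter_iff {p : ℕ → Pin} {i : ℕ} {l : Letter} (hi : 1 ≤ i) :
    HasLetter p i l ↔ (2 ≤ i ∧ Turn 0 p i l) ∨ ∀ j, 0 ≤ j → j < i → InQuadrant (p i) (p j) l := by
  have key : ∀ l, (∀ j, 0 ≤ j → j < i → InQuadrant (p i) (p j) l) →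
      Independent (p i) (p '' Set.Ico 0 i) := fun l h =>
    independent_of_outAt (outAt_of_inQuadrant h)
  have triv : ¬ ∀ j, 0 ≤ j → j < i → False := fun h => h 0 le_rfl hi
  cases l <;> simp only [HasLetter, separatesV_iff, separatesH_iff, Set.forall_mem_image,
    Set.mem_Ico, and_imp, Turn, InQuadrant, Above, Below, and_false, false_or, triv, or_false]
  · exact ⟨fun h => h.2, fun h => ⟨key .one h, h⟩⟩
  · exact ⟨fun h => h.2, fun h => ⟨key .two h, h⟩⟩
  · exact ⟨fun h => h.2, fun h => ⟨key .three h, h⟩⟩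
  · exact ⟨fun h => h.2, fun h => ⟨key .four h, h⟩⟩

theorem OutAt.not_inBoundingBox_fst {p : ℕ → Pin} {a i : ℕ} (h : OutAt (fun j => (p j).1) a i) :
    ¬ InBoundingBox (p i) (p '' Set.Ico a i) := by
  rintro ⟨⟨⟨_, ⟨j, hj, rfl⟩, h1⟩, ⟨_, ⟨k, hk, rfl⟩, h2⟩⟩, -⟩
  rcases h with h | h
  · exact absurd (h k hk.1 hk.2) h2.not_gt
  · exact absurd (h j hj.1 hj.2) h1.not_gt

theorem OutAt.not_inBoundingBox_snd {p : ℕ → Pin} {a i : ℕ} (h : OutAt (fun j => (p j).2) a i) :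
    ¬ InBoundingBox (p i) (p '' Set.Ico a i) := by
  rintro ⟨-, ⟨⟨_, ⟨j, hj, rfl⟩, h1⟩, ⟨_, ⟨k, hk, rfl⟩, h2⟩⟩⟩
  rcases h with h | h
  · exact absurd (h k hk.1 hk.2) h2.not_gt
  · exact absurd (h j hj.1 hj.2) h1.not_gt

theorem isPinSequence_of_steps {p : ℕ → Pin} {a b : ℕ}
    (hne : ∀ i, a ≤ i → ∀ j, i < j → j ≤ b → (p i).1 ≠ (p j).1 ∧ (p i).2 ≠ (p j).2)
    (h : ∀ i, a < i → i ≤ b → StepAt (fun j => (p j).1) (fun j => (p j).2) a i ∨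
      (OutAt (fun j => (p j).1) a i ∧ OutAt (fun j => (p j).2) a i)) : IsPinSequence p a b := by
  constructor
  · rintro i ⟨hi, hib⟩ j ⟨hj, hjb⟩ hij
    rcases lt_or_gt_of_ne hij with hlt | hlt
    · exact hne i hi j hlt hjb
    · exact (hne j hj i hlt hib).imp Ne.symm Ne.symm
  · intro i hi hib
    rcases h i hi hib with (h | h) | h
    · exact ⟨h.2.not_inBoundingBox_snd, Or.inl (Or.inl (separatesV_iff.2 h.1))⟩
    · exact ⟨h.2.not_inBoundingBox_fst, Or.inl (Or.inr (separatesH_iff.2 h.1))⟩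
    · exact ⟨h.1.not_inBoundingBox_fst, Or.inr (independent_of_outAt h)⟩

/-- The possible first two letters of a pin word, according to the position of the second pin with
respect to the first one and to the direction of the third pin. -/
def firstLetters (p₁ p₂ : Pin) (l : Letter) : List (Letter × Letter) :=
  if p₁.1 < p₂.1 then
    if p₁.2 < p₂.2 then
      [(.one, .one), (.two, .one), (.three, .one), (.four, .one)] ++
        if dirCode l < 3 then [(.three, .R), (.four, .R)] else [(.two, .U), (.three, .U)]
    else
      [(.one, .four), (.two, .four), (.three, .four), (.four, .four)] ++
        if dirCode l < 3 then [(.one, .R), (.two, .R)] else [(.two, .D), (.three, .D)]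
  else
    if p₁.2 < p₂.2 then
      [(.one, .two), (.two, .two), (.three, .two), (.four, .two)] ++
        if dirCode l < 3 then [(.three, .L), (.four, .L)] else [(.one, .U), (.four, .U)]
    else
      [(.one, .three), (.two, .three), (.three, .three), (.four, .three)] ++
        if dirCode l < 3 then [(.one, .L), (.two, .L)] else [(.one, .D), (.four, .D)]

/-- The word with the first two letters `ab` and the directions `d 3, …, d n`. -/
def wordOf (n : ℕ) (ab : Letter × Letter) (d : ℕ → Letter) : List Letter :=
  ab.1 :: ab.2 :: (List.range (n - 2)).map fun t => d (t + 3)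

theorem firstLetters_congr {p₁ p₂ q₁ q₂ : Pin} (h1 : p₁.1 < p₂.1 ↔ q₁.1 < q₂.1)
    (h2 : p₁.2 < p₂.2 ↔ q₁.2 < q₂.2) (l : Letter) :
    firstLetters p₁ p₂ l = firstLetters q₁ q₂ l := by
  simp only [firstLetters, h1, h2]

/-! ### The first two letters of a pin word -/

section

variable {f : ℕ → ℤ}

theorem sepAt_zero_two :
    SepAt f 0 2 ↔ (f 0 < f 2 ∧ f 2 < f 1) ∨ (f 2 < f 0 ∧ f 1 < f 2) := by
  have h : ∀ P : ℕ → Prop, (∀ j, 0 ≤ j → j + 1 < 2 → P j) ↔ P 0 := fun P =>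
    ⟨fun h => h 0 le_rfl (by omega), fun h j _ hj => by obtain rfl : j = 0 := by omega
                                                        exact h⟩
  simp only [SepAt, h]

theorem sepAt_zero_three :
    SepAt f 0 3 ↔ ((f 0 < f 3 ∧ f 1 < f 3) ∧ f 3 < f 2) ∨ ((f 3 < f 0 ∧ f 3 < f 1) ∧ f 2 < f 3) := by
  have h : ∀ P : ℕ → Prop, (∀ j, 0 ≤ j → j + 1 < 3 → P j) ↔ P 0 ∧ P 1 := fun P =>
    ⟨fun h => ⟨h 0 le_rfl (by omega), h 1 (by omega) (by omega)⟩, fun h j _ hj => by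
      have : j < 2 := by omega
      interval_cases j
      exacts [h.1, h.2]⟩
  simp only [SepAt, h]

theorem forall_lt_two {P : ℕ → Prop} : (∀ j, 0 ≤ j → j < 2 → P j) ↔ P 0 ∧ P 1 :=
  ⟨fun h => ⟨h 0 le_rfl (by omega), h 1 (by omega) (by omega)⟩, fun h j _ hj => by
    interval_cases j
    exacts [h.1, h.2]⟩

theorem forall_lt_one {P : ℕ → Prop} : (∀ j, 0 ≤ j → j < 1 → P j) ↔ P 0 :=
  ⟨fun h => h 0 le_rfl (by omega), fun h j _ hj => by
    interval_cases j
    exact h⟩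

end

/-- The third pin keeps the origin on the side of the first pin. If it separates by its column, the
origin cannot lie beyond the column of the second pin, which excludes `U` and `D` as second letter;
if it separates by its row, `L` and `R` are excluded. The remaining cases are comparisons of
coordinates. -/
theorem mem_firstLetters {p : ℕ → Pin} {a b l : Letter} (h1 : HasLetter p 1 a)
    (h2 : HasLetter p 2 b) (h3 : Turn 0 p 3 l) : (a, b) ∈ firstLetters (p 1) (p 2) l := by
  rw [hasLetter_iff (by omega)] at h1 h2
  simp only [forall_lt_two, forall_lt_one, Nat.not_ofNat_le_one, false_and, false_or, le_refl,
    true_and] at h1 h2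
  -- The codes of `U` and `D` are those below 3 among the directions, so the test tells which
  -- coordinate is separated.
  have h3 : (dirCode l < 3 ∧ SepAt (fun j => (p j).1) 0 3) ∨
      (¬ dirCode l < 3 ∧ SepAt (fun j => (p j).2) 0 3) := by
    cases l <;> simp only [Turn] at h3 <;> simp [dirCode, h3.1]
  rcases h3 with ⟨hl, h3⟩ | ⟨hl, h3⟩ <;> rw [sepAt_zero_three] at h3 <;>
    simp only [firstLetters, hl, if_true, if_false] <;>
    cases a <;> simp only [InQuadrant] at h1 <;> cases b <;>
    simp only [InQuadrant, Turn, false_and, false_or, or_false, sepAt_zero_two, Above, Below,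
      forall_lt_two] at h2 <;> split_ifs <;>
    first | (exfalso; omega) | simp

/-! ### Inserting an origin into a walk -/

/-- The coordinate of an origin next to `f u`, in a grid three times as fine. -/
def withOrigin (f : ℕ → ℤ) (u : ℕ) (ε : ℤ) (j : ℕ) : ℤ := if j = 0 then 3 * f u + ε else 3 * f j

section WithOrigin

variable {f : ℕ → ℤ} {u i : ℕ} {ε : ℤ}

theorem withOrigin_of_pos {j : ℕ} (hj : 1 ≤ j) : withOrigin f u ε j = 3 * f j :=
  if_neg (by omega)

theorem withOrigin_zero : withOrigin f u ε 0 = 3 * f u + ε := if_pos rfl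

/-- The origin behaves like the pin `u` next to it. At `i = 3` the pin 2 is the one being separated,
so there the origin must be next to pin 1. -/
theorem SepAt.withOrigin (h : SepAt f 1 i) (hi : 3 ≤ i) (hu : u = 1 ∨ (u = 2 ∧ 3 < i))
    (hε : ε = 1 ∨ ε = -1) : SepAt (withOrigin f u ε) 0 i := by
  rcases h with ⟨h1, h2⟩ | ⟨h1, h2⟩
  · refine Or.inl ⟨fun j _ hji => ?_, ?_⟩
    · rw [withOrigin_of_pos (j := i) (by omega)]
      rcases Nat.eq_zero_or_pos j with rfl | hj
      · have := h1 u (by omega) (by omega)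
        rw [withOrigin_zero]; omega
      · have := h1 j hj hji
        rw [withOrigin_of_pos hj]; omega
    · rw [withOrigin_of_pos (by omega), withOrigin_of_pos (by omega)]; omega
  · refine Or.inr ⟨fun j _ hji => ?_, ?_⟩
    · rw [withOrigin_of_pos (j := i) (by omega)]
      rcases Nat.eq_zero_or_pos j with rfl | hj
      · have := h1 u (by omega) (by omega)
        rw [withOrigin_zero]; omega
      · have := h1 j hj hji
        rw [withOrigin_of_pos hj]; omega
    · rw [withOrigin_of_pos (by omega), withOrigin_of_pos (by omega)]; omega

theorem Above.withOrigin (h : Above f 1 i) (hi : 3 ≤ i) (hu : u = 1 ∨ u = 2)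
    (hε : ε = 1 ∨ ε = -1) : Above (withOrigin f u ε) 0 i := by
  intro j _ hji
  rw [withOrigin_of_pos (j := i) (by omega)]
  rcases Nat.eq_zero_or_pos j with rfl | hj
  · have := h u (by omega) (by omega)
    rw [withOrigin_zero]; omega
  · have := h j hj hji
    rw [withOrigin_of_pos hj]; omega

theorem Below.withOrigin (h : Below f 1 i) (hi : 3 ≤ i) (hu : u = 1 ∨ u = 2)
    (hε : ε = 1 ∨ ε = -1) : Below (withOrigin f u ε) 0 i := by
  intro j _ hji
  rw [withOrigin_of_pos (j := i) (by omega)]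
  rcases Nat.eq_zero_or_pos j with rfl | hj
  · have := h u (by omega) (by omega)
    rw [withOrigin_zero]; omega
  · have := h j hj hji
    rw [withOrigin_of_pos hj]; omega

theorem Turn.withOrigin {q : ℕ → Pin} {l : Letter} {v : ℕ} {δ : ℤ} (h : Turn 1 q i l)
    (hi : 3 ≤ i) (hu : u = 1 ∨ u = 2) (hv : v = 1 ∨ v = 2) (hε : ε = 1 ∨ ε = -1)
    (hδ : δ = 1 ∨ δ = -1) (hul : i = 3 → dirCode l < 3 → u = 1)
    (hvl : i = 3 → ¬ dirCode l < 3 → v = 1) :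
    Turn 0 (fun j => (withOrigin (fun j => (q j).1) u ε j, withOrigin (fun j => (q j).2) v δ j))
      i l := by
  cases l <;> simp only [Turn, dirCode] at *
  · exact ⟨h.1.withOrigin hi (by omega) hε, h.2.withOrigin hi hv hδ⟩
  · exact ⟨h.1.withOrigin hi (by omega) hε, h.2.withOrigin hi hv hδ⟩
  · exact ⟨h.1.withOrigin hi (by omega) hδ, h.2.withOrigin hi hu hε⟩
  · exact ⟨h.1.withOrigin hi (by omega) hδ, h.2.withOrigin hi hu hε⟩

end WithOrigin

/-- For every admissible pair of first letters there is an origin next to the lines through the first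
two pins. -/
theorem exists_origin {q : ℕ → Pin} {a b l : Letter} (hx : (q 1).1 ≠ (q 2).1)
    (hy : (q 1).2 ≠ (q 2).2) (h : (a, b) ∈ firstLetters (q 1) (q 2) l) :
    ∃ u v ε δ, (u = 1 ∨ u = 2) ∧ (v = 1 ∨ v = 2) ∧ (ε = 1 ∨ ε = -1) ∧ (δ = 1 ∨ δ = -1) ∧
      (dirCode l < 3 → u = 1) ∧ (¬ dirCode l < 3 → v = 1) ∧
      ∀ p : ℕ → Pin, p = (fun j => (withOrigin (fun j => (q j).1) u ε j,
        withOrigin (fun j => (q j).2) v δ j)) → HasLetter p 1 a ∧ HasLetter p 2 b := by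
  -- The origin is next to the line of pin 2 exactly in the coordinate in which pin 2 must separate
  -- it from pin 1, and otherwise next to that of pin 1. The signs place pin 1 in the quadrant
  -- prescribed by `a`.
  refine ⟨if b = .U ∨ b = .D then 2 else 1, if b = .L ∨ b = .R then 2 else 1,
    if a = .two ∨ a = .three then 1 else -1, if a = .three ∨ a = .four then 1 else -1,
    by split_ifs <;> simp, by split_ifs <;> simp, by split_ifs <;> simp, by split_ifs <;> simp,
    ?_, ?_, ?_⟩
  · intro hl
    simp only [firstLetters, hl, if_true] at h
    split_ifs at h <;> revert h <;> cases a <;> cases b <;> simp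
  · intro hl
    simp only [firstLetters, hl, if_false] at h
    split_ifs at h <;> revert h <;> cases a <;> cases b <;> simp
  · intro p hp
    have e0 := congrFun hp 0
    have e1 := congrFun hp 1
    have e2 := congrFun hp 2
    rw [withOrigin_zero, withOrigin_zero] at e0
    rw [withOrigin_of_pos (by omega), withOrigin_of_pos (by omega)] at e1 e2
    clear hp
    rw [hasLetter_iff (by omega), hasLetter_iff (by omega)]
    simp only [forall_lt_two, forall_lt_one, Nat.not_ofNat_le_one, false_and, false_or, le_refl,
      true_and]
    simp only [firstLetters] at h
    split_ifs at h <;>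
    simp only [List.cons_append, List.nil_append, List.mem_cons, Prod.mk.injEq, List.not_mem_nil,
      or_false] at h <;>
    (rcases h with ⟨rfl, rfl⟩ | ⟨rfl, rfl⟩ | ⟨rfl, rfl⟩ | ⟨rfl, rfl⟩ | ⟨rfl, rfl⟩ | ⟨rfl, rfl⟩ <;>
      simp only [InQuadrant, Turn, sepAt_zero_two, Above, Below, forall_lt_two, e0, e1, e2] <;>
      simp <;> omega)

section

variable {n : ℕ} {σ : Equiv.Perm (Fin n)}

/-- Tripling the coordinates of the diagram makes room for the origin without changing the order of
the pins. -/
theorem IsWalk.isPinWordOf (hn : 3 ≤ n) {q : ℕ → Pin} {d : ℕ → Letter} (h : IsWalk σ n q d)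
    {ab : Letter × Letter} (hab : ab ∈ firstLetters (q 1) (q 2) (d 3)) :
    IsPinWordOf (wordOf n ab d) σ := by
  have hneq : ∀ i, 1 ≤ i → ∀ j, i < j → j ≤ n → (q i).1 ≠ (q j).1 ∧ (q i).2 ≠ (q j).2 := by
    intro i hi j hij hj
    have hne := h.ne hi hij hj
    obtain ⟨c, hc⟩ := h.mem i hi (by omega)
    obtain ⟨c', hc'⟩ := h.mem j (by omega) hj
    rw [hc, hc'] at hne ⊢
    refine ⟨fun he => hne ?_, fun he => hne (congrArg _ (point_eq_of_snd he))⟩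
    simp only [point, Nat.cast_inj] at he
    rw [Fin.ext he]
  have h12 := hneq 1 le_rfl 2 (by omega) (by omega)
  obtain ⟨u, v, ε, δ, hu, hv, hε, hδ, hul, hvl, hp⟩ :=
    exists_origin h12.1 h12.2 hab
  set p : ℕ → Pin := fun j => (withOrigin (fun j => (q j).1) u ε j,
    withOrigin (fun j => (q j).2) v δ j) with hpdef
  obtain ⟨hl1, hl2⟩ := hp p rfl
  have hp1 : ∀ j, 1 ≤ j → p j = (3 * (q j).1, 3 * (q j).2) := fun j hj => by
    simp only [hpdef, withOrigin_of_pos hj]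
  have hp0 : p 0 = (3 * (q u).1 + ε, 3 * (q v).2 + δ) := by simp only [hpdef, withOrigin_zero]
  have hturn : ∀ i, 3 ≤ i → i ≤ n → Turn 0 p i (d i) := fun i hi hin =>
    (h.turn i hi hin).withOrigin hi hu hv hε hδ (by rintro rfl; exact hul)
      (by rintro rfl; exact hvl)
  have hne : ∀ i, 0 ≤ i → ∀ j, i < j → j ≤ n → (p i).1 ≠ (p j).1 ∧ (p i).2 ≠ (p j).2 := by
    intro i _ j hij hj
    rw [hp1 j (by omega)]
    rcases Nat.eq_zero_or_pos i with rfl | hi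
    -- The coordinates of the origin are not divisible by 3, those of the other pins are.
    · rw [hp0]; exact ⟨by simp only; omega, by simp only; omega⟩
    · have := hneq i hi j hij hj
      rw [hp1 i hi]; exact ⟨by simp only; omega, by simp only; omega⟩
  have hletter : ∀ i, 1 ≤ i → i ≤ n →
      HasLetter p i (if i = 1 then ab.1 else if i = 2 then ab.2 else d i) := by
    intro i hi hin
    split_ifs with h1 h2
    · exact h1 ▸ hl1
    · exact h2 ▸ hl2
    · exact (hasLetter_iff hi).2 (Or.inl ⟨by omega, hturn i (by omega) hin⟩)
  obtain ⟨e, he⟩ := h.exists_perm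
  refine ⟨p, e, ⟨?_, ?_⟩, ?_, ?_, ?_⟩
  · refine isPinSequence_of_steps (fun i hi => hne i (by omega)) fun i hi hin => ?_
    rcases Nat.lt_or_ge i 3 with h3 | h3
    -- Relative to the single pin `p 1`, the pin `p 2` is independent, whatever it does relative to
    -- the origin.
    · obtain rfl : i = 2 := by omega
      have h12 := hne 1 (by omega) 2 (by omega) hin
      have aux : ∀ f : ℕ → ℤ, f 1 ≠ f 2 → OutAt f 1 2 := by
        intro f hf
        rcases lt_or_gt_of_ne hf with hf | hf
        · exact Or.inl fun j hj hj2 => by obtain rfl : j = 1 := by omega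
                                          exact hf
        · exact Or.inr fun j hj hj2 => by obtain rfl : j = 1 := by omega
                                          exact hf
      exact Or.inr ⟨aux _ h12.1, aux _ h12.2⟩
    · exact Or.inl ((hturn i h3 hin).stepAt.transfer (by omega) (by omega)
        (fun _ _ _ _ _ _ => id) (fun _ _ _ _ _ _ => id))
  · intro k l
    rw [hp1 _ (by omega), hp1 _ (by omega), he, he]
    simp only [point, Fin.lt_def]
    omega
  · refine isPinSequence_of_steps hne fun i hi hin => ?_
    rcases (hasLetter_iff hi).1 (hletter i hi hin) with hs | hs
    · exact Or.inl hs.2.stepAt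
    · exact Or.inr (outAt_of_inQuadrant hs)
  · simp [wordOf]; omega
  · intro k hk
    have hkn : k < n := by simp [wordOf] at hk; omega
    have := hletter (k + 1) (by omega) (by omega)
    match k with
    | 0 => exact this
    | 1 => exact this
    | k + 2 => simpa [wordOf] using this

/-- By simplicity the underlying representation is proper; the point is that the letters of `w`
themselves, and not just some choice of directions, label the walk. -/
theorem IsPinWordOf.exists_isWalk (hσ : IsSimple σ) (hn : 3 ≤ n) {w : List Letter}
    (h : IsPinWordOf w σ) : ∃ q d, IsWalk σ n q d ∧
      ∃ ab ∈ firstLetters (q 1) (q 2) (d 3), w = wordOf n ab d := by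
  obtain ⟨p, e, hp, -, hlen, hlet⟩ := h
  obtain ⟨d', hd'⟩ := hp.exists_isWalk fun i hi hin => hp.stepAt_of_isSimple hσ hi hin
  set d : ℕ → Letter := fun i => w.getD (i - 1) .U with hd
  have hget : ∀ k (hk : k < w.length), w[k] = d (k + 1) := by
    intro k hk; simp [hd, hk]
  have hlet' : ∀ i, 1 ≤ i → i ≤ n → HasLetter p i (d i) := by
    intro i hi hin
    obtain ⟨k, rfl⟩ := Nat.exists_eq_add_of_le' hi
    have := hlet k (by omega)
    rwa [hget] at this
  have hturn : ∀ i, 3 ≤ i → i ≤ n → Turn 0 p i (d i) := by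
    intro i hi hin
    rcases (hasLetter_iff (by omega)).1 (hlet' i (by omega) hin) with hs | hs
    · exact hs.2
    -- A numeral would make both coordinates extreme, while properness makes one of them
    -- intermediate.
    · have ho := outAt_of_inQuadrant (a := 1) fun j hj hji => hs j (by omega) hji
      rcases hp.stepAt_of_isSimple hσ hi hin with hs | hs
      · exact absurd ho.1 (hs.1.not_outAt (by omega))
      · exact absurd ho.2 (hs.1.not_outAt (by omega))
  refine ⟨diagram σ e, d, ⟨hd'.mem, hd'.start, fun i hi hin => ?_⟩, (d 1, d 2), ?_, ?_⟩
  · exact (hturn i hi hin).transfer (by omega) (by omega)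
      (fun j k hj hj' hk hk' => (hp.fst_lt_iff hj (by omega) hk (by omega)).1)
      (fun j k hj hj' hk hk' => (hp.snd_lt_iff hj (by omega) hk (by omega)).1)
  · rw [← firstLetters_congr (hp.fst_lt_iff (by omega) (by omega) (by omega) (by omega))
      (hp.snd_lt_iff (by omega) (by omega) (by omega) (by omega))]
    exact mem_firstLetters (hlet' 1 (by omega) (by omega)) (hlet' 2 (by omega) (by omega))
      (hturn 3 le_rfl hn)
  · refine List.ext_getElem (by simp [wordOf]; omega) fun k h1 h2 => ?_
    rw [hget]
    match k with
    | 0 => rfl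
    | 1 => rfl
    | k + 2 => simp [wordOf]

end


/-! ### Frame rules for programs -/

namespace Cmd

/-- `c` may write to the register `r`. -/
def writesReg (r : Reg) : Cmd → Bool
  | .set r' _ => decide (r' = r)
  | .load r' _ _ => decide (r' = r)
  | .seq c d => c.writesReg r || d.writesReg r
  | .ifLt _ _ c d => c.writesReg r || d.writesReg r
  | .ifEq _ _ c d => c.writesReg r || d.writesReg r
  | .loop r' _ c => decide (r' = r) || c.writesReg r
  | _ => false

/-- `c` may write to the array `A`. -/
def writesMem (A : Arr) : Cmd → Bool
  | .store A' _ _ => decide (A' = A)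
  | .seq c d => c.writesMem A || d.writesMem A
  | .ifLt _ _ c d => c.writesMem A || d.writesMem A
  | .ifEq _ _ c d => c.writesMem A || d.writesMem A
  | .loop _ _ c => c.writesMem A
  | _ => false

/-- `c` may write to the output. -/
def writesOut : Cmd → Bool
  | .emit _ => true
  | .flush => true
  | .seq c d => c.writesOut || d.writesOut
  | .ifLt _ _ c d => c.writesOut || d.writesOut
  | .ifEq _ _ c d => c.writesOut || d.writesOut
  | .loop _ _ c => c.writesOut
  | _ => false

/-- The hypothesis is a computation on the syntax of the program, so for concrete programs `rfl`
proves it. -/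
theorem reg_exec {r : Reg} : ∀ {c : Cmd}, c.writesReg r = false → ∀ s, (c.exec s).reg r = s.reg r
  | .skip, _, _ => rfl
  | .set r' _, h, s => Function.update_of_ne (Ne.symm (by simpa [writesReg] using h)) _ _
  | .load r' _ _, h, s => Function.update_of_ne (Ne.symm (by simpa [writesReg] using h)) _ _
  | .store _ _ _, _, _ => rfl
  | .emit _, _, _ => rfl
  | .flush, _, _ => rfl
  | .seq c d, h, s => by
    simp only [writesReg, Bool.or_eq_false_iff] at h
    exact (reg_exec h.2 _).trans (reg_exec h.1 s)
  | .ifLt _ _ c d, h, s => by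
    simp only [writesReg, Bool.or_eq_false_iff] at h
    simp only [exec]; split_ifs
    exacts [reg_exec h.1 s, reg_exec h.2 s]
  | .ifEq _ _ c d, h, s => by
    simp only [writesReg, Bool.or_eq_false_iff] at h
    simp only [exec]; split_ifs
    exacts [reg_exec h.1 s, reg_exec h.2 s]
  | .loop r' o c, h, s => by
    simp only [writesReg, Bool.or_eq_false_iff, decide_eq_false_iff_not] at h
    simp only [exec]
    induction (o.val s).toNat with
    | zero => rfl
    | succ j ih => exact (reg_exec h.2 _).trans ((Function.update_of_ne (Ne.symm h.1) _ _).trans ih)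

theorem mem_exec {A : Arr} : ∀ {c : Cmd}, c.writesMem A = false → ∀ s, (c.exec s).mem A = s.mem A
  | .skip, _, _ => rfl
  | .set _ _, _, _ => rfl
  | .load _ _ _, _, _ => rfl
  | .store _ _ _, h, s => Function.update_of_ne (Ne.symm (by simpa [writesMem] using h)) _ _
  | .emit _, _, _ => rfl
  | .flush, _, _ => rfl
  | .seq c d, h, s => by
    simp only [writesMem, Bool.or_eq_false_iff] at h
    exact (mem_exec h.2 _).trans (mem_exec h.1 s)
  | .ifLt _ _ c d, h, s => by
    simp only [writesMem, Bool.or_eq_false_iff] at h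
    simp only [exec]; split_ifs
    exacts [mem_exec h.1 s, mem_exec h.2 s]
  | .ifEq _ _ c d, h, s => by
    simp only [writesMem, Bool.or_eq_false_iff] at h
    simp only [exec]; split_ifs
    exacts [mem_exec h.1 s, mem_exec h.2 s]
  | .loop r' o c, h, s => by
    simp only [writesMem] at h
    simp only [exec]
    induction (o.val s).toNat with
    | zero => rfl
    | succ j ih => exact (mem_exec h _).trans ih

theorem out_exec : ∀ {c : Cmd}, c.writesOut = false → ∀ s,
    (c.exec s).cur = s.cur ∧ (c.exec s).words = s.words
  | .skip, _, _ => ⟨rfl, rfl⟩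
  | .set _ _, _, _ => ⟨rfl, rfl⟩
  | .load _ _ _, _, _ => ⟨rfl, rfl⟩
  | .store _ _ _, _, _ => ⟨rfl, rfl⟩
  | .emit _, h, _ => by simp [writesOut] at h
  | .flush, h, _ => by simp [writesOut] at h
  | .seq c d, h, s => by
    simp only [writesOut, Bool.or_eq_false_iff] at h
    have h1 := out_exec h.1 s
    have h2 := out_exec h.2 (c.exec s)
    exact ⟨h2.1.trans h1.1, h2.2.trans h1.2⟩
  | .ifLt _ _ c d, h, s => by
    simp only [writesOut, Bool.or_eq_false_iff] at h
    simp only [exec]; split_ifs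
    exacts [out_exec h.1 s, out_exec h.2 s]
  | .ifEq _ _ c d, h, s => by
    simp only [writesOut, Bool.or_eq_false_iff] at h
    simp only [exec]; split_ifs
    exacts [out_exec h.1 s, out_exec h.2 s]
  | .loop r' o c, h, s => by
    simp only [writesOut] at h
    simp only [exec]
    induction (o.val s).toNat with
    | zero => exact ⟨rfl, rfl⟩
    | succ j ih =>
      have h1 := out_exec h
        (State.setReg (Nat.rec s (fun j u => c.exec (u.setReg r' j)) j : State) r' j)
      exact ⟨h1.1.trans ih.1, h1.2.trans ih.2⟩

/-- The bound of a loop is evaluated once, so it may be frozen as a constant; invariants are then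
proved by induction on it with `exec_loop_succ`. -/
theorem exec_loop {r : Reg} {o : Opd} {c : Cmd} {s : State} {m : ℕ} (h : o.val s = m) :
    (loop r o c).exec s = (loop r (.lit m) c).exec s := by
  simp only [exec]
  rw [h]
  rfl

theorem exec_loop_zero (r : Reg) (c : Cmd) (s : State) : (loop r (.lit (0 : ℕ)) c).exec s = s := rfl

theorem exec_loop_succ (r : Reg) (c : Cmd) (s : State) (j : ℕ) :
    (loop r (.lit (j + 1 : ℕ)) c).exec s =
      c.exec (((loop r (.lit (j : ℕ)) c).exec s).setReg r j) := by
  simp only [exec, Opd.val, Int.toNat_natCast]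

/-! ### Running times -/

def loopFree : Cmd → Bool
  | .seq c d => c.loopFree && d.loopFree
  | .ifLt _ _ c d => c.loopFree && d.loopFree
  | .ifEq _ _ c d => c.loopFree && d.loopFree
  | .loop _ _ _ => false
  | _ => true

/-- A bound for the number of steps of a program without loops. -/
def flat : Cmd → ℕ
  | .seq c d => c.flat + d.flat
  | .ifLt _ _ c d => 1 + (c.flat + d.flat)
  | .ifEq _ _ c d => 1 + (c.flat + d.flat)
  | _ => 1

theorem cost_le_flat : ∀ {c : Cmd}, c.loopFree = true → ∀ s, c.cost s ≤ c.flat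
  | .skip, _, _ => le_rfl
  | .set _ _, _, _ => le_rfl
  | .load _ _ _, _, _ => le_rfl
  | .store _ _ _, _, _ => le_rfl
  | .emit _, _, _ => le_rfl
  | .flush, _, _ => le_rfl
  | .seq c d, h, s => by
    simp only [loopFree, Bool.and_eq_true] at h
    exact add_le_add (cost_le_flat h.1 s) (cost_le_flat h.2 _)
  | .ifLt _ _ c d, h, s => by
    simp only [loopFree, Bool.and_eq_true] at h
    have h1 := cost_le_flat h.1 s
    have h2 := cost_le_flat h.2 s
    simp only [cost, flat]; split_ifs <;> omega
  | .ifEq _ _ c d, h, s => by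
    simp only [loopFree, Bool.and_eq_true] at h
    have h1 := cost_le_flat h.1 s
    have h2 := cost_le_flat h.2 s
    simp only [cost, flat]; split_ifs <;> omega
  | .loop _ _ _, h, _ => by simp [loopFree] at h

/-- All loops of the program are run at most `n` times and are not nested. -/
def shallow : Cmd → Bool
  | .seq c d => c.shallow && d.shallow
  | .ifLt _ _ c d => c.shallow && d.shallow
  | .ifEq _ _ c d => c.shallow && d.shallow
  | .loop _ (.reg .n z) c => decide (z ≤ 0) && c.loopFree
  | .loop _ _ _ => false
  | _ => true

/-- The constant in a linear bound for the number of steps of a program without nested loops. -/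
def slope : Cmd → ℕ
  | .seq c d => c.slope + d.slope
  | .ifLt _ _ c d => 1 + (c.slope + d.slope)
  | .ifEq _ _ c d => 1 + (c.slope + d.slope)
  | .loop _ _ c => 1 + (1 + c.flat)
  | _ => 1

theorem cost_loop_le {r : Reg} {o : Opd} {c : Cmd} {s : State} {m B : ℕ} (hm : (o.val s).toNat ≤ m)
    (hB : ∀ j : ℕ, c.cost (((loop r (.lit j) c).exec s).setReg r j) ≤ B) :
    (loop r o c).cost s ≤ 1 + m * (1 + B) := by
  simp only [cost]
  refine Nat.add_le_add_left ?_ 1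
  calc _ ≤ ∑ j ∈ Finset.range (o.val s).toNat, (1 + B) := by
        refine Finset.sum_le_sum fun j _ => Nat.add_le_add_left ?_ 1
        have := hB j
        simpa only [exec, Opd.val, Int.toNat_natCast] using this
    _ = (o.val s).toNat * (1 + B) := by simp
    _ ≤ m * (1 + B) := Nat.mul_le_mul_right _ hm

/-- As `n` is never overwritten, every loop has at most `m` rounds, each of bounded cost because
loops are not nested. -/
theorem cost_le_slope {m : ℕ} : ∀ {c : Cmd}, c.shallow = true → c.writesReg .n = false →
    ∀ s : State, s.reg .n = (m : ℤ) → c.cost s ≤ c.slope * (m + 1)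
  | .skip, _, _, _, _ => by simp [cost, slope]
  | .set _ _, _, _, _, _ => by simp [cost, slope]
  | .load _ _ _, _, _, _, _ => by simp [cost, slope]
  | .store _ _ _, _, _, _, _ => by simp [cost, slope]
  | .emit _, _, _, _, _ => by simp [cost, slope]
  | .flush, _, _, _, _ => by simp [cost, slope]
  | .seq c d, h, hw, s, hs => by
    simp only [shallow, Bool.and_eq_true] at h
    simp only [writesReg, Bool.or_eq_false_iff] at hw
    simp only [slope, cost, add_mul]
    exact add_le_add (cost_le_slope h.1 hw.1 s hs)
      (cost_le_slope h.2 hw.2 _ ((reg_exec hw.1 s).trans hs))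
  | .ifLt _ _ c d, h, hw, s, hs => by
    simp only [shallow, Bool.and_eq_true] at h
    simp only [writesReg, Bool.or_eq_false_iff] at hw
    have h1 := cost_le_slope h.1 hw.1 s hs
    have h2 := cost_le_slope h.2 hw.2 s hs
    simp only [cost, slope, add_mul]; split_ifs <;> omega
  | .ifEq _ _ c d, h, hw, s, hs => by
    simp only [shallow, Bool.and_eq_true] at h
    simp only [writesReg, Bool.or_eq_false_iff] at hw
    have h1 := cost_le_slope h.1 hw.1 s hs
    have h2 := cost_le_slope h.2 hw.2 s hs
    simp only [cost, slope, add_mul]; split_ifs <;> omega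
  | .loop r o c, h, hw, s, hs => by
    obtain ⟨z, rfl, hz, hc⟩ : ∃ z, o = .reg .n z ∧ z ≤ 0 ∧ c.loopFree = true := by
      unfold shallow at h
      split at h <;> simp_all
    refine (cost_loop_le (m := m) (B := c.flat) (by simp only [Opd.val, hs]; omega)
      fun j => cost_le_flat hc _).trans ?_
    simp only [slope]
    nlinarith

end Cmd

/-- The outer loop is entered only after the test against 48, and each of its rounds is a program
without nested loops. -/
theorem pinWords_cost_le {m : ℕ} {s : State} (hs : s.reg .n = m) :
    pinWords.cost s ≤ (invert.slope + findKnights.slope + 4 + 48 * (1 +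
      (buildRepresentation ;; .ifEq (rg .alive) (.lit 1) outputWords .skip).slope)) * (m + 1) := by
  set body := (buildRepresentation ;; .ifEq (rg .alive) (.lit 1) outputWords .skip) with hbody
  have h1 : invert.cost s ≤ invert.slope * (m + 1) := Cmd.cost_le_slope rfl rfl s hs
  have hs1 : (invert.exec s).reg .n = m := (Cmd.reg_exec rfl s).trans hs
  have h2 : findKnights.cost (invert.exec s) ≤ findKnights.slope * (m + 1) :=
    Cmd.cost_le_slope rfl rfl _ hs1
  have hs2 : (findKnights.exec (invert.exec s)).reg .n = m := (Cmd.reg_exec rfl _).trans hs1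
  set u := findKnights.exec (invert.exec s) with hu
  have h3 : ¬ 48 < u.reg .m →
      (Cmd.loop .k (rg .m) body).cost u ≤ 1 + 48 * (1 + body.slope * (m + 1)) := by
    intro h48
    refine Cmd.cost_loop_le (by simp only [rg, Opd.val]; omega) fun j => ?_
    refine Cmd.cost_le_slope rfl rfl _ ?_
    exact (Cmd.reg_exec (c := Cmd.loop .k (.lit j) body) rfl u).trans hs2
  have h4 : pinWords.cost s = invert.cost s + (findKnights.cost (invert.exec s) +
      (1 + if 48 < u.reg .m + 0 then 1 else (Cmd.loop .k (rg .m) body).cost u)) := rfl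
  rw [h4, add_zero]
  generalize (Cmd.loop .k (rg .m) body).cost u = x at *
  generalize invert.slope = a at *
  generalize findKnights.slope = b at *
  generalize body.slope = c at *
  split_ifs with h48
  · nlinarith
  · have := h3 h48
    nlinarith


section

variable {n : ℕ} {σ : Equiv.Perm (Fin n)}

/-! ### The inverse permutation -/

/-- The memory holds the permutation `σ` and its inverse. -/
structure Loaded (σ : Equiv.Perm (Fin n)) (s : State) : Prop where
  reg_n : s.reg .n = n
  mem_S : ∀ c : Fin n, s.mem .S ((c : ℕ) : ℤ) = ((σ c : ℕ) : ℤ)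
  mem_T : ∀ c : Fin n, s.mem .T ((σ c : ℕ) : ℤ) = ((c : ℕ) : ℤ)

theorem Loaded.exec {c : Cmd} {s : State} (h : Loaded σ s) (hn : c.writesReg .n = false)
    (hS : c.writesMem .S = false) (hT : c.writesMem .T = false) : Loaded σ (c.exec s) where
  reg_n := (Cmd.reg_exec hn s).trans h.reg_n
  mem_S x := by rw [Cmd.mem_exec hS]; exact h.mem_S x
  mem_T x := by rw [Cmd.mem_exec hT]; exact h.mem_T x

theorem Loaded.setReg {s : State} (h : Loaded σ s) {r : Reg} (hr : r ≠ .n) (z : ℤ) :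
    Loaded σ (s.setReg r z) :=
  ⟨(Function.update_of_ne hr.symm _ _).trans h.reg_n, h.mem_S, h.mem_T⟩

theorem input_mem_S (c : Fin n) : (input σ).mem .S ((c : ℕ) : ℤ) = ((σ c : ℕ) : ℤ) := by
  simp [input]

theorem loaded_invert (σ : Equiv.Perm (Fin n)) : Loaded σ (invert.exec (input σ)) := by
  refine ⟨Cmd.reg_exec rfl _, fun c => ?_, ?_⟩
  · rw [Cmd.mem_exec rfl]; exact input_mem_S c
  set body : Cmd := .load .v .S (rg .i) ;; .store .T (rg .v) (rg .i) with hbody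
  have key : ∀ j : ℕ, j ≤ n → ∀ c : Fin n, (c : ℕ) < j →
      ((Cmd.loop .i (.lit j) body).exec (input σ)).mem .T ((σ c : ℕ) : ℤ) = ((c : ℕ) : ℤ) := by
    intro j
    induction j with
    | zero => intro _ c hc; omega
    | succ j ih =>
      intro hj c hc
      rw [Cmd.exec_loop_succ]
      set u := (Cmd.loop .i (.lit (j : ℕ)) body).exec (input σ) with hu
      have hS : u.mem .S (j : ℤ) = ((σ ⟨j, by omega⟩ : ℕ) : ℤ) := by
        rw [hu, Cmd.mem_exec rfl]; exact input_mem_S ⟨j, by omega⟩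
      have hmem : (body.exec (u.setReg .i j)).mem .T =
          Function.update (u.mem .T) ((σ ⟨j, by omega⟩ : ℕ) : ℤ) (j : ℤ) := by
        simp [hbody, Cmd.exec, State.setReg, State.setMem, Opd.val, rg, hS]
      rw [hmem]
      -- By injectivity of `σ`, the current write does not touch the cells of `T` filled before.
      rcases eq_or_ne (c : ℕ) j with rfl | hne
      · simp
      · rw [Function.update_of_ne]
        · exact ih (by omega) c (by omega)
        · intro he
          have := σ.injective (Fin.ext (by exact_mod_cast he) : σ c = σ ⟨j, by omega⟩)
          exact hne (congrArg Fin.val this)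
  intro c
  have h := key n le_rfl c c.2
  rwa [← Cmd.exec_loop (o := rg .n) (by simp [rg, Opd.val, input])] at h

/-! ### The list of knight pairs -/

/-- The position of a point of the diagram relative to another one. -/
def offset (σ : Equiv.Perm (Fin n)) (a b : Fin n) : ℤ × ℤ :=
  (((b : ℕ) : ℤ) - ((a : ℕ) : ℤ), ((σ b : ℕ) : ℤ) - ((σ a : ℕ) : ℤ))

def knightOffsets : List (ℤ × ℤ) :=
  [(1, 2), (1, -2), (-1, 2), (-1, -2), (2, 1), (2, -1), (-2, 1), (-2, -1)]

theorem isKnight_iff_offset {a b : Fin n} : IsKnight σ a b ↔ offset σ a b ∈ knightOffsets := by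
  have h1 : ∀ z : ℤ, |z| = 1 ↔ z = 1 ∨ z = -1 := fun z => abs_eq (by omega)
  have h2 : ∀ z : ℤ, |z| = 2 ↔ z = 2 ∨ z = -2 := fun z => abs_eq (by omega)
  simp only [IsKnight, h1, h2, offset, knightOffsets, List.mem_cons, Prod.mk.injEq,
    List.not_mem_nil, or_false]
  omega

/-- The registers and arrays describe the list of the knight pairs whose first point is in a column
before the `j`-th one, or is in the `j`-th column if the offset is in `ds`. -/
def Recorded (σ : Equiv.Perm (Fin n)) (j : ℕ) (ds : List (ℤ × ℤ)) (s : State) : Prop :=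
  ∃ l : List (Fin n × Fin n), s.reg .m = l.length ∧
    (∀ (k : ℕ) (hk : k < l.length), s.mem .E k = ((l[k].1 : ℕ) : ℤ) ∧
      s.mem .F k = ((l[k].2 : ℕ) : ℤ)) ∧
    l.Nodup ∧ ∀ a b, (a, b) ∈ l ↔
      offset σ a b ∈ knightOffsets ∧ ((a : ℕ) < j ∨ (a : ℕ) = j ∧ offset σ a b ∈ ds)

theorem Recorded.congr {j : ℕ} {ds : List (ℤ × ℤ)} {s s' : State} (h : Recorded σ j ds s)
    (hm : s'.reg .m = s.reg .m) (hE : s'.mem .E = s.mem .E) (hF : s'.mem .F = s.mem .F) :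
    Recorded σ j ds s' := by
  unfold Recorded at *
  rwa [hm, hE, hF]

theorem Recorded.checkCell {j : ℕ} (hj : j < n) {ds : List (ℤ × ℤ)} {d : ℤ × ℤ} {s : State}
    (h : Recorded σ j ds s) (hs : Loaded σ s) (hi : s.reg .i = j)
    (hv : s.reg .v = ((σ ⟨j, hj⟩ : ℕ) : ℤ)) (hd : d ∈ knightOffsets) (hds : d ∉ ds) :
    Recorded σ j (ds ++ [d]) ((PinPerm.checkCell d).exec s) := by
  by_cases hb : ∃ b, offset σ ⟨j, hj⟩ b = d
  · obtain ⟨b, rfl⟩ := hb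
    obtain ⟨l, hm, hEF, hnd, hl⟩ := h
    have hSb := hs.mem_S b
    have e1 : s.reg .i + (offset σ ⟨j, hj⟩ b).1 = ((b : ℕ) : ℤ) := by
      rw [hi]; simp [offset]
    have e2 : ((σ b : ℕ) : ℤ) = s.reg .v + (offset σ ⟨j, hj⟩ b).2 := by
      rw [hv]; simp [offset]
    have h0 : ¬ ((b : ℕ) : ℤ) < 0 := by omega
    have h1 : ((b : ℕ) : ℤ) < s.reg .n := by rw [hs.reg_n]; omega
    have hexec : ((PinPerm.checkCell (offset σ ⟨j, hj⟩ b)).exec s).reg .m = s.reg .m + 1 ∧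
        ((PinPerm.checkCell (offset σ ⟨j, hj⟩ b)).exec s).mem .E =
          Function.update (s.mem .E) (s.reg .m) (s.reg .i) ∧
        ((PinPerm.checkCell (offset σ ⟨j, hj⟩ b)).exec s).mem .F =
          Function.update (s.mem .F) (s.reg .m) (b : ℕ) := by
      simp [PinPerm.checkCell, Cmd.exec, State.setReg, State.setMem, Opd.val, rg, e1, h0, h1,
        hSb, ← e2]
    -- Each offset is inspected once per column, so no pair is recorded twice; this makes the
    -- counter equal to the number of knight pairs.
    have hnew : (⟨j, hj⟩, b) ∉ l := by
      rw [hl]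
      simp only [lt_self_iff_false, true_and, false_or]
      exact fun h => hds h.2
    refine ⟨l ++ [(⟨j, hj⟩, b)], ?_, ?_, ?_, ?_⟩
    · rw [hexec.1, hm]; simp
    · intro k hk
      rw [hexec.2.1, hexec.2.2, hm, hi]
      rw [List.length_append, List.length_singleton] at hk
      rcases Nat.lt_or_ge k l.length with hkl | hkl
      · rw [Function.update_of_ne (by omega), Function.update_of_ne (by omega),
          List.getElem_append_left hkl]
        exact hEF k hkl
      · obtain rfl : k = l.length := by omega
        simp
    · exact List.nodup_append.2 ⟨hnd, List.nodup_singleton _, by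
        intro x hx y hy
        rw [List.mem_singleton] at hy
        rintro rfl
        exact hnew (hy ▸ hx)⟩
    · intro a c
      rw [List.mem_append, hl, List.mem_singleton, List.mem_append, List.mem_singleton,
        Prod.mk.injEq]
      constructor
      · rintro (⟨h1, h2⟩ | ⟨rfl, rfl⟩)
        · exact ⟨h1, by tauto⟩
        · exact ⟨hd, by simp⟩
      · rintro ⟨h1, h2 | ⟨h2, h3 | h3⟩⟩
        · exact Or.inl ⟨h1, Or.inl h2⟩
        · exact Or.inl ⟨h1, Or.inr ⟨h2, h3⟩⟩
        · obtain rfl : a = ⟨j, hj⟩ := Fin.ext h2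
          refine Or.inr ⟨rfl, Fin.ext ?_⟩
          have : ((c : ℕ) : ℤ) - (j : ℕ) = ((b : ℕ) : ℤ) - (j : ℕ) := congrArg Prod.fst h3
          omega
  · have hexec : ((PinPerm.checkCell d).exec s).reg .m = s.reg .m ∧
        ((PinPerm.checkCell d).exec s).mem = s.mem := by
      simp only [PinPerm.checkCell, Cmd.exec, State.setReg, State.setMem, Opd.val, rg, add_zero]
      split_ifs with h0 h1 h2
      · exact ⟨rfl, rfl⟩
      -- If all the tests succeed, the cell inspected does contain a point, against `hb`.
      · exfalso
        rw [hs.reg_n] at h1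
        refine hb ⟨⟨(s.reg .i + d.1).toNat, by omega⟩, ?_⟩
        have hS := hs.mem_S ⟨(s.reg .i + d.1).toNat, by omega⟩
        have e : (((s.reg .i + d.1).toNat : ℕ) : ℤ) = s.reg .i + d.1 := by omega
        simp only [e] at hS
        simp only [Function.update_self, ne_eq, reduceCtorEq, not_false_eq_true,
          Function.update_of_ne] at h2
        rw [hS, hv] at h2
        refine Prod.ext ?_ ?_
        · simp only [offset, e]; omega
        · simp only [offset]; omega
      · simp
      · exact ⟨rfl, rfl⟩
    obtain ⟨l, hm, hEF, hnd, hl⟩ := h.congr hexec.1 (by rw [hexec.2]) (by rw [hexec.2])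
    refine ⟨l, hm, hEF, hnd, fun a b => ?_⟩
    rw [hl, List.mem_append, List.mem_singleton]
    have : (a : ℕ) = j → offset σ a b ≠ d := by
      intro ha he
      obtain rfl : a = ⟨j, hj⟩ := Fin.ext ha
      exact hb ⟨b, he⟩
    tauto

theorem Recorded.seqs_checkCell {j : ℕ} (hj : j < n) (ds' : List (ℤ × ℤ)) :
    ∀ {ds : List (ℤ × ℤ)} {s : State}, Recorded σ j ds s → Loaded σ s → s.reg .i = j →
      s.reg .v = ((σ ⟨j, hj⟩ : ℕ) : ℤ) → (∀ d ∈ ds', d ∈ knightOffsets) → (ds ++ ds').Nodup →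
      Recorded σ j (ds ++ ds') ((seqs (ds'.map PinPerm.checkCell)).exec s) := by
  induction ds' with
  | nil => intro ds s h _ _ _ _ _; rw [List.append_nil]; exact h
  | cons d ds' ih =>
    intro ds s h hs hi hv hsub hnd
    have hd : d ∉ ds := fun hd =>
      (List.nodup_append.1 hnd).2.2 d hd d (by simp) rfl
    have h1 := h.checkCell hj hs hi hv (hsub d (by simp)) hd
    have h2 := ih h1 (hs.exec rfl rfl rfl) ((Cmd.reg_exec rfl s).trans hi)
      ((Cmd.reg_exec rfl s).trans hv) (fun d' hd' => hsub d' (by simp [hd'])) (by simpa using hnd)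
    rw [List.append_assoc] at h2
    exact h2

theorem Recorded.succ {j : ℕ} {s : State} (h : Recorded σ j knightOffsets s) :
    Recorded σ (j + 1) [] s := by
  obtain ⟨l, hm, hEF, hnd, hl⟩ := h
  refine ⟨l, hm, hEF, hnd, fun a b => ?_⟩
  rw [hl, Nat.lt_succ_iff_lt_or_eq]
  simp only [List.not_mem_nil, and_false, or_false]
  tauto

/-- After the search the arrays hold the list of all knight pairs, without repetitions. -/
theorem findKnights_spec {s : State} (hs : Loaded σ s) :
    ∃ l : List (Fin n × Fin n), (findKnights.exec s).reg .m = l.length ∧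
      (∀ (k : ℕ) (hk : k < l.length), (findKnights.exec s).mem .E k = ((l[k].1 : ℕ) : ℤ) ∧
        (findKnights.exec s).mem .F k = ((l[k].2 : ℕ) : ℤ)) ∧
      l.Nodup ∧ ∀ q, q ∈ l ↔ IsKnight σ q.1 q.2 := by
  set body : Cmd := .load .v .S (rg .i) ;; seqs (knightOffsets.map checkCell) with hbody
  set s₀ := (Cmd.set .m (.lit 0)).exec s with hs0
  have hl0 : Loaded σ s₀ := hs.exec rfl rfl rfl
  have key : ∀ j : ℕ, j ≤ n → Recorded σ j [] ((Cmd.loop .i (.lit j) body).exec s₀) := by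
    intro j
    induction j with
    | zero =>
      intro _
      exact ⟨[], rfl, fun k hk => absurd hk (Nat.not_lt_zero k), List.nodup_nil, by simp⟩
    | succ j ih =>
      intro hj
      rw [Cmd.exec_loop_succ]
      set u := (Cmd.loop .i (.lit (j : ℕ)) body).exec s₀ with hu
      have hlu : Loaded σ u := hl0.exec rfl rfl rfl
      set u' := (Cmd.load .v .S (rg .i)).exec (u.setReg .i j) with hu'
      have hlu' : Loaded σ u' := (hlu.setReg (by decide) _).exec rfl rfl rfl
      have hv : u'.reg .v = ((σ ⟨j, hj⟩ : ℕ) : ℤ) := by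
        have := hlu.mem_S ⟨j, hj⟩
        simp only at this
        simp [hu', Cmd.exec, State.setReg, Opd.val, rg, this]
      have := Recorded.seqs_checkCell hj knightOffsets (ds := []) (s := u')
        ((ih (by omega)).congr rfl rfl rfl) hlu' rfl hv (fun _ => id) (by decide)
      exact Recorded.succ this
  obtain ⟨l, hm, hEF, hnd, hl⟩ := key n le_rfl
  rw [← Cmd.exec_loop (o := rg .n) (by simp [rg, Opd.val, hl0.reg_n])] at hm hEF
  refine ⟨l, hm, hEF, hnd, fun q => ?_⟩
  rw [isKnight_iff_offset, ← Prod.eta q, hl]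
  simp

end


/-! ### The search for the next pin -/

/-- What one attempt to find the next pin does: if there is a candidate satisfying `P`, such a
candidate is stored; otherwise nothing changes. -/
def TrySpec (P : ℤ → ℤ → Letter → Prop) (s s' : State) : Prop :=
  ((∀ x y l, ¬ P x y l) ∧ s'.reg .found = s.reg .found ∧ s'.reg .nx = s.reg .nx ∧
      s'.reg .ny = s.reg .ny ∧ s'.reg .dir = s.reg .dir) ∨
  ∃ x y l, P x y l ∧ s'.reg .found = 1 ∧ s'.reg .nx = x ∧ s'.reg .ny = y ∧ s'.reg .dir = dirCode l

/-- A later hit overwrites an earlier one. Only the disjunction is claimed, since any hit serves. -/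
theorem TrySpec.trans {P Q : ℤ → ℤ → Letter → Prop} {s s' s'' : State} (h : TrySpec P s s')
    (h' : TrySpec Q s' s'') : TrySpec (fun x y l => P x y l ∨ Q x y l) s s'' := by
  rcases h' with ⟨hQ, h1, h2, h3, h4⟩ | ⟨x, y, l, hQ, h'⟩
  · rcases h with ⟨hP, h5, h6, h7, h8⟩ | ⟨x, y, l, hP, h5, h6, h7, h8⟩
    · exact Or.inl ⟨fun x y l h => h.elim (hP x y l) (hQ x y l), h1.trans h5, h2.trans h6,
        h3.trans h7, h4.trans h8⟩
    · exact Or.inr ⟨x, y, l, Or.inl hP, h1.trans h5, h2.trans h6, h3.trans h7, h4.trans h8⟩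
  · exact Or.inr ⟨x, y, l, Or.inr hQ, h'⟩

/-- Candidates for the next pin in the column `a`. -/
def ColHit (S : ℤ → ℤ) (a lo hi x y : ℤ) (l : Letter) : Prop :=
  x = a ∧ y = S a ∧ ((l = .U ∧ hi < y) ∨ (l = .D ∧ y < lo))

/-- Candidates for the next pin in the row `a`. -/
def RowHit (T : ℤ → ℤ) (a lo hi x y : ℤ) (l : Letter) : Prop :=
  y = a ∧ x = T a ∧ ((l = .R ∧ hi < x) ∨ (l = .L ∧ x < lo))

/-- The values read enter through equations, so that `extend_spec` can express successive attempts
by the state before the first of them. -/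
theorem tryColumn_spec (s : State) (o o₁ o₂ : Opd) {S : ℤ → ℤ} {a lo hi u v : ℤ}
    (hS : s.mem .S = S) (ha : o.val s = a) (hlo : s.reg .boxD = lo) (hhi : s.reg .boxU = hi)
    (hu : o₁.val s = u) (hv : o₂.val s = v) :
    TrySpec (fun x y l => u < v ∧ ColHit S a lo hi x y l) s
      ((Cmd.ifLt o₁ o₂ (tryColumn o) .skip).exec s) := by
  subst hS ha hlo hhi hu hv
  simp only [tryColumn, accept, Cmd.exec, rg, State.setReg, Opd.val, Function.update_self,
    add_zero, ne_eq, reduceCtorEq, not_false_eq_true, Function.update_of_ne]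
  split_ifs with h1 h2 h3
  · exact Or.inr ⟨_, _, .U, ⟨h1, rfl, rfl, Or.inl ⟨rfl, h2⟩⟩, by simp⟩
  · exact Or.inr ⟨_, _, .D, ⟨h1, rfl, rfl, Or.inr ⟨rfl, h3⟩⟩, by simp⟩
  · refine Or.inl ⟨?_, by simp⟩
    rintro x y l ⟨-, rfl, rfl, ⟨-, h⟩ | ⟨-, h⟩⟩
    exacts [h2 h, h3 h]
  · exact Or.inl ⟨fun x y l h => h1 h.1, by simp⟩

theorem tryRow_spec (s : State) (o o₁ o₂ : Opd) {T : ℤ → ℤ} {a lo hi u v : ℤ}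
    (hT : s.mem .T = T) (ha : o.val s = a) (hlo : s.reg .boxL = lo) (hhi : s.reg .boxR = hi)
    (hu : o₁.val s = u) (hv : o₂.val s = v) :
    TrySpec (fun x y l => u < v ∧ RowHit T a lo hi x y l) s
      ((Cmd.ifLt o₁ o₂ (tryRow o) .skip).exec s) := by
  subst hT ha hlo hhi hu hv
  simp only [tryRow, accept, Cmd.exec, rg, State.setReg, Opd.val, Function.update_self,
    add_zero, ne_eq, reduceCtorEq, not_false_eq_true, Function.update_of_ne]
  split_ifs with h1 h2 h3
  · exact Or.inr ⟨_, _, .R, ⟨h1, rfl, rfl, Or.inl ⟨rfl, h2⟩⟩, by simp⟩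
  · exact Or.inr ⟨_, _, .L, ⟨h1, rfl, rfl, Or.inr ⟨rfl, h3⟩⟩, by simp⟩
  · refine Or.inl ⟨?_, by simp⟩
    rintro x y l ⟨-, rfl, rfl, ⟨-, h⟩ | ⟨-, h⟩⟩
    exacts [h2 h, h3 h]
  · exact Or.inl ⟨fun x y l h => h1 h.1, by simp⟩

theorem Cmd.exec_seq (c d : Cmd) (s : State) : (c ;; d).exec s = d.exec (c.exec s) := rfl

/-- The first part of `extend`: the computation of the bounding box. -/
def boxCmd : Cmd :=
  .set .found (.lit 0) ;;
  .set .boxL (rg .oldL) ;; .ifLt (rg .cx) (rg .boxL) (.set .boxL (rg .cx)) .skip ;;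
  .set .boxR (rg .oldR) ;; .ifLt (rg .boxR) (rg .cx) (.set .boxR (rg .cx)) .skip ;;
  .set .boxD (rg .oldD) ;; .ifLt (rg .cy) (rg .boxD) (.set .boxD (rg .cy)) .skip ;;
  .set .boxU (rg .oldU) ;; .ifLt (rg .boxU) (rg .cy) (.set .boxU (rg .cy)) .skip

/-- The middle part of `extend`: the search for a candidate. -/
def searchCmd : Cmd :=
  .ifLt (.reg .cx 1) (rg .oldL) (tryColumn (.reg .cx 1)) .skip ;;
  .ifLt (rg .oldR) (.reg .cx (-1)) (tryColumn (.reg .cx (-1))) .skip ;;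
  .ifLt (.reg .cy 1) (rg .oldD) (tryRow (.reg .cy 1)) .skip ;;
  .ifLt (rg .oldU) (.reg .cy (-1)) (tryRow (.reg .cy (-1))) .skip

/-- The last part of `extend`: the new pin is placed. -/
def placeCmd : Cmd :=
  .ifEq (rg .found) (.lit 1)
    (.set .oldL (rg .boxL) ;; .set .oldR (rg .boxR) ;;
      .set .oldD (rg .boxD) ;; .set .oldU (rg .boxU) ;;
      .set .cx (rg .nx) ;; .set .cy (rg .ny) ;; .store .G (rg .t) (rg .dir))
    (.set .alive (.lit 0))

theorem extend_exec (s : State) :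
    extend.exec s = placeCmd.exec (searchCmd.exec (boxCmd.exec s)) := by
  simp only [extend, placeCmd, searchCmd, boxCmd, Cmd.exec_seq]

theorem exec_set_min (s : State) {a b c : Reg} (hab : c ≠ a) :
    (Cmd.ifLt (rg c) (rg a) (.set a (rg c)) .skip).exec ((Cmd.set a (rg b)).exec s) =
      s.setReg a (min (s.reg b) (s.reg c)) := by
  simp only [Cmd.exec, rg, State.setReg, Opd.val, add_zero, Function.update_self,
    Function.update_of_ne hab]
  split_ifs with h
  · rw [Function.update_idem, min_eq_right h.le]
  · rw [min_eq_left (not_lt.1 h)]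

theorem exec_set_max (s : State) {a b c : Reg} (hab : c ≠ a) :
    (Cmd.ifLt (rg a) (rg c) (.set a (rg c)) .skip).exec ((Cmd.set a (rg b)).exec s) =
      s.setReg a (max (s.reg b) (s.reg c)) := by
  simp only [Cmd.exec, rg, State.setReg, Opd.val, add_zero, Function.update_self,
    Function.update_of_ne hab]
  split_ifs with h
  · rw [Function.update_idem, max_eq_right h.le]
  · rw [max_eq_left (not_lt.1 h)]

theorem boxCmd_exec (s : State) : boxCmd.exec s =
    ((((s.setReg .found 0).setReg .boxL (min (s.reg .oldL) (s.reg .cx))).setReg .boxR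
      (max (s.reg .oldR) (s.reg .cx))).setReg .boxD (min (s.reg .oldD) (s.reg .cy))).setReg .boxU
      (max (s.reg .oldU) (s.reg .cy)) := by
  have h0 : (Cmd.set .found (.lit 0)).exec s = s.setReg .found 0 := rfl
  simp only [boxCmd, Cmd.exec_seq]
  rw [exec_set_min _ (by decide), exec_set_max _ (by decide), exec_set_min _ (by decide),
    exec_set_max _ (by decide), h0]
  simp [State.setReg]

/-- The candidates for the next pin that `extend` examines: the last pin is `(cx, cy)`, the
numbers `oL, oR, oD, oU` are the sides of the bounding box of the previous ones. -/
def Candidate (S T : ℤ → ℤ) (cx cy oL oR oD oU x y : ℤ) (l : Letter) : Prop :=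
  (cx + 1 < oL ∧ ColHit S (cx + 1) (min oD cy) (max oU cy) x y l) ∨
  (oR < cx - 1 ∧ ColHit S (cx - 1) (min oD cy) (max oU cy) x y l) ∨
  (cy + 1 < oD ∧ RowHit T (cy + 1) (min oL cx) (max oR cx) x y l) ∨
  (oU < cy - 1 ∧ RowHit T (cy - 1) (min oL cx) (max oR cx) x y l)

/-- The four attempts do not modify the registers and arrays that they test, so all of them examine
the same configuration. -/
theorem extend_spec (s : State) :
    (∃ x y l, Candidate (s.mem .S) (s.mem .T) (s.reg .cx) (s.reg .cy) (s.reg .oldL) (s.reg .oldR)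
        (s.reg .oldD) (s.reg .oldU) x y l ∧
      (extend.exec s).reg .alive = s.reg .alive ∧
      (extend.exec s).reg .cx = x ∧ (extend.exec s).reg .cy = y ∧
      (extend.exec s).reg .oldL = min (s.reg .oldL) (s.reg .cx) ∧
      (extend.exec s).reg .oldR = max (s.reg .oldR) (s.reg .cx) ∧
      (extend.exec s).reg .oldD = min (s.reg .oldD) (s.reg .cy) ∧
      (extend.exec s).reg .oldU = max (s.reg .oldU) (s.reg .cy) ∧
      (extend.exec s).mem .G = Function.update (s.mem .G) (s.reg .t) (dirCode l)) ∨
    ((∀ x y l, ¬ Candidate (s.mem .S) (s.mem .T) (s.reg .cx) (s.reg .cy) (s.reg .oldL)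
        (s.reg .oldR) (s.reg .oldD) (s.reg .oldU) x y l) ∧
      (extend.exec s).reg .alive = 0) := by
  rw [extend_exec]
  set b := boxCmd.exec s with hb
  set c1 := Cmd.ifLt (.reg .cx 1) (rg .oldL) (tryColumn (.reg .cx 1)) .skip
  set c2 := Cmd.ifLt (rg .oldR) (.reg .cx (-1)) (tryColumn (.reg .cx (-1))) .skip
  set c3 := Cmd.ifLt (.reg .cy 1) (rg .oldD) (tryRow (.reg .cy 1)) .skip
  set c4 := Cmd.ifLt (rg .oldU) (.reg .cy (-1)) (tryRow (.reg .cy (-1))) .skip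
  set u := searchCmd.exec b with hu
  have hbx := boxCmd_exec s
  rw [← hb] at hbx
  have r : ∀ r, boxCmd.writesReg r = false → b.reg r = s.reg r := fun r h => Cmd.reg_exec h s
  have m : ∀ A, b.mem A = s.mem A := fun A => Cmd.mem_exec (by cases A <;> rfl) s
  have rL : b.reg .boxL = min (s.reg .oldL) (s.reg .cx) := by rw [hbx]; rfl
  have rR : b.reg .boxR = max (s.reg .oldR) (s.reg .cx) := by rw [hbx]; rfl
  have rD : b.reg .boxD = min (s.reg .oldD) (s.reg .cy) := by rw [hbx]; rfl
  have rU : b.reg .boxU = max (s.reg .oldU) (s.reg .cy) := by rw [hbx]; rfl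
  have rf : b.reg .found = 0 := by rw [hbx]; rfl
  have hspec : TrySpec _ b u :=
    (tryColumn_spec b (.reg .cx 1) (.reg .cx 1) (rg .oldL) rfl rfl rfl rfl rfl rfl).trans <|
    (tryColumn_spec (c1.exec b) (.reg .cx (-1)) (rg .oldR) (.reg .cx (-1))
      rfl rfl rfl rfl rfl rfl).trans <|
    (tryRow_spec (c2.exec (c1.exec b)) (.reg .cy 1) (.reg .cy 1) (rg .oldD)
      rfl rfl rfl rfl rfl rfl).trans <|
    tryRow_spec (c3.exec (c2.exec (c1.exec b))) (.reg .cy (-1)) (rg .oldU) (.reg .cy (-1))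
      rfl rfl rfl rfl rfl rfl
  have q1 : ∀ r, c1.writesReg r = false → (c1.exec b).reg r = b.reg r :=
    fun r h => Cmd.reg_exec h b
  have q2 : ∀ r, c2.writesReg r = false → c1.writesReg r = false →
      (c2.exec (c1.exec b)).reg r = b.reg r :=
    fun r h h' => (Cmd.reg_exec h _).trans (q1 r h')
  have q3 : ∀ r, c3.writesReg r = false → c2.writesReg r = false → c1.writesReg r = false →
      (c3.exec (c2.exec (c1.exec b))).reg r = b.reg r :=
    fun r h h' h'' => (Cmd.reg_exec h _).trans (q2 r h' h'')
  have m1 : (c1.exec b).mem .S = s.mem .S := (Cmd.mem_exec rfl b).trans (m _)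
  have m2 : (c2.exec (c1.exec b)).mem .T = s.mem .T :=
    (Cmd.mem_exec rfl _).trans ((Cmd.mem_exec rfl b).trans (m _))
  have m3 : (c3.exec (c2.exec (c1.exec b))).mem .T = s.mem .T := (Cmd.mem_exec rfl _).trans m2
  simp only [rg, Opd.val, add_zero, m1, m2, m3, m, q3 .boxL rfl rfl rfl, q3 .boxR rfl rfl rfl,
    q3 .oldU rfl rfl rfl, q3 .cy rfl rfl rfl, q2 .boxL rfl rfl, q2 .boxR rfl rfl,
    q2 .oldD rfl rfl, q2 .cy rfl rfl, q1 .boxD rfl, q1 .boxU rfl, q1 .cx rfl, q1 .oldR rfl,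
    rL, rR, rD, rU, r .cx rfl, r .cy rfl, r .oldL rfl, r .oldR rfl, r .oldD rfl, r .oldU rfl,
    ← sub_eq_add_neg] at hspec
  have s1 : ∀ r, searchCmd.writesReg r = false → u.reg r = b.reg r := fun r h => Cmd.reg_exec h b
  have hG : u.mem .G = s.mem .G := (Cmd.mem_exec rfl b).trans (m _)
  rcases hspec with ⟨hno, hf, -⟩ | ⟨x, y, l, hP, hf, hx, hy, hd⟩
  · refine Or.inr ⟨hno, ?_⟩
    rw [rf] at hf
    simp [placeCmd, Cmd.exec, rg, Opd.val, hf, State.setReg]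
  · refine Or.inl ⟨x, y, l, hP, ?_⟩
    simp [placeCmd, Cmd.exec, rg, Opd.val, hf, State.setReg, State.setMem, hx, hy, hd,
      s1 .boxL rfl, s1 .boxR rfl, s1 .boxD rfl, s1 .boxU rfl, s1 .alive rfl, s1 .t rfl,
      r .alive rfl, r .t rfl, rL, rR, rD, rU, hG]


section

variable {n : ℕ} {σ : Equiv.Perm (Fin n)}

/-! ### The computation of a proper pin representation -/

/-- `lo` is the least of the values `f 1, …, f m`. -/
def IsMinOf (lo : ℤ) (f : ℕ → ℤ) (m : ℕ) : Prop :=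
  ∀ z, z < lo ↔ ∀ j, 1 ≤ j → j ≤ m → z < f j

/-- `hi` is the largest of the values `f 1, …, f m`. -/
def IsMaxOf (hi : ℤ) (f : ℕ → ℤ) (m : ℕ) : Prop :=
  ∀ z, hi < z ↔ ∀ j, 1 ≤ j → j ≤ m → f j < z

theorem IsMinOf.min_succ {lo : ℤ} {f : ℕ → ℤ} {m : ℕ} (h : IsMinOf lo f m) :
    IsMinOf (min lo (f (m + 1))) f (m + 1) := by
  intro z
  rw [lt_min_iff, h z]
  constructor
  · rintro ⟨h1, h2⟩ j hj hjm
    rcases hjm.eq_or_lt with rfl | hlt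
    exacts [h2, h1 j hj (by omega)]
  · exact fun h' => ⟨fun j hj hjm => h' j hj (by omega), h' _ (by omega) le_rfl⟩

theorem IsMaxOf.max_succ {hi : ℤ} {f : ℕ → ℤ} {m : ℕ} (h : IsMaxOf hi f m) :
    IsMaxOf (max hi (f (m + 1))) f (m + 1) := by
  intro z
  rw [max_lt_iff, h z]
  constructor
  · rintro ⟨h1, h2⟩ j hj hjm
    rcases hjm.eq_or_lt with rfl | hlt
    exacts [h2, h1 j hj (by omega)]
  · exact fun h' => ⟨fun j hj hjm => h' j hj (by omega), h' _ (by omega) le_rfl⟩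

theorem IsMinOf.congr {lo : ℤ} {f g : ℕ → ℤ} {m : ℕ} (h : IsMinOf lo f m)
    (hfg : ∀ j, j ≤ m → g j = f j) : IsMinOf lo g m := fun z =>
  (h z).trans ⟨fun h j hj hjm => by rw [hfg j hjm]; exact h j hj hjm,
    fun h j hj hjm => by rw [← hfg j hjm]; exact h j hj hjm⟩

theorem IsMaxOf.congr {hi : ℤ} {f g : ℕ → ℤ} {m : ℕ} (h : IsMaxOf hi f m)
    (hfg : ∀ j, j ≤ m → g j = f j) : IsMaxOf hi g m := fun z =>
  (h z).trans ⟨fun h j hj hjm => by rw [hfg j hjm]; exact h j hj hjm,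
    fun h j hj hjm => by rw [← hfg j hjm]; exact h j hj hjm⟩

/-- The points placed so far, with the last one and the bounding box of the others, are in the
registers, and the directions in the array `G`. -/
structure Placed (σ : Equiv.Perm (Fin n)) (m : ℕ) (q : ℕ → Pin) (d : ℕ → Letter) (s : State) :
    Prop where
  isWalk : IsWalk σ (m + 2) q d
  last : q (m + 2) = (s.reg .cx, s.reg .cy)
  left : IsMinOf (s.reg .oldL) (fun j => (q j).1) (m + 1)
  right : IsMaxOf (s.reg .oldR) (fun j => (q j).1) (m + 1)
  down : IsMinOf (s.reg .oldD) (fun j => (q j).2) (m + 1)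
  up : IsMaxOf (s.reg .oldU) (fun j => (q j).2) (m + 1)
  dirs : ∀ j, j < m → s.mem .G j = dirCode (d (j + 3))

theorem IsMaxOf.above_iff {hi : ℤ} {f : ℕ → ℤ} {m : ℕ} {z : ℤ} (h : IsMaxOf hi f (m + 1)) :
    max hi (f (m + 2)) < z ↔ ∀ j, 1 ≤ j → j < m + 3 → f j < z := by
  rw [h.max_succ z]
  exact ⟨fun h j hj hjm => h j hj (by omega), fun h j hj hjm => h j hj (by omega)⟩

theorem IsMinOf.below_iff {lo : ℤ} {f : ℕ → ℤ} {m : ℕ} {z : ℤ} (h : IsMinOf lo f (m + 1)) :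
    z < min lo (f (m + 2)) ↔ ∀ j, 1 ≤ j → j < m + 3 → z < f j := by
  rw [h.min_succ z]
  exact ⟨fun h j hj hjm => h j hj (by omega), fun h j hj hjm => h j hj (by omega)⟩

/-- The candidates examined by `extend` are the points that continue the walk, in a column or a row
next to that of the last point. -/
theorem Placed.candidate_iff {m : ℕ} {q : ℕ → Pin} {d : ℕ → Letter} {s : State}
    (h : Placed σ m q d s) (hs : Loaded σ s) {x y : ℤ} {l : Letter} :
    Candidate (s.mem .S) (s.mem .T) (s.reg .cx) (s.reg .cy) (s.reg .oldL) (s.reg .oldR)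
      (s.reg .oldD) (s.reg .oldU) x y l ↔
    (∃ c, (x, y) = point σ c) ∧ Turn 1 (fun j => if j = m + 3 then (x, y) else q j) (m + 3) l ∧
      (|x - s.reg .cx| = 1 ∧ (l = .U ∨ l = .D) ∨ |y - s.reg .cy| = 1 ∧ (l = .L ∨ l = .R)) := by
  have hcx : (q (m + 2)).1 = s.reg .cx := by rw [h.last]
  have hcy : (q (m + 2)).2 = s.reg .cy := by rw [h.last]
  have hL := h.left
  have hR := h.right
  have hD := h.down
  have hU := h.up
  obtain ⟨c₀, hc₀⟩ := h.isWalk.mem (m + 2) (by omega) le_rfl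
  obtain ⟨c₁, hc₁⟩ := h.isWalk.mem 1 le_rfl (by omega)
  rw [h.last] at hc₀
  have hx0 : s.reg .cx = ((c₀ : ℕ) : ℤ) := congrArg Prod.fst hc₀
  have hy0 : s.reg .cy = ((σ c₀ : ℕ) : ℤ) := congrArg Prod.snd hc₀
  have hx1 : (q 1).1 = ((c₁ : ℕ) : ℤ) := by rw [hc₁]; rfl
  have hy1 : (q 1).2 = ((σ c₁ : ℕ) : ℤ) := by rw [hc₁]; rfl
  have above : ∀ (f : Pin → ℤ) z, (∀ j, 1 ≤ j → j < m + 3 → f (q j) < z) ↔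
      ∀ j, 1 ≤ j → j < m + 3 → f (if j = m + 3 then (x, y) else q j) < z := by
    intro f z
    refine forall_congr' fun j => forall_congr' fun _ => forall_congr' fun hj => ?_
    rw [if_neg (by omega)]
  have below : ∀ (f : Pin → ℤ) z, (∀ j, 1 ≤ j → j < m + 3 → z < f (q j)) ↔
      ∀ j, 1 ≤ j → j < m + 3 → z < f (if j = m + 3 then (x, y) else q j) := by
    intro f z
    refine forall_congr' fun j => forall_congr' fun _ => forall_congr' fun hj => ?_
    rw [if_neg (by omega)]
  have col : ∀ a l', (∃ c : Fin n, a = ((c : ℕ) : ℤ)) →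
      (ColHit (s.mem .S) a (min (s.reg .oldD) (s.reg .cy)) (max (s.reg .oldU) (s.reg .cy)) x y l' ↔
        x = a ∧ (∃ c, (x, y) = point σ c) ∧
        (l' = .U ∧ Above (fun j => (if j = m + 3 then (x, y) else q j).2) 1 (m + 3) ∨
          l' = .D ∧ Below (fun j => (if j = m + 3 then (x, y) else q j).2) 1 (m + 3))) := by
    rintro _ l' ⟨c, rfl⟩
    rw [ColHit, ← hcy, hU.above_iff, hD.below_iff, above Prod.snd, below Prod.snd, hs.mem_S]
    simp only [Above, Below, if_true]
    refine and_congr_right fun hx => and_congr_left fun _ => ?_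
    constructor
    · rintro rfl; exact ⟨c, by rw [hx]; rfl⟩
    · rintro ⟨c', hc'⟩
      have h1 : x = ((c' : ℕ) : ℤ) := congrArg Prod.fst hc'
      obtain rfl : c' = c := Fin.ext (by omega)
      exact congrArg Prod.snd hc'
  have row : ∀ a l', (∃ c : Fin n, a = ((c : ℕ) : ℤ)) →
      (RowHit (s.mem .T) a (min (s.reg .oldL) (s.reg .cx)) (max (s.reg .oldR) (s.reg .cx)) x y l' ↔
        y = a ∧ (∃ c, (x, y) = point σ c) ∧
        (l' = .R ∧ Above (fun j => (if j = m + 3 then (x, y) else q j).1) 1 (m + 3) ∨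
          l' = .L ∧ Below (fun j => (if j = m + 3 then (x, y) else q j).1) 1 (m + 3))) := by
    rintro _ l' ⟨c, rfl⟩
    obtain ⟨c, rfl⟩ := σ.surjective c
    rw [RowHit, ← hcx, hR.above_iff, hL.below_iff, above Prod.fst, below Prod.fst, hs.mem_T]
    simp only [Above, Below, if_true]
    refine and_congr_right fun hy => and_congr_left fun _ => ?_
    constructor
    · rintro rfl; exact ⟨c, by rw [hy]; rfl⟩
    · rintro ⟨c', hc'⟩
      have h1 : y = ((σ c' : ℕ) : ℤ) := congrArg Prod.snd hc'
      obtain rfl : c' = c := σ.injective (Fin.ext (by omega))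
      exact congrArg Prod.fst hc'
  -- Comparing with all pins before the last one amounts to comparing with a side of their bounding
  -- box.
  have sep : ∀ (f : Pin → ℤ) (lo hi : ℤ), IsMinOf lo (fun j => f (q j)) (m + 1) →
      IsMaxOf hi (fun j => f (q j)) (m + 1) →
      (SepAt (fun j => f (if j = m + 3 then (x, y) else q j)) 1 (m + 3) ↔
        (hi < f (x, y) ∧ f (x, y) < f (q (m + 2))) ∨
        (f (x, y) < lo ∧ f (q (m + 2)) < f (x, y))) := by
    intro f lo hi hlo hhi
    rw [hlo, hhi]
    simp only [SepAt, if_true, show m + 3 - 1 = m + 2 from rfl,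
      if_neg (show ¬ m + 2 = m + 3 by omega)]
    refine or_congr (and_congr_left fun _ => ?_) (and_congr_left fun _ => ?_)
    · refine forall_congr' fun j => forall_congr' fun _ => ⟨fun h hj => ?_, fun h hj => ?_⟩
      · have := h (by omega); rwa [if_neg (by omega)] at this
      · rw [if_neg (by omega)]; exact h (by omega)
    · refine forall_congr' fun j => forall_congr' fun _ => ⟨fun h hj => ?_, fun h hj => ?_⟩
      · have := h (by omega); rwa [if_neg (by omega)] at this
      · rw [if_neg (by omega)]; exact h (by omega)
  have sepx := sep Prod.fst _ _ hL hR
  have sepy := sep Prod.snd _ _ hD hU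
  simp only [hcx] at sepx
  simp only [hcy] at sepy
  -- The first pin bounds the sides of the box. Together with the guards of the four attempts this
  -- keeps every array access within `0, …, n - 1`.
  have bL : s.reg .oldL ≤ ((c₁ : ℕ) : ℤ) := by
    by_contra hlt
    have := (hL _).1 (not_le.1 hlt) 1 le_rfl (by omega)
    simp only [hx1, lt_self_iff_false] at this
  have bR : ((c₁ : ℕ) : ℤ) ≤ s.reg .oldR := by
    by_contra hlt
    have := (hR _).1 (not_le.1 hlt) 1 le_rfl (by omega)
    simp only [hx1, lt_self_iff_false] at this
  have bD : s.reg .oldD ≤ ((σ c₁ : ℕ) : ℤ) := by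
    by_contra hlt
    have := (hD _).1 (not_le.1 hlt) 1 le_rfl (by omega)
    simp only [hy1, lt_self_iff_false] at this
  have bU : ((σ c₁ : ℕ) : ℤ) ≤ s.reg .oldU := by
    by_contra hlt
    have := (hU _).1 (not_le.1 hlt) 1 le_rfl (by omega)
    simp only [hy1, lt_self_iff_false] at this
  have range : ∀ z : ℤ, 0 ≤ z → z < n → ∃ c : Fin n, z = ((c : ℕ) : ℤ) := fun z h0 hn =>
    ⟨⟨z.toNat, by omega⟩, by simp only; omega⟩
  have e1 := fun (h : s.reg .cx + 1 < s.reg .oldL) =>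
    col (s.reg .cx + 1) l (range _ (by omega) (by omega))
  have e2 := fun (h : s.reg .oldR < s.reg .cx - 1) =>
    col (s.reg .cx - 1) l (range _ (by omega) (by omega))
  have e3 := fun (h : s.reg .cy + 1 < s.reg .oldD) =>
    row (s.reg .cy + 1) l (range _ (by omega) (by omega))
  have e4 := fun (h : s.reg .oldU < s.reg .cy - 1) =>
    row (s.reg .cy - 1) l (range _ (by omega) (by omega))
  have a1 : ∀ z : ℤ, |z| = 1 ↔ z = 1 ∨ z = -1 := fun z => abs_eq (by omega)
  rw [Candidate, and_congr_right e1, and_congr_right e2, and_congr_right e3, and_congr_right e4,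
    a1, a1]
  generalize (∃ c, (x, y) = point σ c) = P
  cases l <;> simp only [Turn, sepx, sepy, reduceCtorEq, false_and, and_false, true_and, or_false,
    false_or, and_true, or_self, or_true]
  · generalize Above _ _ _ = A
    by_cases hP : P <;> by_cases hA : A <;>
      simp only [hP, hA, and_true, and_false, true_and, false_and, or_false]
    omega
  · generalize Below _ _ _ = A
    by_cases hP : P <;> by_cases hA : A <;>
      simp only [hP, hA, and_true, and_false, true_and, false_and, or_false]
    omega
  · generalize Below _ _ _ = A
    by_cases hP : P <;> by_cases hA : A <;>
      simp only [hP, hA, and_true, and_false, true_and, false_and, or_false]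
    omega
  · generalize Above _ _ _ = A
    by_cases hP : P <;> by_cases hA : A <;>
      simp only [hP, hA, and_true, and_false, true_and, false_and, or_false]
    omega

/-- The points that continue a walk through the whole diagram are found. -/
theorem IsWalk.adjacent {q : ℕ → Pin} {d : ℕ → Letter} (h : IsWalk σ n q d) {i : ℕ} (hi : 3 ≤ i)
    (hin : i ≤ n) :
    |(q i).1 - (q (i - 1)).1| = 1 ∧ (d i = .U ∨ d i = .D) ∨
      |(q i).2 - (q (i - 1)).2| = 1 ∧ (d i = .L ∨ d i = .R) := by
  have key : ∀ x y : ℕ → ℤ, FullWalk x y n → SepAt x 1 i → |x i - x (i - 1)| = 1 := by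
    rintro x y hf (⟨h1, h2⟩ | ⟨h1, h2⟩)
    · rw [hf.eq_sub_one hi hin h1 h2, abs_eq (by omega)]; omega
    · rw [hf.eq_add_one hi hin h1 h2, abs_eq (by omega)]; omega
  have ht := h.turn i hi hin
  have hx := key _ _ h.fullWalk
  have hy := key _ _ h.fullWalk.symm
  generalize d i = l at ht ⊢
  cases l <;> simp only [Turn] at ht
  · exact Or.inl ⟨hx ht.1, by simp⟩
  · exact Or.inl ⟨hx ht.1, by simp⟩
  · exact Or.inr ⟨hy ht.1, by simp⟩
  · exact Or.inr ⟨hy ht.1, by simp⟩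

/-- The state of the computation of the representation beginning with the points in columns `a` and
`b`, when `m` points after these have been looked for. -/
def Building (σ : Equiv.Perm (Fin n)) (a b : Fin n) (m : ℕ) (s : State) : Prop :=
  (s.reg .alive = 1 ∧ ∃ q d, Placed σ m q d s ∧ q 1 = point σ a ∧ q 2 = point σ b) ∨
  (s.reg .alive = 0 ∧ ∀ q d, IsWalk σ n q d → q 1 = point σ a → q 2 = point σ b → False)

/-- A hit extends the walk. If there is none, a walk through the whole diagram with this start is
impossible: it would agree with the points placed so far, and its next point, being adjacent to the
last one, would be a candidate. -/
theorem Building.step {a b : Fin n} {m : ℕ} {s : State} (h : Building σ a b m s)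
    (hs : Loaded σ s) (ht : s.reg .t = m) (hm : m + 2 < n) :
    Building σ a b (m + 1) ((Cmd.ifEq (rg .alive) (.lit 1) extend .skip).exec s) := by
  rcases h with ⟨hal, q, d, h, ha, hb⟩ | ⟨hal, h⟩
  swap
  · refine Or.inr ⟨?_, h⟩
    simp [Cmd.exec, rg, Opd.val, hal]
  have hexec : (Cmd.ifEq (rg .alive) (.lit 1) extend .skip).exec s = extend.exec s := by
    simp [Cmd.exec, rg, Opd.val, hal]
  rw [hexec]
  have hcx : (q (m + 2)).1 = s.reg .cx := by rw [h.last]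
  have hcy : (q (m + 2)).2 = s.reg .cy := by rw [h.last]
  rcases extend_spec s with ⟨x, y, l, hc, e1, e2, e3, e4, e5, e6, e7, e8⟩ | ⟨hno, e1⟩
  · obtain ⟨⟨c, hxy⟩, hturn, -⟩ := (h.candidate_iff hs).1 hc
    set q' : ℕ → Pin := fun j => if j = m + 3 then (x, y) else q j with hq'
    have hqq : ∀ j, j ≤ m + 2 → q' j = q j := fun j hj => if_neg (by omega)
    refine Or.inl ⟨e1.trans hal, q', fun j => if j = m + 3 then l else d j, ⟨⟨?_, ?_, ?_⟩, ?_, ?_,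
      ?_, ?_, ?_, ?_⟩, (hqq 1 (by omega)).trans ha, (hqq 2 (by omega)).trans hb⟩
    · intro i hi him
      rcases eq_or_ne i (m + 3) with rfl | hne
      · exact ⟨c, (if_pos rfl).trans hxy⟩
      · rw [hqq i (by omega)]
        exact h.isWalk.mem i hi (by omega)
    · intro _
      rw [hqq 1 (by omega), hqq 2 (by omega)]
      exact h.isWalk.start (by omega)
    · intro i hi him
      rcases eq_or_ne i (m + 3) with rfl | hne
      · simpa only [if_true] using hturn
      · simp only [if_neg hne]
        exact (h.isWalk.turn i hi (by omega)).congr (by omega)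
          fun j _ hj => (hqq j (by omega)).symm
    · rw [e2, e3]; exact if_pos rfl
    · rw [e4, ← hcx]
      exact h.left.min_succ.congr fun j hj => by rw [hqq j hj]
    · rw [e5, ← hcx]
      exact h.right.max_succ.congr fun j hj => by rw [hqq j hj]
    · rw [e6, ← hcy]
      exact h.down.min_succ.congr fun j hj => by rw [hqq j hj]
    · rw [e7, ← hcy]
      exact h.up.max_succ.congr fun j hj => by rw [hqq j hj]
    · intro j hj
      rw [e8, ht]
      rcases eq_or_ne j m with rfl | hne
      · simp
      · rw [Function.update_of_ne (by omega), if_neg (by omega)]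
        exact h.dirs j (by omega)
  · refine Or.inr ⟨e1, fun Q D hQ hQa hQb => ?_⟩
    have heq := h.isWalk.eq_of_start hQ (ha.trans hQa.symm) (hb.trans hQb.symm)
    refine hno (Q (m + 3)).1 (Q (m + 3)).2 (D (m + 3)) ((h.candidate_iff hs).2 ⟨?_, ?_, ?_⟩)
    · exact hQ.mem (m + 3) (by omega) (by omega)
    · refine (hQ.turn (m + 3) (by omega) (by omega)).congr (by omega) fun j hj hjm => ?_
      split_ifs with hj3
      · rw [hj3]
      · exact (heq j hj (by omega)).symm
    · rw [← hcx, ← hcy, heq (m + 2) (by omega) le_rfl]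
      exact hQ.adjacent (i := m + 3) (by omega) (by omega)

/-- The first part of `buildRepresentation`: the first two points are placed. -/
def startCmd : Cmd :=
  .load .x1 .E (rg .k) ;; .load .y1 .S (rg .x1) ;;
  .load .x2 .F (rg .k) ;; .load .y2 .S (rg .x2) ;;
  .set .oldL (rg .x1) ;; .set .oldR (rg .x1) ;; .set .oldD (rg .y1) ;; .set .oldU (rg .y1) ;;
  .set .cx (rg .x2) ;; .set .cy (rg .y2) ;;
  .set .alive (.lit 1)

theorem buildRepresentation_spec {s : State} {a b : Fin n} (hn : 3 ≤ n) (hab : a ≠ b)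
    (hs : Loaded σ s) (hE : s.mem .E (s.reg .k) = ((a : ℕ) : ℤ))
    (hF : s.mem .F (s.reg .k) = ((b : ℕ) : ℤ)) :
    Building σ a b (n - 2) (buildRepresentation.exec s) ∧
    (((buildRepresentation.exec s).reg .x1, (buildRepresentation.exec s).reg .y1) = point σ a) ∧
    (((buildRepresentation.exec s).reg .x2, (buildRepresentation.exec s).reg .y2) = point σ b) := by
  set loop := Cmd.loop .t (.reg .n (-2)) (.ifEq (rg .alive) (.lit 1) extend .skip) with hloop
  set u := startCmd.exec s with hu
  have hexec : buildRepresentation.exec s = loop.exec u := by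
    simp only [buildRepresentation, hu, startCmd, Cmd.exec_seq, hloop]
  rw [hexec]
  have hSa := hs.mem_S a
  have hSb := hs.mem_S b
  have hus : Loaded σ u := hs.exec rfl rfl rfl
  have hregs : u.reg .x1 = ((a : ℕ) : ℤ) ∧ u.reg .y1 = ((σ a : ℕ) : ℤ) ∧
      u.reg .x2 = ((b : ℕ) : ℤ) ∧ u.reg .y2 = ((σ b : ℕ) : ℤ) ∧
      u.reg .oldL = ((a : ℕ) : ℤ) ∧ u.reg .oldR = ((a : ℕ) : ℤ) ∧
      u.reg .oldD = ((σ a : ℕ) : ℤ) ∧ u.reg .oldU = ((σ a : ℕ) : ℤ) ∧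
      u.reg .cx = ((b : ℕ) : ℤ) ∧ u.reg .cy = ((σ b : ℕ) : ℤ) ∧ u.reg .alive = 1 := by
    simp [hu, startCmd, Cmd.exec, State.setReg, Opd.val, rg, hE, hF, hSa, hSb]
  obtain ⟨h1, h2, h3, h4, h5, h6, h7, h8, h9, h10, h11⟩ := hregs
  refine ⟨?_, ?_, ?_⟩
  · rw [hloop, Cmd.exec_loop (m := n - 2) (by simp only [Opd.val, hus.reg_n]; omega)]
    have key : ∀ m : ℕ, m ≤ n - 2 → Building σ a b m
        ((Cmd.loop .t (.lit m) (.ifEq (rg .alive) (.lit 1) extend .skip)).exec u) := by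
      intro m
      induction m with
      | zero =>
        intro _
        rw [Cmd.exec_loop_zero]
        have aux1 : ∀ f : ℕ → ℤ, IsMinOf (f 1) f 1 := fun f z =>
          ⟨fun h j hj hj1 => by rwa [show j = 1 by omega], fun h => h 1 le_rfl le_rfl⟩
        have aux2 : ∀ f : ℕ → ℤ, IsMaxOf (f 1) f 1 := fun f z =>
          ⟨fun h j hj hj1 => by rwa [show j = 1 by omega], fun h => h 1 le_rfl le_rfl⟩
        -- No direction has been used yet, so `.U` is a dummy value.
        refine Or.inl ⟨h11, fun j => if j = 1 then point σ a else point σ b, fun _ => .U,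
          ⟨⟨?_, ?_, ?_⟩, ?_, ?_, ?_, ?_, ?_, ?_⟩, rfl, rfl⟩
        · intro i _ _
          split_ifs
          exacts [⟨a, rfl⟩, ⟨b, rfl⟩]
        · exact fun _ h => hab (point_injective σ h)
        · intro i hi hi'; omega
        · rw [h9, h10]; rfl
        · rw [h5]; exact aux1 fun j => (if j = 1 then point σ a else point σ b).1
        · rw [h6]; exact aux2 fun j => (if j = 1 then point σ a else point σ b).1
        · rw [h7]; exact aux1 fun j => (if j = 1 then point σ a else point σ b).2
        · rw [h8]; exact aux2 fun j => (if j = 1 then point σ a else point σ b).2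
        · intro j hj; omega
      | succ m ih =>
        intro hm
        rw [Cmd.exec_loop_succ]
        set v := (Cmd.loop .t (.lit (m : ℕ)) (.ifEq (rg .alive) (.lit 1) extend .skip)).exec u
          with hv
        have hvs : Loaded σ v := hus.exec rfl rfl rfl
        -- The invariant does not mention the loop counter `t`.
        have hvm : Building σ a b m (v.setReg .t m) := by
          rcases ih (by omega) with ⟨g1, q, d, g2, g3⟩ | g
          · exact Or.inl ⟨g1, q, d, ⟨g2.1, g2.2, g2.3, g2.4, g2.5, g2.6, g2.7⟩, g3⟩
          · exact Or.inr g
        exact hvm.step (hvs.setReg (by decide) _) rfl (by omega)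
    exact key (n - 2) le_rfl
  · rw [Cmd.reg_exec (r := .x1) rfl, Cmd.reg_exec (r := .y1) rfl, h1, h2]; rfl
  · rw [Cmd.reg_exec (r := .x2) rfl, Cmd.reg_exec (r := .y2) rfl, h3, h4]; rfl

/-! ### The output of the words -/

def IsDirection (l : Letter) : Prop := l = .U ∨ l = .D ∨ l = .L ∨ l = .R

theorem Turn.isDirection {a i : ℕ} {q : ℕ → Pin} {l : Letter} (h : Turn a q i l) :
    IsDirection l := by
  cases l <;> simp [Turn, IsDirection] at h ⊢

/-- The four codes are distinct and emitting does not change `dir`, so exactly one of the tests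
fires. -/
theorem emitStored_exec {s : State} {l : Letter} (hl : IsDirection l)
    (hd : s.reg .dir = dirCode l) :
    (seqs ([.U, .D, .L, .R].map emitStored)).exec s = { s with cur := s.cur ++ [l] } := by
  rcases hl with rfl | rfl | rfl | rfl <;>
    simp [seqs, emitStored, Cmd.exec, Opd.val, rg, hd, dirCode]

theorem outputWord_exec {s : State} (hn : 3 ≤ n) (hs : s.reg .n = n) (hcur : s.cur = [])
    {d : ℕ → Letter} (hG : ∀ j, j < n - 2 → s.mem .G j = dirCode (d (j + 3)))
    (hd : ∀ j, j < n - 2 → IsDirection (d (j + 3))) (w : Letter × Letter) :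
    ((outputWord w).exec s).cur = [] ∧
      ((outputWord w).exec s).words = s.words ++ [wordOf n w d] := by
  set body : Cmd := .load .dir .G (rg .s) ;; seqs ([.U, .D, .L, .R].map emitStored) with hbody
  set u := (Cmd.emit w.1 ;; Cmd.emit w.2).exec s with hu
  have hexec : (outputWord w).exec s =
      Cmd.flush.exec ((Cmd.loop .s (.reg .n (-2)) body).exec u) := by
    simp only [outputWord, Cmd.exec_seq, hu, hbody]
  have key : ∀ m : ℕ, m ≤ n - 2 →
      ((Cmd.loop .s (.lit m) body).exec u).cur =
        w.1 :: w.2 :: (List.range m).map (fun t => d (t + 3)) ∧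
      ((Cmd.loop .s (.lit m) body).exec u).words = s.words := by
    intro m
    induction m with
    | zero =>
      intro _
      rw [Cmd.exec_loop_zero]
      simp [hu, Cmd.exec, hcur]
    | succ m ih =>
      intro hm
      obtain ⟨ih1, ih2⟩ := ih (by omega)
      rw [Cmd.exec_loop_succ]
      set v := (Cmd.loop .s (.lit (m : ℕ)) body).exec u with hv
      have hvG : v.mem .G (m : ℤ) = dirCode (d (m + 3)) := by
        rw [hv, Cmd.mem_exec rfl, hu, Cmd.mem_exec rfl]
        exact hG m (by omega)
      have hx := emitStored_exec (s := (Cmd.load .dir .G (rg .s)).exec (v.setReg .s m))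
        (hd m (by omega)) (by simp [Cmd.exec, State.setReg, Opd.val, rg, hvG])
      have hb : body.exec (v.setReg .s m) = _ := hx
      rw [hb]
      refine ⟨?_, ih2⟩
      change v.cur ++ [d (m + 3)] = _
      rw [ih1, List.range_succ, List.map_append]
      rfl
  have hun : u.reg .n = n := (Cmd.reg_exec rfl s).trans hs
  obtain ⟨h1, h2⟩ := key (n - 2) le_rfl
  rw [hexec, Cmd.exec_loop (m := n - 2) (by simp only [Opd.val, hun]; omega)]
  refine ⟨rfl, ?_⟩
  change ((Cmd.loop .s (.lit (n - 2 : ℕ)) body).exec u).words ++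
    [((Cmd.loop .s (.lit (n - 2 : ℕ)) body).exec u).cur] = _
  rw [h1, h2]
  rfl

theorem seqs_outputWord_exec (hn : 3 ≤ n) {d : ℕ → Letter}
    (hd : ∀ j, j < n - 2 → IsDirection (d (j + 3))) (l : List (Letter × Letter)) :
    ∀ {s : State}, s.reg .n = n → s.cur = [] →
      (∀ j, j < n - 2 → s.mem .G j = dirCode (d (j + 3))) →
      ((seqs (l.map outputWord)).exec s).reg .n = n ∧
      ((seqs (l.map outputWord)).exec s).cur = [] ∧
      ((seqs (l.map outputWord)).exec s).mem .G = s.mem .G ∧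
      ((seqs (l.map outputWord)).exec s).words = s.words ++ l.map fun w => wordOf n w d := by
  induction l with
  | nil => intro s hs hcur _; exact ⟨hs, hcur, rfl, by simp [seqs, Cmd.exec]⟩
  | cons w l ih =>
    intro s hs hcur hG
    obtain ⟨h1, h2⟩ := outputWord_exec hn hs hcur hG hd w
    have hGw : ((outputWord w).exec s).mem .G = s.mem .G := Cmd.mem_exec rfl s
    obtain ⟨g1, g2, g3, g4⟩ := ih (s := (outputWord w).exec s) ((Cmd.reg_exec rfl s).trans hs) h1
      (by rw [hGw]; exact hG)
    refine ⟨g1, g2, g3.trans hGw, g4.trans ?_⟩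
    rw [h2]; simp

theorem outputPlacements_exec (hn : 3 ≤ n) {d : ℕ → Letter}
    (hd : ∀ j, j < n - 2 → IsDirection (d (j + 3))) {s : State} (hs : s.reg .n = n)
    (hcur : s.cur = []) (hG : ∀ j, j < n - 2 → s.mem .G j = dirCode (d (j + 3)))
    (l₁ l₂ l₃ : List (Letter × Letter)) :
    ((outputPlacements l₁ l₂ l₃).exec s).cur = [] ∧
    ((outputPlacements l₁ l₂ l₃).exec s).words = s.words ++
      (l₁ ++ if dirCode (d 3) < 3 then l₂ else l₃).map fun w => wordOf n w d := by
  obtain ⟨h1, h2, h3, h4⟩ := seqs_outputWord_exec hn hd l₁ hs hcur hG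
  set u := (seqs (l₁.map outputWord)).exec s with hu
  set v := (Cmd.load .w .G (.lit 0)).exec u with hv
  have hexec : (outputPlacements l₁ l₂ l₃).exec s =
      (Cmd.ifLt (rg .w) (.lit 3) (seqs (l₂.map outputWord)) (seqs (l₃.map outputWord))).exec v := by
    simp only [outputPlacements, Cmd.exec_seq, hu, hv]
  -- The cell `0` of `G` holds the direction of the third pin, which selects the list.
  have hw : v.reg .w = dirCode (d 3) := by
    have := hG 0 (by omega)
    rw [← h3] at this
    simpa [hv, Cmd.exec, State.setReg, Opd.val] using this
  have hvG : ∀ j : ℕ, j < n - 2 → v.mem .G j = dirCode (d (j + 3)) := by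
    intro j hj
    have : v.mem .G = u.mem .G := rfl
    rw [this, h3]
    exact hG j hj
  have hvn : v.reg .n = n := (Cmd.reg_exec rfl u).trans h1
  have hvw : v.words = u.words := rfl
  have hvc : v.cur = [] := h2
  rw [hexec]
  simp only [Cmd.exec, rg, Opd.val, hw, add_zero]
  split_ifs
  · obtain ⟨-, g2, -, g4⟩ := seqs_outputWord_exec hn hd l₂ hvn hvc hvG
    exact ⟨g2, by rw [g4, hvw, h4, List.map_append, List.append_assoc]⟩
  · obtain ⟨-, g2, -, g4⟩ := seqs_outputWord_exec hn hd l₃ hvn hvc hvG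
    exact ⟨g2, by rw [g4, hvw, h4, List.map_append, List.append_assoc]⟩

theorem outputWords_exec (hn : 3 ≤ n) {d : ℕ → Letter}
    (hd : ∀ j, j < n - 2 → IsDirection (d (j + 3))) {s : State} (hs : s.reg .n = n)
    (hcur : s.cur = []) (hG : ∀ j, j < n - 2 → s.mem .G j = dirCode (d (j + 3))) :
    (outputWords.exec s).cur = [] ∧
    (outputWords.exec s).words = s.words ++
      (firstLetters (s.reg .x1, s.reg .y1) (s.reg .x2, s.reg .y2) (d 3)).map
        fun w => wordOf n w d := by
  simp only [outputWords, firstLetters, Cmd.exec, rg, Opd.val, add_zero]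
  by_cases h1 : s.reg .x1 < s.reg .x2 <;> by_cases h2 : s.reg .y1 < s.reg .y2 <;>
    simp only [h1, h2, if_true, if_false] <;>
    exact outputPlacements_exec hn hd hs hcur hG _ _ _

end


section

variable {n : ℕ} {σ : Equiv.Perm (Fin n)}

/-! ### The procedure `PinWords` -/

/-- The words encoding representations that begin with the points in columns `a` and `b`. -/
def WordFrom (σ : Equiv.Perm (Fin n)) (a b : Fin n) (w : List Letter) : Prop :=
  ∃ q d, IsWalk σ n q d ∧ q 1 = point σ a ∧ q 2 = point σ b ∧
    ∃ ab ∈ firstLetters (q 1) (q 2) (d 3), w = wordOf n ab d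

theorem IsKnight.ne {a b : Fin n} (h : IsKnight σ a b) : a ≠ b := by
  rintro rfl
  rcases h with h | h <;> simp at h

theorem wordOf_congr {ab : Letter × Letter} {d d' : ℕ → Letter}
    (h : ∀ i, 3 ≤ i → i ≤ n → d i = d' i) : wordOf n ab d = wordOf n ab d' := by
  simp only [wordOf]
  congr 2
  refine List.map_congr_left fun t ht => h _ (by omega) ?_
  rw [List.mem_range] at ht
  omega

/-- The words output for one knight pair. -/
theorem knightPair_spec {s : State} {a b : Fin n} (hn : 3 ≤ n) (hab : a ≠ b)
    (hs : Loaded σ s) (hE : s.mem .E (s.reg .k) = ((a : ℕ) : ℤ))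
    (hF : s.mem .F (s.reg .k) = ((b : ℕ) : ℤ)) (hcur : s.cur = []) :
    ((buildRepresentation ;; .ifEq (rg .alive) (.lit 1) outputWords .skip).exec s).cur = [] ∧
    ∀ w, w ∈ ((buildRepresentation ;; .ifEq (rg .alive) (.lit 1) outputWords .skip).exec s).words ↔
      w ∈ s.words ∨ WordFrom σ a b w := by
  obtain ⟨hb, h1, h2⟩ := buildRepresentation_spec hn hab hs hE hF
  rw [Cmd.exec_seq]
  set u := buildRepresentation.exec s with hu
  obtain ⟨hc, hw⟩ := Cmd.out_exec (c := buildRepresentation) rfl s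
  rw [← hu] at hc hw
  have hus : Loaded σ u := hs.exec rfl rfl rfl
  rcases hb with ⟨hal, q, d, hp, hqa, hqb⟩ | ⟨hal, hno⟩
  · have hwalk : IsWalk σ n q d := by
      have := hp.isWalk
      rwa [show n - 2 + 2 = n by omega] at this
    have hexec : (Cmd.ifEq (rg .alive) (.lit 1) outputWords .skip).exec u = outputWords.exec u := by
      simp [Cmd.exec, rg, Opd.val, hal]
    obtain ⟨g1, g2⟩ := outputWords_exec hn
      (fun j hj => (hwalk.turn (j + 3) (by omega) (by omega)).isDirection) hus.reg_n
      (hc.trans hcur) hp.dirs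
    rw [hexec]
    refine ⟨g1, fun w => ?_⟩
    rw [g2, hw, h1, h2, List.mem_append, List.mem_map]
    refine or_congr_right ?_
    constructor
    · rintro ⟨ab, hab, rfl⟩
      exact ⟨q, d, hwalk, hqa, hqb, ab, by rwa [hqa, hqb], rfl⟩
    -- Any walk with this start has the directions of the computed one, hence yields the same words.
    · rintro ⟨q', d', hwalk', hqa', hqb', ab, hab, rfl⟩
      have hd : ∀ i, 3 ≤ i → i ≤ n → d i = d' i := fun i hi hin =>
        hwalk.letter_eq hwalk' le_rfl (hqa.trans hqa'.symm) (hqb.trans hqb'.symm) hi hin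
      refine ⟨ab, ?_, wordOf_congr hd⟩
      rwa [hqa', hqb', ← hd 3 le_rfl hn] at hab
  · have hexec : (Cmd.ifEq (rg .alive) (.lit 1) outputWords .skip).exec u = u := by
      simp [Cmd.exec, rg, Opd.val, hal]
    rw [hexec]
    refine ⟨hc.trans hcur, fun w => ?_⟩
    rw [hw]
    refine ⟨Or.inl, fun h => h.resolve_right ?_⟩
    rintro ⟨q, d, hwalk, hqa, hqb, -⟩
    exact hno q d hwalk hqa hqb

/-- Every pin word comes from a walk, whose first two points are a knight pair and thus are tried.
Giving up beyond 48 pairs loses nothing, because then `σ` is not a pin-permutation and has no pin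
words. -/
theorem pinWords_words (hσ : IsSimple σ) (hn : 3 ≤ n) (w : List Letter) :
    w ∈ (pinWords.exec (input σ)).words ↔ IsPinWordOf w σ := by
  set s₁ := invert.exec (input σ) with hs1
  have hl1 : Loaded σ s₁ := loaded_invert σ
  obtain ⟨l, hm, hEF, hnd, hl⟩ := findKnights_spec hl1
  set s := findKnights.exec s₁ with hs
  have hls : Loaded σ s := hl1.exec rfl rfl rfl
  have hout : s.cur = [] ∧ s.words = [] := by
    obtain ⟨a1, a2⟩ := Cmd.out_exec (c := findKnights) rfl s₁
    obtain ⟨b1, b2⟩ := Cmd.out_exec (c := invert) rfl (input σ)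
    exact ⟨a1.trans b1, a2.trans b2⟩
  set body := (buildRepresentation ;; .ifEq (rg .alive) (.lit 1) outputWords .skip) with hbody
  have hexec : pinWords.exec (input σ) =
      (Cmd.ifLt (.lit 48) (rg .m) .skip (.loop .k (rg .m) body)).exec s := by
    simp only [pinWords, Cmd.exec_seq, hs, hs1, hbody]
  have hval : (rg .m).val s = l.length := by simp [rg, Opd.val, hm]
  have hiff : IsPinWordOf w σ ↔ ∃ a b, IsKnight σ a b ∧ WordFrom σ a b w := by
    constructor
    · intro h
      obtain ⟨q, d, hwalk, hw⟩ := h.exists_isWalk hσ hn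
      obtain ⟨a, ha⟩ := hwalk.mem 1 le_rfl (by omega)
      obtain ⟨b, hb⟩ := hwalk.mem 2 (by omega) (by omega)
      exact ⟨a, b, hwalk.isKnight_start hn ha hb, q, d, hwalk, ha, hb, hw⟩
    · rintro ⟨a, b, -, q, d, hwalk, -, -, ab, hab, rfl⟩
      exact hwalk.isPinWordOf hn hab
  rw [hexec]
  by_cases h48 : 48 < l.length
  · have hskip : (Cmd.ifLt (.lit 48) (rg .m) .skip (.loop .k (rg .m) body)).exec s = s := by
      simp only [Cmd.exec, hval]
      rw [if_pos]
      simp only [Opd.val]; omega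
    rw [hskip, hout.2]
    refine ⟨fun h => absurd h List.not_mem_nil, fun h => absurd h48 ?_⟩
    obtain ⟨p, e, hp, -⟩ := h
    have := hσ.ncard_knights_le ⟨p, e, hp⟩
    have hset : {q : Fin n × Fin n | IsKnight σ q.1 q.2} = (l.toFinset : Set (Fin n × Fin n)) := by
      ext q; simp [hl]
    rw [hset, Set.ncard_coe_finset, List.toFinset_card_of_nodup hnd] at this
    omega
  · have hloop : (Cmd.ifLt (.lit 48) (rg .m) .skip (.loop .k (rg .m) body)).exec s =
        (Cmd.loop .k (.lit l.length) body).exec s := by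
      rw [← Cmd.exec_loop hval]
      simp only [Cmd.exec, hval]
      rw [if_neg]
      simp only [Opd.val]; omega
    rw [hloop]
    have key : ∀ m : ℕ, m ≤ l.length → ((Cmd.loop .k (.lit m) body).exec s).cur = [] ∧
        ∀ w, w ∈ ((Cmd.loop .k (.lit m) body).exec s).words ↔
          ∃ (k : ℕ) (hk : k < l.length), k < m ∧ WordFrom σ l[k].1 l[k].2 w := by
      intro m
      induction m with
      | zero => intro _; rw [Cmd.exec_loop_zero]; exact ⟨hout.1, by simp [hout.2]⟩
      | succ m ih =>
        intro hm
        obtain ⟨ih1, ih2⟩ := ih (by omega)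
        rw [Cmd.exec_loop_succ]
        set u := (Cmd.loop .k (.lit (m : ℕ)) body).exec s with hu
        have hlu : Loaded σ u := hls.exec rfl rfl rfl
        have hE : u.mem .E = s.mem .E := Cmd.mem_exec rfl s
        have hF : u.mem .F = s.mem .F := Cmd.mem_exec rfl s
        obtain ⟨g1, g2⟩ := knightPair_spec (s := u.setReg .k m) hn
          ((hl l[m]).1 (List.getElem_mem _)).ne (hlu.setReg (by decide) _)
          ((congrFun hE _).trans (hEF m hm).1) ((congrFun hF _).trans (hEF m hm).2) ih1
        refine ⟨g1, fun w => (g2 w).trans ?_⟩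
        rw [show (u.setReg .k m).words = u.words from rfl, ih2]
        constructor
        · rintro (⟨k, hk, hkm, h⟩ | h)
          exacts [⟨k, hk, by omega, h⟩, ⟨m, hm, by omega, h⟩]
        · rintro ⟨k, hk, hkm, h⟩
          rcases Nat.lt_succ_iff_lt_or_eq.1 hkm with hlt | rfl
          exacts [Or.inl ⟨k, hk, hlt, h⟩, Or.inr h]
    rw [(key _ le_rfl).2, hiff]
    constructor
    · rintro ⟨k, hk, -, h⟩
      exact ⟨_, _, (hl l[k]).1 (List.getElem_mem _), h⟩
    · rintro ⟨a, b, hab, h⟩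
      obtain ⟨k, hk, hkl⟩ := List.getElem_of_mem ((hl (a, b)).2 hab)
      exact ⟨k, hk, hk, by rwa [hkl]⟩

theorem exists_pinWords_cost_le : ∃ C : ℕ, ∀ (n : ℕ) (σ : Equiv.Perm (Fin n)), 3 ≤ n →
    pinWords.cost (input σ) ≤ C * n := by
  -- The factor 2 absorbs `n + 1 ≤ 2 * n`.
  refine ⟨2 * (invert.slope + findKnights.slope + 4 + 48 * (1 +
    (buildRepresentation ;; .ifEq (rg .alive) (.lit 1) outputWords .skip).slope)),
    fun n σ hn => ?_⟩
  refine (pinWords_cost_le (m := n) rfl).trans ?_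
  generalize invert.slope + findKnights.slope + 4 + 48 * (1 +
    (buildRepresentation ;; .ifEq (rg .alive) (.lit 1) outputWords .skip).slope) = c
  nlinarith

end

end PinPerm

theorem mainTheorem6 :
    (∃ C : ℕ, ∀ (n : ℕ) (σ : Equiv.Perm (Fin n)), 3 ≤ n → PinPerm.IsSimple σ →
      {w | w ∈ (PinPerm.pinWords.exec (PinPerm.input σ)).words} = {w | PinPerm.IsPinWordOf w σ} ∧
      PinPerm.pinWords.cost (PinPerm.input σ) ≤ C * n) ∧
    (∀ (n : ℕ) (σ : Equiv.Perm (Fin n)), PinPerm.IsSimple σ → PinPerm.IsPinPermutation σ →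
      {q : Fin n × Fin n | PinPerm.IsKnight σ q.1 q.2}.ncard ≤ 48) ∧
    (∀ (n : ℕ) (σ : Equiv.Perm (Fin n)) (x y : Fin n), PinPerm.IsKnight σ x y →
      ∀ (p p' : ℕ → PinPerm.Pin) (e e' : Equiv.Perm (Fin n)),
        PinPerm.IsProperPinRepresentation σ p e → PinPerm.BeginsWith e x y →
        PinPerm.IsProperPinRepresentation σ p' e' → PinPerm.BeginsWith e' x y → e = e') := by
  refine ⟨?_, fun n σ hσ h => hσ.ncard_knights_le h, fun n σ x y _ p p' e e' h hb h' hb' =>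
    PinPerm.properPinRepresentation_unique h hb h' hb'⟩
  obtain ⟨C, hC⟩ := PinPerm.exists_pinWords_cost_le
  exact ⟨C, fun n σ hn hσ => ⟨Set.ext fun w => PinPerm.pinWords_words hσ hn w, hC n σ hn⟩⟩
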